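/- Finite types are generated from the ground types $0$ (natural numbers), $\Omega$ (sample space) and $S$ (events) by forming $\tau(\rho)$ (functions from $\rho$ to $\tau$); the pure types are $0$ and $n+1:=0(n)$. A type is small if it is $\rho_0(0)\ldots(0)$, and admissible if it is $\rho_0(\sigma_k)\ldots(\sigma_1)$ with all $\sigma_i$ small, where $\rho_0\in\{0,\Omega,S\}$. A $\forall$-formula ($\exists$-formula) is a quantifier-free formula preceded by a block of universal (existential) quantifiers of admissible types. Let $\mathcal{F}^\omega[\mathbb{P}]$ be the classical system consisting of weakly extensional Peano arithmetic in all these types (equality of type $0$, induction, combinators, simultaneous primitive recursion, and the quantifier-free rule of extensionality), the schemata of quantifier-free choice and of dependent choice, and constants and axioms stating that $S$ is an algebra of events over the non-empty sample space $\Omega$ and that $\mathbb{P}$, of type $1(S)$, is a probability content on it. Real numbers are represented by objects of type $1$ coding Cauchy sequences of rationals with modulus $2^{-n}$. For a pure type $\rho$, $\mathrm{UB}^{\Omega}_{\rho}$ is the schema $$\forall y^{\alpha(0)}\bigl(\forall k^0,x^\alpha,\underline z^{\underline\beta}\,\exists w^\rho\,\psi(y,k,\min\nolimits_\alpha(x,yk),\underline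 z,w)\to\exists\chi^{\rho(0)}\forall k^0,x^\alpha,\underline z^{\underline\beta}\,\exists w\le_\rho\chi k\;\psi(y,k,\min\nolimits_\alpha(x,yk),\underline z,w)\bigr),$$ where $\alpha=0(\sigma_k)\ldots(\sigma_1)$, each type in $\underline\beta$ has the form $\Omega(\tau_m)\ldots(\tau_1)$, and $\psi$ is an $\exists$-formula, possibly with further parameters; inequality and minimum are pointwise. $\mathrm{UB}^{S}_{\rho}$ is the same schema with $S$ in place of $\Omega$ in the condition on $\underline\beta$. For a formula $\varphi(\varpi^\Omega)$ with De Morgan dual $\overline\varphi$ and a term $\lambda$ of type $1$, put $$\mathbb{P}[\varphi]\ge\lambda:\equiv\forall A^S\bigl(\mathbb{P}(A)<\lambda\to\exists\varpi\in A^c\,\varphi(\varpi)\bigr),\qquad \mathbb{P}[\varphi]>\lambda:\equiv\forall A^S\bigl(\mathbb{P}(A)\le\lambda\to\exists\varpi\in A^c\,\varphi(\varpi)\bigr),$$ $$\mathbb{P}[\varphi]\le\lambda:\equiv\mathbb{P}[\overline\varphi]\ge1-\lambda,\qquad \mathbb{P}[\varphi]<\lambda:\equiv\mathbb{P}[\overline\varphi]>1-\lambda.$$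 **Proposition.** Let $\tau$ be a pure type, let $\varphi(x^\tau,\varpi^\Omega)$ be a formula, possibly with further free variables, and let $\lambda$ be a variable or, more generally, any term of type $1$ in which $x$ and $\varpi$ do not occur. 1. Let $\varphi$ be a $\forall$-formula and let $\mathrm{AM}$ be the formula $\forall\varpi^\Omega\,\forall x^\tau,y^\tau\,(y\ge_\tau x\wedge\varphi(y,\varpi)\to\varphi(x,\varpi))$ (anti-monotonicity in $x$). Then - $\mathcal{F}^\omega[\mathbb{P}]+\mathrm{UB}^{\Omega}_{\tau}$ proves $\mathrm{AM}\to\bigl(\mathbb{P}[\forall x^\tau\varphi(x)]\ge\lambda\leftrightarrow\forall x^\tau(\mathbb{P}[\varphi(x)]\ge\lambda)\bigr)$; - $\mathcal{F}^\omega[\mathbb{P}]+\mathrm{UB}^{S}_{\tau}$ proves $\mathrm{AM}\to\bigl(\forall\mu^{\mathbb{Q}}>0\,\exists x^\tau(\mathbb{P}[\varphi(x)]<\lambda+\mu)\leftrightarrow\mathbb{P}[\forall x^\tau\varphi(x)]\le\lambda\bigr)$. 2. Let $\varphi$ be an $\exists$-formula and let $\mathrm{M}$ be the formula $\forall\varpi^\Omega\,\forall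 x^\tau,y^\tau\,(y\ge_\tau x\wedge\varphi(x,\varpi)\to\varphi(y,\varpi))$ (monotonicity in $x$). Then - $\mathcal{F}^\omega[\mathbb{P}]+\mathrm{UB}^{\Omega}_{\tau}$ proves $\mathrm{M}\to\bigl(\mathbb{P}[\exists x^\tau\varphi(x)]\le\lambda\leftrightarrow\forall x^\tau(\mathbb{P}[\varphi(x)]\le\lambda)\bigr)$; - $\mathcal{F}^\omega[\mathbb{P}]+\mathrm{UB}^{S}_{\tau}$ proves $\mathrm{M}\to\bigl(\forall\mu^{\mathbb{Q}}>0\,\exists x^\tau(\mathbb{P}[\varphi(x)]>\lambda-\mu)\leftrightarrow\mathbb{P}[\exists x^\tau\varphi(x)]\ge\lambda\bigr)$. -/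

import Mathlib

namespace FinType

/-! ### Finite types over the natural numbers, the sample space and the event space -/

/-- The finite types over the three ground types `0` (here `nat`), `Ω` (here `Om`) and
`S` (here `Ev`). The type of functions from `ρ` to `τ`, usually written `τ(ρ)`, is `fn ρ τ`. -/
inductive Ty : Type
  | nat : Ty
  | Om : Ty
  | Ev : Ty
  | fn (ρ τ : Ty) : Ty

/-- `arr [σ₁, …, σₖ] τ` is the type `τ(σₖ)…(σ₁)` of `k`-ary functionals. -/
@[reducible] def arr : List Ty → Ty → Ty
  | [], τ => τ
  | σ :: σs, τ => Ty.fn σ (arr σs τ)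

/-- The type `1 = 0(0)` of number-theoretic functions, which also represents the reals. -/
abbrev one : Ty := Ty.fn Ty.nat Ty.nat

/-- The pure types `0` and `n + 1 := 0(n)`. -/
inductive IsPure : Ty → Prop
  | nat : IsPure Ty.nat
  | succ {τ : Ty} : IsPure τ → IsPure (Ty.fn τ Ty.nat)

/-- The ground types. -/
inductive IsGround : Ty → Prop
  | nat : IsGround Ty.nat
  | om : IsGround Ty.Om
  | ev : IsGround Ty.Ev

/-- Small types: `ρ₀(0)…(0)` with `ρ₀` a ground type. -/
inductive IsSmall : Ty → Prop
  | ground {τ : Ty} : IsGround τ → IsSmall τ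
  | fn {τ : Ty} : IsSmall τ → IsSmall (Ty.fn Ty.nat τ)

/-- Admissible types: `ρ₀(σₖ)…(σ₁)` with `ρ₀` a ground type and all `σᵢ` small. -/
inductive IsAdmissible : Ty → Prop
  | ground {τ : Ty} : IsGround τ → IsAdmissible τ
  | fn {σ τ : Ty} : IsSmall σ → IsAdmissible τ → IsAdmissible (Ty.fn σ τ)

/-! ### Variables, terms and substitution

Terms and formulas are typed and use de Bruijn indices. A context lists the types of the free
variables; its head is the variable that was bound last. -/

/-- The variables of type `σ` in a context. -/
inductive Var : List Ty → Ty → Type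
  | z {Γ : List Ty} {σ : Ty} : Var (σ :: Γ) σ
  | s {Γ : List Ty} {σ τ : Ty} : Var Γ σ → Var (τ :: Γ) σ

namespace Var

def map (f : Ty → Ty) : {Ξ : List Ty} → {σ : Ty} → Var Ξ σ → Var (Ξ.map f) (f σ)
  | _, _, z => z
  | _, _, s v => s (map f v)

def inl {Γ : List Ty} : {Ξ : List Ty} → {σ : Ty} → Var Ξ σ → Var (Ξ ++ Γ) σ
  | _, _, z => z
  | _, _, s v => s (inl v)

def inr {Γ : List Ty} : (Ξ : List Ty) → {σ : Ty} → Var Γ σ → Var (Ξ ++ Γ) σ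
  | [], _, v => v
  | _ :: Ξ, _, v => s (inr Ξ v)

end Var

/-- The type of the `j`-th step function of a simultaneous recursion in the types `ρs`, where
`ρ` is the `j`-th type: it takes the tuple of previous values and then the counter. -/
abbrev stepTy (ρs : List Ty) (ρ : Ty) : Ty := arr ρs (Ty.fn Ty.nat ρ)

/-- The constants. -/
inductive Con : Ty → Type
  | zero : Con Ty.nat
  | succ : Con one
  /-- the projector `Π` -/
  | proj (ρ τ : Ty) : Con (Ty.fn ρ (Ty.fn τ ρ))
  /-- the combinator `Σ` -/
  | comb (δ ρ τ : Ty) :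
      Con (Ty.fn (Ty.fn δ (Ty.fn ρ τ)) (Ty.fn (Ty.fn δ ρ) (Ty.fn δ τ)))
  /-- the `i`-th recursor of the simultaneous primitive recursion in the types `ρs` -/
  | recursor (ρs : List Ty) {ρ : Ty} (i : Var ρs ρ) :
      Con (Ty.fn Ty.nat (arr ρs (arr (ρs.map (stepTy ρs)) ρ)))
  | eqOm : Con (Ty.fn Ty.Om (Ty.fn Ty.Om Ty.nat))
  | mem : Con (Ty.fn Ty.Om (Ty.fn Ty.Ev Ty.nat))
  | union : Con (Ty.fn Ty.Ev (Ty.fn Ty.Ev Ty.Ev))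
  | compl : Con (Ty.fn Ty.Ev Ty.Ev)
  | empty : Con Ty.Ev
  | prob : Con (Ty.fn Ty.Ev one)
  /-- a constant witnessing that the sample space is not empty -/
  | pt : Con Ty.Om

/-- Terms of a given type in a given context. -/
inductive Tm : List Ty → Ty → Type
  | var {Γ : List Ty} {σ : Ty} : Var Γ σ → Tm Γ σ
  | con {Γ : List Ty} {σ : Ty} : Con σ → Tm Γ σ
  | app {Γ : List Ty} {σ τ : Ty} : Tm Γ (Ty.fn σ τ) → Tm Γ σ → Tm Γ τ

/-- Renamings of variables. -/
abbrev Ren (Γ Δ : List Ty) : Type := ∀ σ : Ty, Var Γ σ → Var Δ σ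

/-- Substitutions; also used for tuples of terms (of types `Γ`, in the context `Δ`). -/
abbrev Sub (Γ Δ : List Ty) : Type := ∀ σ : Ty, Var Γ σ → Tm Δ σ

def Ren.lift {Γ Δ : List Ty} (r : Ren Γ Δ) (τ : Ty) : Ren (τ :: Γ) (τ :: Δ)
  | _, Var.z => Var.z
  | _, Var.s v => Var.s (r _ v)

def Tm.ren {Γ Δ : List Ty} (r : Ren Γ Δ) : {σ : Ty} → Tm Γ σ → Tm Δ σ
  | _, Tm.var v => Tm.var (r _ v)
  | _, Tm.con c => Tm.con c
  | _, Tm.app t u => Tm.app (t.ren r) (u.ren r)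

/-- Weakening of a term by one new variable. -/
def Tm.wk {Γ : List Ty} {τ σ : Ty} (t : Tm Γ σ) : Tm (τ :: Γ) σ := t.ren fun _ v => Var.s v

/-- Weakening of a term by a block of new variables. -/
def Tm.wks {Γ : List Ty} (Ξ : List Ty) {σ : Ty} (t : Tm Γ σ) : Tm (Ξ ++ Γ) σ :=
  t.ren fun _ v => Var.inr Ξ v

namespace Sub

def id {Γ : List Ty} : Sub Γ Γ := fun _ v => Tm.var v

def cons {Γ Δ : List Ty} {τ : Ty} (t : Tm Δ τ) (s : Sub Γ Δ) : Sub (τ :: Γ) Δ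
  | _, Var.z => t
  | _, Var.s v => s _ v

def lift {Γ Δ : List Ty} (s : Sub Γ Δ) (τ : Ty) : Sub (τ :: Γ) (τ :: Δ)
  | _, Var.z => Tm.var Var.z
  | _, Var.s v => (s _ v).wk

def lifts {Γ Δ : List Ty} (s : Sub Γ Δ) : (Ξ : List Ty) → Sub (Ξ ++ Γ) (Ξ ++ Δ)
  | [] => s
  | τ :: Ξ => (lifts s Ξ).lift τ

def append {Γ Δ : List Ty} : {Ξ : List Ty} → Sub Ξ Δ → Sub Γ Δ → Sub (Ξ ++ Γ) Δ
  | [], _, s => s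
  | _ :: _, r, s => cons (r _ Var.z) (append (fun _ v => r _ (Var.s v)) s)

end Sub

def Tm.subst {Γ Δ : List Ty} (s : Sub Γ Δ) : {σ : Ty} → Tm Γ σ → Tm Δ σ
  | _, Tm.var v => s _ v
  | _, Tm.con c => Tm.con c
  | _, Tm.app t u => Tm.app (t.subst s) (u.subst s)

/-- Application of a term to a tuple of terms. -/
def appN {Δ : List Ty} : (ρs : List Ty) → {τ : Ty} → Tm Δ (arr ρs τ) → Sub ρs Δ → Tm Δ τ
  | [], _, t, _ => t
  | _ :: ρs, _, t, a => appN ρs (Tm.app t (a _ Var.z)) fun _ v => a _ (Var.s v)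

/-- The variable bound last, as a term. -/
abbrev v0 {Γ : List Ty} {σ : Ty} : Tm (σ :: Γ) σ := Tm.var Var.z

/-- The variable bound next to last, as a term. -/
abbrev v1 {Γ : List Ty} {σ τ : Ty} : Tm (τ :: σ :: Γ) σ := Tm.var (Var.s Var.z)

/-- The third variable of a context, as a term. -/
abbrev v2 {Γ : List Ty} {σ τ ρ : Ty} : Tm (ρ :: τ :: σ :: Γ) σ := Tm.var (Var.s (Var.s Var.z))

/-- Lambda abstraction, defined from the combinators. -/
def Tm.lam {Γ : List Ty} {σ : Ty} : {τ : Ty} → Tm (σ :: Γ) τ → Tm Γ (Ty.fn σ τ)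
  | _, Tm.var Var.z =>
      Tm.app (Tm.app (Tm.con (Con.comb σ (Ty.fn σ σ) σ)) (Tm.con (Con.proj σ (Ty.fn σ σ))))
        (Tm.con (Con.proj σ σ))
  | _, Tm.var (Var.s v) => Tm.app (Tm.con (Con.proj _ σ)) (Tm.var v)
  | _, Tm.con c => Tm.app (Tm.con (Con.proj _ σ)) (Tm.con c)
  | _, Tm.app t u => Tm.app (Tm.app (Tm.con (Con.comb σ _ _)) t.lam) u.lam

/-! ### Formulas -/

/-- Formulas in a given context; the only prime formulas are equations of type `0`. -/
inductive Fm : List Ty → Type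
  | eq {Γ : List Ty} : Tm Γ Ty.nat → Tm Γ Ty.nat → Fm Γ
  | and {Γ : List Ty} : Fm Γ → Fm Γ → Fm Γ
  | or {Γ : List Ty} : Fm Γ → Fm Γ → Fm Γ
  | imp {Γ : List Ty} : Fm Γ → Fm Γ → Fm Γ
  | all {Γ : List Ty} (σ : Ty) : Fm (σ :: Γ) → Fm Γ
  | ex {Γ : List Ty} (σ : Ty) : Fm (σ :: Γ) → Fm Γ

abbrev zro {Γ : List Ty} : Tm Γ Ty.nat := Tm.con Con.zero

abbrev suc {Γ : List Ty} (t : Tm Γ Ty.nat) : Tm Γ Ty.nat := Tm.app (Tm.con Con.succ) t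

namespace Fm

def subst : {Γ Δ : List Ty} → Sub Γ Δ → Fm Γ → Fm Δ
  | _, _, s, eq t u => eq (t.subst s) (u.subst s)
  | _, _, s, and φ ψ => and (φ.subst s) (ψ.subst s)
  | _, _, s, or φ ψ => or (φ.subst s) (ψ.subst s)
  | _, _, s, imp φ ψ => imp (φ.subst s) (ψ.subst s)
  | _, _, s, all σ φ => all σ (φ.subst (s.lift σ))
  | _, _, s, ex σ φ => ex σ (φ.subst (s.lift σ))

/-- Weakening of a formula by one new variable. -/
def wk {Γ : List Ty} {τ : Ty} (φ : Fm Γ) : Fm (τ :: Γ) := φ.subst fun _ v => Tm.var (Var.s v)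

/-- Weakening of a formula by one new variable, inserted below the variable bound last. -/
def wkBelow {Γ : List Ty} {σ τ : Ty} (φ : Fm (σ :: Γ)) : Fm (σ :: τ :: Γ) :=
  φ.subst (Sub.lift (fun _ v => Tm.var (Var.s v)) σ)

/-- Weakening of a formula by one new variable, inserted below the two variables bound last. -/
def wkBelow2 {Γ : List Ty} {ρ σ τ : Ty} (φ : Fm (ρ :: σ :: Γ)) : Fm (ρ :: σ :: τ :: Γ) :=
  φ.subst (Sub.lift (Sub.lift (fun _ v => Tm.var (Var.s v)) σ) ρ)

/-- Instantiation of the variable bound last. -/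
def inst {Γ : List Ty} {τ : Ty} (φ : Fm (τ :: Γ)) (t : Tm Γ τ) : Fm Γ :=
  φ.subst (Sub.cons t Sub.id)

/-- Exchange of the two variables bound last. -/
def swap {Γ : List Ty} {σ τ : Ty} (φ : Fm (σ :: τ :: Γ)) : Fm (τ :: σ :: Γ) :=
  φ.subst (Sub.cons v1 (Sub.cons v0 fun _ v => Tm.var (Var.s (Var.s v))))

/-- Falsity is the equation `0 = 1`. -/
def bot {Γ : List Ty} : Fm Γ := eq zro (suc zro)

def neg {Γ : List Ty} (φ : Fm Γ) : Fm Γ := imp φ bot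

def iff {Γ : List Ty} (φ ψ : Fm Γ) : Fm Γ := and (imp φ ψ) (imp ψ φ)

/-- Universal quantification over a block of variables. -/
def alls {Γ : List Ty} : (Ξ : List Ty) → Fm (Ξ ++ Γ) → Fm Γ
  | [], φ => φ
  | σ :: Ξ, φ => alls Ξ (all σ φ)

/-- Existential quantification over a block of variables. -/
def exs {Γ : List Ty} : (Ξ : List Ty) → Fm (Ξ ++ Γ) → Fm Γ
  | [], φ => φ
  | σ :: Ξ, φ => exs Ξ (ex σ φ)

/-- The De Morgan dual. -/
def dual : {Γ : List Ty} → Fm Γ → Fm Γ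
  | _, eq t u => neg (eq t u)
  | _, and φ ψ => or φ.dual ψ.dual
  | _, or φ ψ => and φ.dual ψ.dual
  | _, imp φ ψ => and φ ψ.dual
  | _, all σ φ => ex σ φ.dual
  | _, ex σ φ => all σ φ.dual

/-- Quantifier-free formulas. -/
def QF : {Γ : List Ty} → Fm Γ → Prop
  | _, eq _ _ => True
  | _, and φ ψ => φ.QF ∧ ψ.QF
  | _, or φ ψ => φ.QF ∧ ψ.QF
  | _, imp φ ψ => φ.QF ∧ ψ.QF
  | _, all _ _ => False
  | _, ex _ _ => False

end Fm

/-- `∀`-formulas: a block of universal quantifiers of admissible types in front of a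
quantifier-free formula. -/
inductive IsForall : {Γ : List Ty} → Fm Γ → Prop
  | qf {Γ : List Ty} {φ : Fm Γ} : φ.QF → IsForall φ
  | all {Γ : List Ty} {σ : Ty} {φ : Fm (σ :: Γ)} :
      IsAdmissible σ → IsForall φ → IsForall (Fm.all σ φ)

/-- `∃`-formulas: a block of existential quantifiers of admissible types in front of a
quantifier-free formula. -/
inductive IsExists : {Γ : List Ty} → Fm Γ → Prop
  | qf {Γ : List Ty} {φ : Fm Γ} : φ.QF → IsExists φ
  | ex {Γ : List Ty} {σ : Ty} {φ : Fm (σ :: Γ)} :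
      IsAdmissible σ → IsExists φ → IsExists (Fm.ex σ φ)

/-! ### The events -/

section Events

variable {Γ : List Ty}

def memT (x : Tm Γ Ty.Om) (A : Tm Γ Ty.Ev) : Tm Γ Ty.nat :=
  Tm.app (Tm.app (Tm.con Con.mem) x) A

/-- The formula `x ∈ A`. -/
def memF (x : Tm Γ Ty.Om) (A : Tm Γ Ty.Ev) : Fm Γ := Fm.eq (memT x A) zro

def cupT (A B : Tm Γ Ty.Ev) : Tm Γ Ty.Ev := Tm.app (Tm.app (Tm.con Con.union) A) B

def compT (A : Tm Γ Ty.Ev) : Tm Γ Ty.Ev := Tm.app (Tm.con Con.compl) A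

def emptyT : Tm Γ Ty.Ev := Tm.con Con.empty

/-- The sure event, the complement of the empty event. -/
def sureT : Tm Γ Ty.Ev := compT emptyT

def capT (A B : Tm Γ Ty.Ev) : Tm Γ Ty.Ev := compT (cupT (compT A) (compT B))

/-- The probability of an event, a term of type `1` that represents a real number. -/
def probT (A : Tm Γ Ty.Ev) : Tm Γ one := Tm.app (Tm.con Con.prob) A

def subsetF (A B : Tm Γ Ty.Ev) : Fm Γ :=
  Fm.all Ty.Om (Fm.imp (memF v0 A.wk) (memF v0 B.wk))

end Events

/-- Equality in all types: primitive in type `0`, given by the constant `eq` on `Ω`, defined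
by having the same elements on `S`, and pointwise in function types. -/
def eqF : {Γ : List Ty} → (σ : Ty) → Tm Γ σ → Tm Γ σ → Fm Γ
  | _, Ty.nat, s, t => Fm.eq s t
  | _, Ty.Om, s, t => Fm.eq (Tm.app (Tm.app (Tm.con Con.eqOm) s) t) zro
  | _, Ty.Ev, s, t => Fm.all Ty.Om (Fm.iff (memF v0 s.wk) (memF v0 t.wk))
  | _, Ty.fn ρ τ, s, t => Fm.all ρ (eqF τ (Tm.app s.wk v0) (Tm.app t.wk v0))

/-! ### Arithmetic -/

section Arithmetic

variable {Γ : List Ty}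

/-- The tuple of two terms. -/
def pairSub {σ τ : Ty} (a : Tm Γ σ) (b : Tm Γ τ) : Sub [σ, τ] Γ
  | _, Var.z => a
  | _, Var.s Var.z => b

/-- Primitive recursion on numbers: the value at `0` is `a`, and the value at `x + 1` is `b`,
where in `b` the variable `v0` is `x` and `v1` is the value at `x`. -/
def natRec (a : Tm Γ Ty.nat) (b : Tm (Ty.nat :: Ty.nat :: Γ) Ty.nat) (n : Tm Γ Ty.nat) :
    Tm Γ Ty.nat :=
  Tm.app (Tm.app (Tm.app (Tm.con (Con.recursor [Ty.nat] Var.z)) n) a) b.lam.lam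

def predT (n : Tm Γ Ty.nat) : Tm Γ Ty.nat := natRec zro v0 n

def addT (m n : Tm Γ Ty.nat) : Tm Γ Ty.nat := natRec m (suc v1) n

/-- Cut-off subtraction. -/
def subT (m n : Tm Γ Ty.nat) : Tm Γ Ty.nat := natRec m (predT v1) n

def mulT (m n : Tm Γ Ty.nat) : Tm Γ Ty.nat := natRec zro (addT v1 m.wk.wk) n

/-- `2 ^ n`. -/
def powT (n : Tm Γ Ty.nat) : Tm Γ Ty.nat := natRec (suc zro) (addT v1 v1) n

/-- `a` if `c = 0`, and `b` otherwise. -/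
def condT (c a b : Tm Γ Ty.nat) : Tm Γ Ty.nat := natRec a b.wk.wk c

/-- The triangular number `0 + 1 + ⋯ + n`. -/
def triT (n : Tm Γ Ty.nat) : Tm Γ Ty.nat := natRec zro (addT v1 (suc v0)) n

/-- The Cantor pairing function. -/
def pairT (a b : Tm Γ Ty.nat) : Tm Γ Ty.nat := addT (triT (addT a b)) b

/-- The two projections of the Cantor pairing function (`i` selects the component). The pairs
are enumerated in the order of their codes by a simultaneous recursion: `(0, b)` is followed by
`(b + 1, 0)`, and `(a + 1, b)` is followed by `(a, b + 1)`. In the step functions, `v2` and `v1`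
are the components of the previous pair. -/
def unpairT (i : Var [Ty.nat, Ty.nat] Ty.nat) (n : Tm Γ Ty.nat) : Tm Γ Ty.nat :=
  Tm.app (Tm.app
    (Tm.app (Tm.app (Tm.app (Tm.con (Con.recursor [Ty.nat, Ty.nat] i)) n) zro) zro)
    (Tm.lam (Tm.lam (Tm.lam (condT v2 (suc v1) (predT v2))))))
    (Tm.lam (Tm.lam (Tm.lam (condT v2 zro (suc v1)))))

def fstT (n : Tm Γ Ty.nat) : Tm Γ Ty.nat := unpairT Var.z n

def sndT (n : Tm Γ Ty.nat) : Tm Γ Ty.nat := unpairT (Var.s Var.z) n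

/-! ### Rational numbers

The number `⟨⟨a, b⟩, c⟩` codes the rational number `(a - b) / (c + 1)`. -/

def ratT (a b c : Tm Γ Ty.nat) : Tm Γ Ty.nat := pairT (pairT a b) c

def posT (q : Tm Γ Ty.nat) : Tm Γ Ty.nat := fstT (fstT q)

def negT (q : Tm Γ Ty.nat) : Tm Γ Ty.nat := sndT (fstT q)

/-- The denominator. -/
def denT (q : Tm Γ Ty.nat) : Tm Γ Ty.nat := suc (sndT q)

/-- For `q = (a - b) / d` and `r = (a' - b') / d'` this is `a d' + b' d`, so that `q < r` means
`crossT q r < crossT r q`. -/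
def crossT (q r : Tm Γ Ty.nat) : Tm Γ Ty.nat :=
  addT (mulT (posT q) (denT r)) (mulT (negT r) (denT q))

/-- A term that is `0` exactly if `q < r`. -/
def qltT (q r : Tm Γ Ty.nat) : Tm Γ Ty.nat := subT (suc (crossT q r)) (crossT r q)

def qltF (q r : Tm Γ Ty.nat) : Fm Γ := Fm.eq (qltT q r) zro

def qleF (q r : Tm Γ Ty.nat) : Fm Γ := Fm.eq (subT (crossT q r) (crossT r q)) zro

def qzero : Tm Γ Ty.nat := ratT zro zro zro

def qone : Tm Γ Ty.nat := ratT (suc zro) zro zro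

/-- The rational number `2 ^ (-n)`. -/
def qhalf (n : Tm Γ Ty.nat) : Tm Γ Ty.nat := ratT (suc zro) zro (predT (powT n))

def qadd (q r : Tm Γ Ty.nat) : Tm Γ Ty.nat :=
  ratT (addT (mulT (posT q) (denT r)) (mulT (posT r) (denT q)))
    (addT (mulT (negT q) (denT r)) (mulT (negT r) (denT q)))
    (predT (mulT (denT q) (denT r)))

def qneg (q : Tm Γ Ty.nat) : Tm Γ Ty.nat := ratT (negT q) (posT q) (sndT q)

def qsub (q r : Tm Γ Ty.nat) : Tm Γ Ty.nat := qadd q (qneg r)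

def qabs (q : Tm Γ Ty.nat) : Tm Γ Ty.nat :=
  ratT (addT (subT (posT q) (negT q)) (subT (negT q) (posT q))) zro (sndT q)

/-! ### Real numbers

A real number is given by any `f` of type `1`, through the sequence `hat f` of (codes of)
rationals. The latter satisfies `|hat f n - hat f (n + 1)| < 2 ^ (-n - 1)` for all `n`, and it is
`f` itself if `f` has this property; otherwise it is `f` up to the first `n` where the property
fails, and constant from there on. -/

/-- `0` exactly if `|f k - f (k + 1)| < 2 ^ (-k - 1)` for all `k < n`. -/
def badT (f : Tm Γ one) (n : Tm Γ Ty.nat) : Tm Γ Ty.nat :=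
  natRec zro
    (addT v1
      (qltT (qabs (qsub (Tm.app f.wk.wk v0) (Tm.app f.wk.wk (suc v0)))) (qhalf (suc v0)))) n

/-- The value of `hat f` at `n`. -/
def hatT (f : Tm Γ one) (n : Tm Γ Ty.nat) : Tm Γ Ty.nat :=
  natRec (Tm.app f zro)
    (condT (badT f.wk.wk (suc v0)) (Tm.app f.wk.wk (suc v0)) v1) n

def rltF (s t : Tm Γ one) : Fm Γ :=
  Fm.ex Ty.nat (qleF (qhalf v0) (qsub (hatT t.wk (suc v0)) (hatT s.wk (suc v0))))

def rleF (s t : Tm Γ one) : Fm Γ :=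
  Fm.all Ty.nat (qltF (qsub (hatT s.wk (suc v0)) (hatT t.wk (suc v0))) (qhalf v0))

def reqF (s t : Tm Γ one) : Fm Γ :=
  Fm.all Ty.nat (qltF (qabs (qsub (hatT s.wk (suc v0)) (hatT t.wk (suc v0)))) (qhalf v0))

/-- The real number given by a rational number. -/
def rrat (q : Tm Γ Ty.nat) : Tm Γ one := Tm.lam q.wk

def radd (s t : Tm Γ one) : Tm Γ one :=
  Tm.lam (qadd (hatT s.wk (suc v0)) (hatT t.wk (suc v0)))

def rsub (s t : Tm Γ one) : Tm Γ one :=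
  Tm.lam (qsub (hatT s.wk (suc v0)) (hatT t.wk (suc v0)))

def rzero : Tm Γ one := rrat qzero

def rone : Tm Γ one := rrat qone

end Arithmetic

/-- The inequality `s ≤ t` in all types: `s ∸ t = 0` in type `0`, trivial on `Ω`, comparison of
probabilities on `S`, and pointwise in function types. -/
def leF : {Γ : List Ty} → (σ : Ty) → Tm Γ σ → Tm Γ σ → Fm Γ
  | _, Ty.nat, s, t => Fm.eq (subT s t) zro
  | _, Ty.Om, _, _ => rleF (probT sureT) (probT sureT)
  | _, Ty.Ev, s, t => rleF (probT s) (probT t)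
  | _, Ty.fn ρ τ, s, t => Fm.all ρ (leF τ (Tm.app s.wk v0) (Tm.app t.wk v0))

/-- The pointwise minimum in the type `0(σₖ)…(σ₁)`. -/
def minT : {Γ : List Ty} → (σs : List Ty) →
    Tm Γ (arr σs Ty.nat) → Tm Γ (arr σs Ty.nat) → Tm Γ (arr σs Ty.nat)
  | _, [], s, t => subT s (subT s t)
  | _, _ :: σs, s, t => Tm.lam (minT σs (Tm.app s.wk v0) (Tm.app t.wk v0))

/-! ### Derivability -/

/-- A theory is given by its axioms, which may contain free variables. -/
abbrev Theory : Type := ∀ Γ : List Ty, Fm Γ → Prop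

/-- The theory with the axioms of two theories. -/
def Theory.plus (T U : Theory) : Theory := fun Γ φ => T Γ φ ∨ U Γ φ

/-- Derivability of a formula from finitely many assumptions in a theory: classical many-sorted
natural deduction, with the quantifier-free rule of extensionality, which applies only to
premises that are derivable without assumptions. -/
inductive Derives (T : Theory) : {Γ : List Ty} → List (Fm Γ) → Fm Γ → Prop
  | ax {Γ : List Ty} {H : List (Fm Γ)} {φ : Fm Γ} : T Γ φ → Derives T H φ
  | hyp {Γ : List Ty} {H : List (Fm Γ)} {φ : Fm Γ} : φ ∈ H → Derives T H φ
  | andI {Γ : List Ty} {H : List (Fm Γ)} {φ ψ : Fm Γ} :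
      Derives T H φ → Derives T H ψ → Derives T H (Fm.and φ ψ)
  | andL {Γ : List Ty} {H : List (Fm Γ)} {φ ψ : Fm Γ} :
      Derives T H (Fm.and φ ψ) → Derives T H φ
  | andR {Γ : List Ty} {H : List (Fm Γ)} {φ ψ : Fm Γ} :
      Derives T H (Fm.and φ ψ) → Derives T H ψ
  | orL {Γ : List Ty} {H : List (Fm Γ)} {φ ψ : Fm Γ} :
      Derives T H φ → Derives T H (Fm.or φ ψ)
  | orR {Γ : List Ty} {H : List (Fm Γ)} {φ ψ : Fm Γ} :
      Derives T H ψ → Derives T H (Fm.or φ ψ)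
  | orE {Γ : List Ty} {H : List (Fm Γ)} {φ ψ χ : Fm Γ} :
      Derives T H (Fm.or φ ψ) → Derives T (φ :: H) χ → Derives T (ψ :: H) χ → Derives T H χ
  | impI {Γ : List Ty} {H : List (Fm Γ)} {φ ψ : Fm Γ} :
      Derives T (φ :: H) ψ → Derives T H (Fm.imp φ ψ)
  | impE {Γ : List Ty} {H : List (Fm Γ)} {φ ψ : Fm Γ} :
      Derives T H (Fm.imp φ ψ) → Derives T H φ → Derives T H ψ
  | raa {Γ : List Ty} {H : List (Fm Γ)} {φ : Fm Γ} :
      Derives T (Fm.neg φ :: H) Fm.bot → Derives T H φ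
  | allI {Γ : List Ty} {H : List (Fm Γ)} {σ : Ty} {φ : Fm (σ :: Γ)} :
      Derives T (H.map Fm.wk) φ → Derives T H (Fm.all σ φ)
  | allE {Γ : List Ty} {H : List (Fm Γ)} {σ : Ty} {φ : Fm (σ :: Γ)} (t : Tm Γ σ) :
      Derives T H (Fm.all σ φ) → Derives T H (φ.inst t)
  | exI {Γ : List Ty} {H : List (Fm Γ)} {σ : Ty} {φ : Fm (σ :: Γ)} (t : Tm Γ σ) :
      Derives T H (φ.inst t) → Derives T H (Fm.ex σ φ)
  | exE {Γ : List Ty} {H : List (Fm Γ)} {σ : Ty} {φ : Fm (σ :: Γ)} {ψ : Fm Γ} :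
      Derives T H (Fm.ex σ φ) → Derives T (φ :: H.map Fm.wk) ψ.wk → Derives T H ψ
  | qfer {Γ : List Ty} {H : List (Fm Γ)} {ρ τ : Ty} {φ : Fm Γ} {s t : Tm Γ ρ}
      (r : Tm (ρ :: Γ) τ) : φ.QF → Derives T [] (Fm.imp φ (eqF ρ s t)) →
      Derives T H (Fm.imp φ
        (eqF τ (r.subst (Sub.cons s Sub.id)) (r.subst (Sub.cons t Sub.id))))

/-- Provability of a formula in a theory. -/
def Proves (T : Theory) {Γ : List Ty} (φ : Fm Γ) : Prop := Derives T [] φ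

/-! ### The system -/

/-- The substitution that replaces the existential variables `ys` of a formula by the values of
the choice functions at the universal variables `xs`. -/
def choiceSub {Γ : List Ty} (xs ys : List Ty) :
    Sub (ys ++ (xs ++ Γ)) (xs ++ (ys.map (arr xs) ++ Γ)) :=
  Sub.append
    (fun _ v => appN xs (Tm.var (Var.inr xs (Var.inl (v.map (arr xs)))))
      fun _ w => Tm.var (Var.inl w))
    (Sub.append (fun _ v => Tm.var (Var.inl v))
      fun _ v => Tm.var (Var.inr xs (Var.inr (ys.map (arr xs)) v)))

/-- The quantifier-free axiom of choice
`∀x ∃y φ(x, y) → ∃Y ∀x φ(x, Y x)`, where `x`, `y`, `Y` are tuples. -/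
def qfChoice {Γ : List Ty} (xs ys : List Ty) (φ : Fm (ys ++ (xs ++ Γ))) : Fm Γ :=
  Fm.imp (Fm.alls xs (Fm.exs ys φ))
    (Fm.exs (ys.map (arr xs)) (Fm.alls xs (φ.subst (choiceSub xs ys))))

/-- The substitution `y ↦ f n`, `z ↦ f (n + 1)` for the axiom of dependent choice. -/
def depSub {Γ : List Ty} (ρs : List Ty) :
    Sub (ρs ++ (ρs ++ (Ty.nat :: Γ))) (Ty.nat :: (ρs.map (Ty.fn Ty.nat) ++ Γ)) :=
  Sub.append
    (fun _ v => Tm.app (Tm.var (Var.s (Var.inl (v.map (Ty.fn Ty.nat))))) (suc v0))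
    (Sub.append
      (fun _ v => Tm.app (Tm.var (Var.s (Var.inl (v.map (Ty.fn Ty.nat))))) v0)
      (Sub.cons v0 fun _ v => Tm.var (Var.s (Var.inr (ρs.map (Ty.fn Ty.nat)) v))))

/-- The axiom of dependent choice
`∀n ∀y ∃z φ(n, y, z) → ∃f ∀n φ(n, f n, f (n + 1))`, where `y`, `z`, `f` are tuples. -/
def depChoice {Γ : List Ty} (ρs : List Ty) (φ : Fm (ρs ++ (ρs ++ (Ty.nat :: Γ)))) : Fm Γ :=
  Fm.imp (Fm.all Ty.nat (Fm.alls ρs (Fm.exs ρs φ)))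
    (Fm.exs (ρs.map (Ty.fn Ty.nat)) (Fm.all Ty.nat (φ.subst (depSub ρs))))

/-- The `i`-th component of the simultaneous recursion with initial values `a` and step
functions `b`, at `n`. -/
def recT {Γ : List Ty} (ρs : List Ty) {ρ : Ty} (i : Var ρs ρ) (n : Tm Γ Ty.nat)
    (a : Sub ρs Γ) (b : Sub (ρs.map (stepTy ρs)) Γ) : Tm Γ ρ :=
  appN (ρs.map (stepTy ρs)) (appN ρs (Tm.app (Tm.con (Con.recursor ρs i)) n) a) b

/-- The axioms of weakly extensional Peano arithmetic in all finite types. -/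
inductive Arith : Theory
  | eqRefl {Γ : List Ty} (t : Tm Γ Ty.nat) : Arith Γ (Fm.eq t t)
  | eqSymm {Γ : List Ty} (s t : Tm Γ Ty.nat) : Arith Γ (Fm.imp (Fm.eq s t) (Fm.eq t s))
  | eqTrans {Γ : List Ty} (s t u : Tm Γ Ty.nat) :
      Arith Γ (Fm.imp (Fm.and (Fm.eq s t) (Fm.eq t u)) (Fm.eq s u))
  | succNe {Γ : List Ty} (t : Tm Γ Ty.nat) : Arith Γ (Fm.neg (Fm.eq (suc t) zro))
  | succInj {Γ : List Ty} (s t : Tm Γ Ty.nat) :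
      Arith Γ (Fm.imp (Fm.eq (suc s) (suc t)) (Fm.eq s t))
  | ind {Γ : List Ty} (φ : Fm (Ty.nat :: Γ)) :
      Arith Γ (Fm.imp
        (Fm.and (φ.inst zro)
          (Fm.all Ty.nat
            (Fm.imp φ (φ.subst (Sub.cons (suc v0) fun _ v => Tm.var (Var.s v))))))
        (Fm.all Ty.nat φ))
  | proj {Γ : List Ty} {ρ τ : Ty} (s : Tm Γ ρ) (t : Tm Γ τ) :
      Arith Γ (eqF ρ (Tm.app (Tm.app (Tm.con (Con.proj ρ τ)) s) t) s)
  | comb {Γ : List Ty} {δ ρ τ : Ty} (s : Tm Γ (Ty.fn δ (Ty.fn ρ τ))) (t : Tm Γ (Ty.fn δ ρ))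
      (u : Tm Γ δ) :
      Arith Γ (eqF τ (Tm.app (Tm.app (Tm.app (Tm.con (Con.comb δ ρ τ)) s) t) u)
        (Tm.app (Tm.app s u) (Tm.app t u)))
  | recZero {Γ : List Ty} (ρs : List Ty) {ρ : Ty} (i : Var ρs ρ)
      (a : Sub ρs Γ) (b : Sub (ρs.map (stepTy ρs)) Γ) :
      Arith Γ (eqF ρ (recT ρs i zro a b) (a ρ i))
  | recSucc {Γ : List Ty} (ρs : List Ty) {ρ : Ty} (i : Var ρs ρ) (n : Tm Γ Ty.nat)
      (a : Sub ρs Γ) (b : Sub (ρs.map (stepTy ρs)) Γ) :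
      Arith Γ (eqF ρ (recT ρs i (suc n) a b)
        (Tm.app (appN ρs (b (stepTy ρs ρ) (i.map (stepTy ρs))) fun _ j => recT ρs j n a b) n))

/-- The axiom schemata of quantifier-free choice and of dependent choice. -/
inductive Choice : Theory
  | qfac {Γ : List Ty} (xs ys : List Ty) (φ : Fm (ys ++ (xs ++ Γ))) :
      φ.QF → Choice Γ (qfChoice xs ys φ)
  | dc {Γ : List Ty} (ρs : List Ty) (φ : Fm (ρs ++ (ρs ++ (Ty.nat :: Γ)))) :
      Choice Γ (depChoice ρs φ)

/-- The axioms of probability contents: equality of points is an equivalence relation,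
membership respects the operations on events, and `P` is a probability content (with additivity
given by inclusion-exclusion and monotonicity). -/
inductive Content : Theory
  | omRefl {Γ : List Ty} (x : Tm Γ Ty.Om) : Content Γ (eqF Ty.Om x x)
  | omSymm {Γ : List Ty} (x y : Tm Γ Ty.Om) :
      Content Γ (Fm.imp (eqF Ty.Om x y) (eqF Ty.Om y x))
  | omTrans {Γ : List Ty} (x y u : Tm Γ Ty.Om) :
      Content Γ (Fm.imp (Fm.and (eqF Ty.Om x y) (eqF Ty.Om y u)) (eqF Ty.Om x u))
  | memEmpty {Γ : List Ty} (x : Tm Γ Ty.Om) : Content Γ (Fm.neg (memF x emptyT))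
  | memCompl {Γ : List Ty} (x : Tm Γ Ty.Om) (A : Tm Γ Ty.Ev) :
      Content Γ (Fm.iff (memF x (compT A)) (Fm.neg (memF x A)))
  | memUnion {Γ : List Ty} (x : Tm Γ Ty.Om) (A B : Tm Γ Ty.Ev) :
      Content Γ (Fm.iff (memF x (cupT A B)) (Fm.or (memF x A) (memF x B)))
  | probNonneg {Γ : List Ty} (A : Tm Γ Ty.Ev) : Content Γ (rleF rzero (probT A))
  | probLeOne {Γ : List Ty} (A : Tm Γ Ty.Ev) : Content Γ (rleF (probT A) rone)
  | probEmpty {Γ : List Ty} : Content Γ (reqF (probT emptyT) rzero)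
  | probSure {Γ : List Ty} : Content Γ (reqF (probT sureT) rone)
  | probUnion {Γ : List Ty} (A B : Tm Γ Ty.Ev) :
      Content Γ (reqF (probT (cupT A B))
        (rsub (radd (probT A) (probT B)) (probT (capT A B))))
  | probMono {Γ : List Ty} (A B : Tm Γ Ty.Ev) :
      Content Γ (Fm.imp (subsetF A B) (rleF (probT A) (probT B)))

/-- The classical system of finite type arithmetic for probability contents. -/
def FP : Theory := Theory.plus (Theory.plus Arith Choice) Content

/-! ### Uniform boundedness -/

/-- For `φ(y, k, x, z, w)`, where `x` has the type `α = 0(σₖ)…(σ₁)`, the formula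
`∀y (∀k ∀x ∀z ∃w φ(y, k, min(x, y k), z, w) →
  ∃χ ∀k ∀x ∀z ∃w (w ≤ χ k ∧ φ(y, k, min(x, y k), z, w)))`. -/
def unifBound {Γ : List Ty} (ρ : Ty) (σs βs : List Ty)
    (φ : Fm (ρ :: (βs ++ (arr σs Ty.nat :: Ty.nat :: Ty.fn Ty.nat (arr σs Ty.nat) :: Γ)))) :
    Fm Γ :=
  Fm.all (Ty.fn Ty.nat (arr σs Ty.nat)) (Fm.imp
    (Fm.all Ty.nat (Fm.all (arr σs Ty.nat) (Fm.alls βs (Fm.ex ρ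
      (φ.subst (((Sub.cons (minT σs v0 (Tm.app v2 v1)) (Sub.cons v1 (Sub.cons v2
        fun _ v => Tm.var (Var.s (Var.s (Var.s v)))))).lifts βs).lift ρ))))))
    (Fm.ex (Ty.fn Ty.nat ρ)
      (Fm.all Ty.nat (Fm.all (arr σs Ty.nat) (Fm.alls βs (Fm.ex ρ (Fm.and
        (leF ρ v0 (Tm.wk (Tm.wks βs (Tm.app v2 v1))))
        (φ.subst (((Sub.cons (minT σs v0 (Tm.app (Tm.var (Var.s (Var.s (Var.s Var.z)))) v1))
          (Sub.cons v1 (Sub.cons (Tm.var (Var.s (Var.s (Var.s Var.z))))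
            fun _ v => Tm.var (Var.s (Var.s (Var.s (Var.s v))))))).lifts βs).lift ρ)))))))))

/-- The principle of uniform boundedness in the type `ρ` for the ground type `B`: the instances
where `φ` is an `∃`-formula and each type in the tuple of the types of `z` is of the form
`B(τₘ)…(τ₁)`. -/
inductive UB (B ρ : Ty) : Theory
  | inst {Γ : List Ty} (σs : List Ty) (τs : List (List Ty))
      (φ : Fm (ρ :: (τs.map (fun l => arr l B) ++
        (arr σs Ty.nat :: Ty.nat :: Ty.fn Ty.nat (arr σs Ty.nat) :: Γ)))) :
      IsExists φ → UB B ρ Γ (unifBound ρ σs (τs.map fun l => arr l B) φ)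

/-- The system with uniform boundedness for the sample space in the type `ρ`. -/
def FPUBOm (ρ : Ty) : Theory := FP.plus (UB Ty.Om ρ)

/-- The system with uniform boundedness for the event space in the type `ρ`. -/
def FPUBEv (ρ : Ty) : Theory := FP.plus (UB Ty.Ev ρ)

/-! ### Probabilistic statements -/

section Probability

variable {Γ : List Ty}

/-- `P[φ] ≥ l`, that is, `∀A (P(A) < l → ∃ϖ (ϖ ∈ Aᶜ ∧ φ(ϖ)))`. -/
def probGe (φ : Fm (Ty.Om :: Γ)) (l : Tm Γ one) : Fm Γ :=
  Fm.all Ty.Ev (Fm.imp (rltF (probT v0) l.wk)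
    (Fm.ex Ty.Om (Fm.and (memF v0 (compT v1)) φ.wkBelow)))

/-- `P[φ] > l`, that is, `∀A (P(A) ≤ l → ∃ϖ (ϖ ∈ Aᶜ ∧ φ(ϖ)))`. -/
def probGt (φ : Fm (Ty.Om :: Γ)) (l : Tm Γ one) : Fm Γ :=
  Fm.all Ty.Ev (Fm.imp (rleF (probT v0) l.wk)
    (Fm.ex Ty.Om (Fm.and (memF v0 (compT v1)) φ.wkBelow)))

/-- `P[φ] ≤ l`, that is, `P[φ̄] ≥ 1 - l` for the De Morgan dual `φ̄` of `φ`. -/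
def probLe (φ : Fm (Ty.Om :: Γ)) (l : Tm Γ one) : Fm Γ := probGe φ.dual (rsub rone l)

/-- `P[φ] < l`, that is, `P[φ̄] > 1 - l` for the De Morgan dual `φ̄` of `φ`. -/
def probLt (φ : Fm (Ty.Om :: Γ)) (l : Tm Γ one) : Fm Γ := probGt φ.dual (rsub rone l)

variable {τ : Ty}

/-- The instance of `φ(x, ϖ)` at the given terms for `x` and `ϖ`, with the remaining free
variables replaced according to `s`. -/
def Fm.at {Δ : List Ty} (φ : Fm (Ty.Om :: τ :: Γ)) (ϖ : Tm Δ Ty.Om) (x : Tm Δ τ)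
    (s : Sub Γ Δ) : Fm Δ :=
  φ.subst (Sub.cons ϖ (Sub.cons x s))

/-- `φ(x, ϖ)` is anti-monotone in `x`: `∀ϖ ∀x ∀y (y ≥ x ∧ φ(y, ϖ) → φ(x, ϖ))`. -/
def antiMono (φ : Fm (Ty.Om :: τ :: Γ)) : Fm Γ :=
  Fm.all Ty.Om (Fm.all τ (Fm.all τ
    (Fm.imp (Fm.and (leF τ v1 v0) (φ.at v2 v0 fun _ v => Tm.var (Var.s (Var.s (Var.s v)))))
      (φ.at v2 v1 fun _ v => Tm.var (Var.s (Var.s (Var.s v)))))))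

/-- `φ(x, ϖ)` is monotone in `x`: `∀ϖ ∀x ∀y (y ≥ x ∧ φ(x, ϖ) → φ(y, ϖ))`. -/
def mono (φ : Fm (Ty.Om :: τ :: Γ)) : Fm Γ :=
  Fm.all Ty.Om (Fm.all τ (Fm.all τ
    (Fm.imp (Fm.and (leF τ v1 v0) (φ.at v2 v1 fun _ v => Tm.var (Var.s (Var.s (Var.s v)))))
      (φ.at v2 v0 fun _ v => Tm.var (Var.s (Var.s (Var.s v)))))))

/-- The quantifier `∀μ > 0` over the rational numbers, where `μ` is given by a code. -/
def allRatPos (φ : Fm (Ty.nat :: Γ)) : Fm Γ := Fm.all Ty.nat (Fm.imp (qltF qzero v0) φ)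

end Probability

end FinType

/-!
By completeness, an implication is provable in an extension `T` of the system as soon as it holds
in the countable Henkin models of `T`. The numbers of type `0` in such a model form an ordered
semiring, which embeds in an ordered field; the inequalities between real numbers of the model
thereby become inequalities between rational approximations in that field.

In a model, uniform boundedness bounds the witnesses `x` of an `∃`-formula uniformly in `ϖ` (or in
`A`), and monotonicity turns the bound into a single witness. For the sample space this is used by
contradiction: if no `ϖ` outside `A` satisfies `φ(x, ϖ)` for every `x`, then `¬ φ(x, ϖ)` has one
witness `x` that works for all of them. For the event space the bound is taken over the events `A`
with `P(A) ≤ λ - μ`: the slack `μ` replaces the condition `P(A) < λ` by an inequality that is a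
`∀`-formula, as the premise of an `∃`-formula has to be.
-/

namespace FinType

/-! ### Completeness -/

section Substitution

variable {Γ Δ Ξ : List Ty}

/-- The composition of substitutions: first `s`, then `t`. -/
def Sub.comp (s : Sub Γ Δ) (t : Sub Δ Ξ) : Sub Γ Ξ := fun _ v => (s _ v).subst t

/-- The weakening by one new variable, as a substitution. -/
def Sub.shift {τ : Ty} : Sub Γ (τ :: Γ) := fun _ v => Tm.var (Var.s v)

theorem Tm.ren_eq_subst (r : Ren Γ Δ) {σ : Ty} (t : Tm Γ σ) :
    t.ren r = t.subst fun _ v => Tm.var (r _ v) := by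
  induction t with
  | var v => rfl
  | con c => rfl
  | app t u iht ihu => simp only [Tm.ren, Tm.subst, iht, ihu]

theorem Tm.wk_eq_subst {τ σ : Ty} (t : Tm Γ σ) : (t.wk : Tm (τ :: Γ) σ) = t.subst Sub.shift :=
  Tm.ren_eq_subst _ t

theorem Tm.subst_subst (s : Sub Γ Δ) (s' : Sub Δ Ξ) {σ : Ty} (t : Tm Γ σ) :
    (t.subst s).subst s' = t.subst (s.comp s') := by
  induction t with
  | var v => rfl
  | con c => rfl
  | app t u iht ihu => simp only [Tm.subst, iht, ihu]

theorem Tm.subst_id {σ : Ty} (t : Tm Γ σ) : t.subst Sub.id = t := by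
  induction t with
  | var v => rfl
  | con c => rfl
  | app t u iht ihu => simp only [Tm.subst, iht, ihu]

theorem Sub.comp_id (s : Sub Γ Δ) : s.comp Sub.id = s :=
  funext fun _ => funext fun v => Tm.subst_id (s _ v)

theorem Sub.shift_comp_cons {τ : Ty} (t : Tm Δ τ) (s : Sub Γ Δ) : Sub.shift.comp (s.cons t) = s :=
  rfl

theorem Sub.comp_shift (s : Sub Γ Δ) (τ : Ty) : s.comp Sub.shift = Sub.shift.comp (s.lift τ) :=
  funext fun _ => funext fun v => (Tm.wk_eq_subst (s _ v)).symm

theorem Sub.lift_id (τ : Ty) : (Sub.id (Γ := Γ)).lift τ = Sub.id := by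
  funext σ v
  cases v <;> rfl

theorem Sub.lift_comp_lift (s : Sub Γ Δ) (s' : Sub Δ Ξ) (τ : Ty) :
    (s.lift τ).comp (s'.lift τ) = (s.comp s').lift τ := by
  funext σ v
  cases v with
  | z => rfl
  | s v =>
      change (s σ v).wk.subst (s'.lift τ) = ((s σ v).subst s').wk
      rw [Tm.wk_eq_subst, Tm.wk_eq_subst, Tm.subst_subst, Tm.subst_subst, Sub.comp_shift]

theorem Sub.lift_comp_cons (s : Sub Γ Δ) (s' : Sub Δ Ξ) {τ : Ty} (t : Tm Ξ τ) :
    (s.lift τ).comp (s'.cons t) = (s.comp s').cons t := by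
  funext σ v
  cases v with
  | z => rfl
  | s v =>
      change (s σ v).wk.subst (s'.cons t) = (s σ v).subst s'
      rw [Tm.wk_eq_subst, Tm.subst_subst, Sub.shift_comp_cons]

theorem Sub.cons_comp (s : Sub Γ Δ) (s' : Sub Δ Ξ) {τ : Ty} (t : Tm Δ τ) :
    (s.cons t).comp s' = (s.comp s').cons (t.subst s') := by
  funext σ v
  cases v <;> rfl

theorem Sub.cons_v0_shift (τ : Ty) : (Sub.shift (Γ := Γ)).cons (v0 (σ := τ)) = Sub.id := by
  funext σ v
  cases v <;> rfl

theorem Fm.subst_subst (s : Sub Γ Δ) (s' : Sub Δ Ξ) (φ : Fm Γ) :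
    (φ.subst s).subst s' = φ.subst (s.comp s') := by
  induction φ generalizing Δ Ξ with
  | eq t u => simp only [Fm.subst, Tm.subst_subst]
  | and φ ψ h₁ h₂ => simp only [Fm.subst, h₁, h₂]
  | or φ ψ h₁ h₂ => simp only [Fm.subst, h₁, h₂]
  | imp φ ψ h₁ h₂ => simp only [Fm.subst, h₁, h₂]
  | all σ φ h => simp only [Fm.subst, h, Sub.lift_comp_lift]
  | ex σ φ h => simp only [Fm.subst, h, Sub.lift_comp_lift]

theorem Fm.subst_id (φ : Fm Γ) : φ.subst Sub.id = φ := by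
  induction φ with
  | eq t u => simp only [Fm.subst, Tm.subst_id]
  | and φ ψ h₁ h₂ => simp only [Fm.subst, h₁, h₂]
  | or φ ψ h₁ h₂ => simp only [Fm.subst, h₁, h₂]
  | imp φ ψ h₁ h₂ => simp only [Fm.subst, h₁, h₂]
  | all σ φ h => simp only [Fm.subst, Sub.lift_id, h]
  | ex σ φ h => simp only [Fm.subst, Sub.lift_id, h]

theorem Fm.wk_eq_subst {τ : Ty} (φ : Fm Γ) : (φ.wk : Fm (τ :: Γ)) = φ.subst Sub.shift := rfl

theorem Fm.inst_subst_lift (s : Sub Γ Δ) {τ : Ty} (t : Tm Δ τ) (φ : Fm (τ :: Γ)) :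
    (φ.subst (s.lift τ)).inst t = φ.subst (s.cons t) := by
  rw [Fm.inst, Fm.subst_subst, Sub.lift_comp_cons, Sub.comp_id]

theorem Fm.subst_inst (s : Sub Γ Δ) {τ : Ty} (t : Tm Γ τ) (φ : Fm (τ :: Γ)) :
    (φ.inst t).subst s = (φ.subst (s.lift τ)).inst (t.subst s) := by
  rw [Fm.inst_subst_lift, Fm.inst, Fm.subst_subst, Sub.cons_comp]
  rfl

theorem Fm.subst_lift_wk (s : Sub Γ Δ) {τ : Ty} (φ : Fm Γ) :
    φ.wk.subst (s.lift τ) = (φ.subst s).wk := by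
  rw [Fm.wk_eq_subst, Fm.wk_eq_subst, Fm.subst_subst, Fm.subst_subst, Sub.comp_shift]

theorem Fm.inst_v0_wkBelow {τ : Ty} (φ : Fm (τ :: Γ)) : φ.wkBelow.inst v0 = φ :=
  (Fm.inst_subst_lift Sub.shift v0 φ).trans (by rw [Sub.cons_v0_shift, Fm.subst_id])

end Substitution

/-- A closed term of each type. -/
def Tm.inhabitant {Γ : List Ty} : (σ : Ty) → Tm Γ σ
  | Ty.nat => Tm.con Con.zero
  | Ty.Om => Tm.con Con.pt
  | Ty.Ev => Tm.con Con.empty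
  | Ty.fn ρ τ => Tm.app (Tm.con (Con.proj τ ρ)) (Tm.inhabitant τ)

/-- Derivability from an arbitrary set of assumptions in classical many-sorted predicate logic.
Unlike `Derives`, it has no axioms and no rule of extensionality: the theorems of a theory enter
as assumptions. It is therefore closed under substitution whatever the theory. -/
inductive Entails : {Γ : List Ty} → Set (Fm Γ) → Fm Γ → Prop
  | hyp {Γ : List Ty} {S : Set (Fm Γ)} {φ : Fm Γ} : φ ∈ S → Entails S φ
  | andI {Γ : List Ty} {S : Set (Fm Γ)} {φ ψ : Fm Γ} :
      Entails S φ → Entails S ψ → Entails S (Fm.and φ ψ)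
  | andL {Γ : List Ty} {S : Set (Fm Γ)} {φ ψ : Fm Γ} : Entails S (Fm.and φ ψ) → Entails S φ
  | andR {Γ : List Ty} {S : Set (Fm Γ)} {φ ψ : Fm Γ} : Entails S (Fm.and φ ψ) → Entails S ψ
  | orL {Γ : List Ty} {S : Set (Fm Γ)} {φ ψ : Fm Γ} : Entails S φ → Entails S (Fm.or φ ψ)
  | orR {Γ : List Ty} {S : Set (Fm Γ)} {φ ψ : Fm Γ} : Entails S ψ → Entails S (Fm.or φ ψ)
  | orE {Γ : List Ty} {S : Set (Fm Γ)} {φ ψ χ : Fm Γ} :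
      Entails S (Fm.or φ ψ) → Entails (insert φ S) χ → Entails (insert ψ S) χ → Entails S χ
  | impI {Γ : List Ty} {S : Set (Fm Γ)} {φ ψ : Fm Γ} :
      Entails (insert φ S) ψ → Entails S (Fm.imp φ ψ)
  | impE {Γ : List Ty} {S : Set (Fm Γ)} {φ ψ : Fm Γ} :
      Entails S (Fm.imp φ ψ) → Entails S φ → Entails S ψ
  | raa {Γ : List Ty} {S : Set (Fm Γ)} {φ : Fm Γ} :
      Entails (insert φ.neg S) Fm.bot → Entails S φ
  | allI {Γ : List Ty} {S : Set (Fm Γ)} {σ : Ty} {φ : Fm (σ :: Γ)} :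
      Entails (Fm.wk '' S) φ → Entails S (Fm.all σ φ)
  | allE {Γ : List Ty} {S : Set (Fm Γ)} {σ : Ty} {φ : Fm (σ :: Γ)} (t : Tm Γ σ) :
      Entails S (Fm.all σ φ) → Entails S (φ.inst t)
  | exI {Γ : List Ty} {S : Set (Fm Γ)} {σ : Ty} {φ : Fm (σ :: Γ)} (t : Tm Γ σ) :
      Entails S (φ.inst t) → Entails S (Fm.ex σ φ)
  | exE {Γ : List Ty} {S : Set (Fm Γ)} {σ : Ty} {φ : Fm (σ :: Γ)} {ψ : Fm Γ} :
      Entails S (Fm.ex σ φ) → Entails (insert φ (Fm.wk '' S)) ψ.wk → Entails S ψ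

namespace Entails

variable {Γ : List Ty} {S S' : Set (Fm Γ)} {φ ψ : Fm Γ} {σ : Ty}

theorem mono (h : Entails S φ) (hS : S ⊆ S') : Entails S' φ := by
  induction h with
  | hyp h => exact .hyp (hS h)
  | andI _ _ h₁ h₂ => exact .andI (h₁ hS) (h₂ hS)
  | andL _ h => exact .andL (h hS)
  | andR _ h => exact .andR (h hS)
  | orL _ h => exact .orL (h hS)
  | orR _ h => exact .orR (h hS)
  | orE _ _ _ h h₁ h₂ =>
      exact .orE (h hS) (h₁ (Set.insert_subset_insert hS)) (h₂ (Set.insert_subset_insert hS))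
  | impI _ h => exact .impI (h (Set.insert_subset_insert hS))
  | impE _ _ h₁ h₂ => exact .impE (h₁ hS) (h₂ hS)
  | raa _ h => exact .raa (h (Set.insert_subset_insert hS))
  | allI _ h => exact .allI (h (Set.image_mono hS))
  | allE t _ h => exact .allE t (h hS)
  | exI t _ h => exact .exI t (h hS)
  | exE _ _ h₁ h₂ => exact .exE (h₁ hS) (h₂ (Set.insert_subset_insert (Set.image_mono hS)))

theorem image_subst_lift_wk {Δ : List Ty} (s : Sub Γ Δ) (σ : Ty) (S : Set (Fm Γ)) :
    Fm.subst (s.lift σ) '' (Fm.wk '' S) = Fm.wk '' (Fm.subst s '' S) := by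
  rw [Set.image_image, Set.image_image]
  exact Set.image_congr fun φ _ => Fm.subst_lift_wk s φ

theorem subst {Δ : List Ty} (s : Sub Γ Δ) (h : Entails S φ) :
    Entails (Fm.subst s '' S) (φ.subst s) := by
  induction h generalizing Δ with
  | hyp h => exact .hyp (Set.mem_image_of_mem _ h)
  | andI _ _ h₁ h₂ => exact .andI (h₁ s) (h₂ s)
  | andL _ h => exact .andL (h s)
  | andR _ h => exact .andR (h s)
  | orL _ h => exact .orL (h s)
  | orR _ h => exact .orR (h s)
  | orE _ _ _ h h₁ h₂ =>
      exact .orE (h s) (Set.image_insert_eq ▸ h₁ s) (Set.image_insert_eq ▸ h₂ s)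
  | impI _ h => exact .impI (Set.image_insert_eq ▸ h s)
  | impE _ _ h₁ h₂ => exact .impE (h₁ s) (h₂ s)
  | raa _ h =>
      have h := h s
      rw [Set.image_insert_eq] at h
      exact .raa h
  | allI _ h => exact .allI (image_subst_lift_wk s _ _ ▸ h (s.lift _))
  | allE t _ h => exact Fm.subst_inst s t _ ▸ .allE _ (h s)
  | exI t _ h => exact .exI _ (Fm.subst_inst s t _ ▸ h s)
  | exE _ _ h₁ h₂ =>
      have h₂ := h₂ (s.lift _)
      rw [Set.image_insert_eq, image_subst_lift_wk, Fm.subst_lift_wk] at h₂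
      exact .exE (h₁ s) h₂

theorem wk (h : Entails S φ) : Entails (Fm.wk '' S) (φ.wk : Fm (σ :: Γ)) := h.subst _

theorem weaken (h : Entails S φ) : Entails (insert ψ S) φ := h.mono (Set.subset_insert _ _)

theorem insert_self (S : Set (Fm Γ)) (φ : Fm Γ) : Entails (insert φ S) φ :=
  .hyp (Set.mem_insert _ _)

theorem botE (h : Entails S Fm.bot) : Entails S φ := .raa h.weaken

theorem cut (h : Entails S φ) (h' : Entails (insert φ S) ψ) : Entails S ψ := .impE (.impI h') h

theorem bot_of_wk (h : Entails (Fm.wk (τ := σ) '' S) Fm.bot) : Entails S Fm.bot :=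
  .allE (φ := Fm.bot) (Tm.inhabitant σ) (.allI h)

theorem ex_neg_of_neg_all {φ : Fm (σ :: Γ)} (h : Entails S (Fm.all σ φ).neg) :
    Entails S (Fm.ex σ φ.neg) := by
  refine .raa (.impE h.weaken (.allI (.raa ?_)))
  refine .impE (φ := (Fm.ex σ φ.neg).wk) ?_ (.exI v0 ?_)
  · rw [Set.image_insert_eq]
    exact (insert_self _ _).weaken
  · exact (Fm.inst_v0_wkBelow φ.neg).symm ▸ insert_self _ _

end Entails

section Compactness

variable {T : Theory} {Γ : List Ty} {S : Set (Fm Γ)}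

theorem Derives.mono {H H' : List (Fm Γ)} {φ : Fm Γ} (h : Derives T H φ) (hH : H ⊆ H') :
    Derives T H' φ := by
  induction h with
  | ax h => exact .ax h
  | hyp h => exact .hyp (hH h)
  | andI _ _ h₁ h₂ => exact .andI (h₁ hH) (h₂ hH)
  | andL _ h => exact .andL (h hH)
  | andR _ h => exact .andR (h hH)
  | orL _ h => exact .orL (h hH)
  | orR _ h => exact .orR (h hH)
  | orE _ _ _ h h₁ h₂ =>
      exact .orE (h hH) (h₁ (List.cons_subset_cons _ hH)) (h₂ (List.cons_subset_cons _ hH))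
  | impI _ h => exact .impI (h (List.cons_subset_cons _ hH))
  | impE _ _ h₁ h₂ => exact .impE (h₁ hH) (h₂ hH)
  | raa _ h => exact .raa (h (List.cons_subset_cons _ hH))
  | allI _ h => exact .allI (h (List.map_subset _ hH))
  | allE t _ h => exact .allE t (h hH)
  | exI t _ h => exact .exI t (h hH)
  | exE _ _ h₁ h₂ => exact .exE (h₁ hH) (h₂ (List.cons_subset_cons _ (List.map_subset _ hH)))
  | qfer r hφ h _ => exact .qfer r hφ h

theorem Derives.cut {H L : List (Fm Γ)} {φ : Fm Γ} (h : Derives T L φ)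
    (hL : ∀ χ ∈ L, Derives T H χ) : Derives T H φ := by
  induction L generalizing φ with
  | nil => exact h.mono (List.nil_subset _)
  | cons χ L ih =>
      rw [List.forall_mem_cons] at hL
      exact .impE (ih (.impI h) hL.2) hL.1

/-- Derivability in a theory from finitely many members of a set of assumptions. -/
def DerivesFrom (T : Theory) {Γ : List Ty} (S : Set (Fm Γ)) (φ : Fm Γ) : Prop :=
  ∃ L : List (Fm Γ), (∀ χ ∈ L, χ ∈ S) ∧ Derives T L φ

theorem DerivesFrom.exists_cons {φ ψ : Fm Γ} (h : DerivesFrom T (insert φ S) ψ) :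
    ∃ L : List (Fm Γ), (∀ χ ∈ L, χ ∈ S) ∧ Derives T (φ :: L) ψ := by
  classical
  obtain ⟨L, hL, d⟩ := h
  refine ⟨L.filter fun χ => χ ∈ S, fun χ hχ => by simpa using (List.mem_filter.1 hχ).2,
    d.mono fun χ hχ => ?_⟩
  rcases hL χ hχ with rfl | hS
  · exact List.mem_cons_self
  · exact List.mem_cons_of_mem _ (List.mem_filter.2 ⟨hχ, by simpa using hS⟩)

theorem exists_map_eq_of_forall_mem_image {α β : Type*} {f : α → β} {A : Set α} {L : List β}
    (h : ∀ b ∈ L, b ∈ f '' A) : ∃ L' : List α, (∀ a ∈ L', a ∈ A) ∧ L'.map f = L := by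
  induction L with
  | nil => exact ⟨[], List.forall_mem_nil _, rfl⟩
  | cons b L ih =>
      rw [List.forall_mem_cons] at h
      obtain ⟨⟨a, ha, rfl⟩, h⟩ := h
      obtain ⟨L', hL', rfl⟩ := ih h
      exact ⟨a :: L', List.forall_mem_cons.2 ⟨ha, hL'⟩, rfl⟩

theorem DerivesFrom.map {φ ψ : Fm Γ} (f : ∀ {L : List (Fm Γ)}, Derives T L φ → Derives T L ψ)
    (h : DerivesFrom T S φ) : DerivesFrom T S ψ :=
  h.imp fun _ h => ⟨h.1, f h.2⟩

theorem DerivesFrom.map₂ {φ ψ χ : Fm Γ}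
    (f : ∀ {L : List (Fm Γ)}, Derives T L φ → Derives T L ψ → Derives T L χ)
    (h₁ : DerivesFrom T S φ) (h₂ : DerivesFrom T S ψ) : DerivesFrom T S χ := by
  obtain ⟨L₁, hL₁, d₁⟩ := h₁
  obtain ⟨L₂, hL₂, d₂⟩ := h₂
  exact ⟨L₁ ++ L₂, List.forall_mem_append.2 ⟨hL₁, hL₂⟩,
    f (d₁.mono (List.subset_append_left _ _)) (d₂.mono (List.subset_append_right _ _))⟩

theorem DerivesFrom.imp {φ ψ : Fm Γ} (h : DerivesFrom T (insert φ S) ψ) :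
    DerivesFrom T S (Fm.imp φ ψ) := by
  obtain ⟨L, hL, d⟩ := h.exists_cons
  exact ⟨L, hL, .impI d⟩

theorem DerivesFrom.all {σ : Ty} {φ : Fm (σ :: Γ)} (h : DerivesFrom T (Fm.wk '' S) φ) :
    DerivesFrom T S (Fm.all σ φ) := by
  obtain ⟨L, hL, d⟩ := h
  obtain ⟨L, hS, rfl⟩ := exists_map_eq_of_forall_mem_image hL
  exact ⟨L, hS, .allI d⟩

theorem DerivesFrom.or_elim {φ ψ χ : Fm Γ} (h : DerivesFrom T S (Fm.or φ ψ))
    (h₁ : DerivesFrom T (insert φ S) χ) (h₂ : DerivesFrom T (insert ψ S) χ) :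
    DerivesFrom T S χ := by
  refine .map₂ (fun d d' => .orE d ?_ ?_) h (.map₂ .andI h₁.imp h₂.imp)
  · exact .impE (d'.andL.mono (List.subset_cons_self _ _)) (.hyp List.mem_cons_self)
  · exact .impE (d'.andR.mono (List.subset_cons_self _ _)) (.hyp List.mem_cons_self)

theorem DerivesFrom.ex_elim {σ : Ty} {φ : Fm (σ :: Γ)} {ψ : Fm Γ}
    (h₁ : DerivesFrom T S (Fm.ex σ φ)) (h₂ : DerivesFrom T (insert φ (Fm.wk '' S)) ψ.wk) :
    DerivesFrom T S ψ := by
  have elim : Derives T [Fm.ex σ φ, Fm.all σ (Fm.imp φ ψ.wk)] ψ := by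
    refine .exE (.hyp List.mem_cons_self) (.impE (φ := φ) ?_ (.hyp List.mem_cons_self))
    have elimAll (H : List (Fm (σ :: Γ))) : Derives T (φ :: (Fm.ex σ φ).wk ::
        (Fm.all σ (Fm.imp φ ψ.wk)).wk :: H) ((Fm.imp φ ψ.wk).wkBelow.inst v0) :=
      .allE v0 (.hyp (List.mem_cons_of_mem _ (List.mem_cons_of_mem _ List.mem_cons_self)))
    rw [Fm.inst_v0_wkBelow] at elimAll
    exact elimAll []
  exact .map₂ (fun d₁ d₂ => elim.cut (by simp [d₁, d₂])) h₁ h₂.imp.all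

theorem Entails.derivesFrom {φ : Fm Γ} (h : Entails S φ) : DerivesFrom T S φ := by
  induction h with
  | @hyp _ _ φ h => exact ⟨[φ], by simpa using h, .hyp List.mem_cons_self⟩
  | andI _ _ h₁ h₂ => exact .map₂ .andI h₁ h₂
  | andL _ h => exact h.map .andL
  | andR _ h => exact h.map .andR
  | orL _ h => exact h.map .orL
  | orR _ h => exact h.map .orR
  | orE _ _ _ h h₁ h₂ => exact h.or_elim h₁ h₂
  | impI _ h => exact h.imp
  | impE _ _ h₁ h₂ => exact .map₂ .impE h₁ h₂
  | raa _ h =>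
      obtain ⟨L, hL, d⟩ := h.exists_cons
      exact ⟨L, hL, .raa d⟩
  | allI _ h => exact h.all
  | allE t _ h => exact h.map (.allE t)
  | exI t _ h => exact h.map (.exI t)
  | exE _ _ h₁ h₂ => exact h₁.ex_elim h₂

end Compactness

section Countability

open Nat (pair pair_eq_pair)

/-- A Gödel numbering of the types. -/
def Ty.code : Ty → ℕ
  | Ty.nat => pair 0 0
  | Ty.Om => pair 1 0
  | Ty.Ev => pair 2 0
  | Ty.fn ρ τ => pair 3 (pair ρ.code τ.code)

theorem Ty.code_injective : ∀ {σ τ : Ty}, σ.code = τ.code → σ = τ := by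
  intro σ
  induction σ with
  | fn ρ τ h₁ h₂ =>
      intro τ' h
      cases τ' <;> simp only [Ty.code, pair_eq_pair] at h <;> try omega
      rw [h₁ h.2.1, h₂ h.2.2]
  | _ =>
      intro τ' h
      cases τ' <;> simp only [Ty.code, pair_eq_pair] at h <;> first | rfl | omega

/-- A Gödel numbering of the contexts. -/
def Ty.codes : List Ty → ℕ
  | [] => 0
  | σ :: Γ => pair σ.code (Ty.codes Γ) + 1

theorem Ty.codes_injective : ∀ {Γ Δ : List Ty}, Ty.codes Γ = Ty.codes Δ → Γ = Δ
  | [], [], _ => rfl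
  | [], _ :: _, h => by simp [Ty.codes] at h
  | _ :: _, [], h => by simp [Ty.codes] at h
  | _ :: _, _ :: _, h => by
      simp only [Ty.codes, Nat.add_right_cancel_iff, pair_eq_pair] at h
      rw [Ty.code_injective h.1, Ty.codes_injective h.2]

/-- The de Bruijn index of a variable. -/
def Var.code : {Γ : List Ty} → {σ : Ty} → Var Γ σ → ℕ
  | _, _, Var.z => 0
  | _, _, Var.s v => v.code + 1

theorem Var.code_injective {Γ : List Ty} {σ : Ty} (v : Var Γ σ) : ∀ {σ' : Ty} (v' : Var Γ σ'),
    v.code = v'.code → σ = σ' ∧ HEq v v' := by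
  induction v with
  | z =>
      intro σ' v' h
      cases v' with
      | z => exact ⟨rfl, HEq.rfl⟩
      | s v' => simp [Var.code] at h
  | s v ih =>
      intro σ' v' h
      cases v' with
      | z => simp [Var.code] at h
      | s v' =>
          obtain ⟨rfl, h⟩ := ih v' (by simpa [Var.code] using h)
          cases h
          exact ⟨rfl, HEq.rfl⟩

/-- A Gödel numbering of the constants. -/
def Con.code : {σ : Ty} → Con σ → ℕ
  | _, Con.zero => pair 0 0
  | _, Con.succ => pair 1 0
  | _, Con.proj ρ τ => pair 2 (pair ρ.code τ.code)
  | _, Con.comb δ ρ τ => pair 3 (pair δ.code (pair ρ.code τ.code))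
  | _, Con.recursor ρs i => pair 4 (pair (Ty.codes ρs) i.code)
  | _, Con.eqOm => pair 5 0
  | _, Con.mem => pair 6 0
  | _, Con.union => pair 7 0
  | _, Con.compl => pair 8 0
  | _, Con.empty => pair 9 0
  | _, Con.prob => pair 10 0
  | _, Con.pt => pair 11 0

theorem Con.code_injective {σ : Ty} (c : Con σ) {σ' : Ty} (c' : Con σ')
    (h : c.code = c'.code) : σ = σ' ∧ HEq c c' := by
  have h₀ : (Nat.unpair c.code).1 = (Nat.unpair c'.code).1 := by rw [h]
  cases c <;> cases c' <;> simp only [Con.code, Nat.unpair_pair] at h₀ <;> try omega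
  all_goals try exact ⟨rfl, HEq.rfl⟩
  · simp only [Con.code, pair_eq_pair] at h
    cases Ty.code_injective h.2.1
    cases Ty.code_injective h.2.2
    exact ⟨rfl, HEq.rfl⟩
  · simp only [Con.code, pair_eq_pair] at h
    cases Ty.code_injective h.2.1
    cases Ty.code_injective h.2.2.1
    cases Ty.code_injective h.2.2.2
    exact ⟨rfl, HEq.rfl⟩
  · simp only [Con.code, pair_eq_pair] at h
    cases Ty.codes_injective h.2.1
    obtain ⟨rfl, h⟩ := Var.code_injective _ _ h.2.2
    cases h
    exact ⟨rfl, HEq.rfl⟩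

/-- A Gödel numbering of the terms. -/
def Tm.code : {Γ : List Ty} → {σ : Ty} → Tm Γ σ → ℕ
  | _, _, Tm.var v => pair 0 v.code
  | _, _, Tm.con c => pair 1 c.code
  | _, _, Tm.app t u => pair 2 (pair t.code u.code)

theorem Tm.code_injective {Γ : List Ty} {σ : Ty} (t : Tm Γ σ) : ∀ {σ' : Ty} (t' : Tm Γ σ'),
    t.code = t'.code → σ = σ' ∧ HEq t t' := by
  induction t with
  | var v =>
      intro σ' t' h
      cases t' <;> simp only [Tm.code, pair_eq_pair] at h <;> try omega
      obtain ⟨rfl, h⟩ := Var.code_injective _ _ h.2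
      cases h
      exact ⟨rfl, HEq.rfl⟩
  | con c =>
      intro σ' t' h
      cases t' <;> simp only [Tm.code, pair_eq_pair] at h <;> try omega
      obtain ⟨rfl, h⟩ := Con.code_injective _ _ h.2
      cases h
      exact ⟨rfl, HEq.rfl⟩
  | app t u iht ihu =>
      intro σ' t' h
      cases t' <;> simp only [Tm.code, pair_eq_pair] at h <;> try omega
      obtain ⟨h₁, h₁'⟩ := iht _ h.2.1
      cases h₁
      cases h₁'
      obtain ⟨_, h₂'⟩ := ihu _ h.2.2
      cases h₂'
      exact ⟨rfl, HEq.rfl⟩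

/-- A Gödel numbering of the formulas. -/
def Fm.code : {Γ : List Ty} → Fm Γ → ℕ
  | _, Fm.eq t u => pair 0 (pair t.code u.code)
  | _, Fm.and φ ψ => pair 1 (pair φ.code ψ.code)
  | _, Fm.or φ ψ => pair 2 (pair φ.code ψ.code)
  | _, Fm.imp φ ψ => pair 3 (pair φ.code ψ.code)
  | _, Fm.all σ φ => pair 4 (pair σ.code φ.code)
  | _, Fm.ex σ φ => pair 5 (pair σ.code φ.code)

theorem Fm.code_injective {Γ : List Ty} (φ : Fm Γ) : ∀ φ' : Fm Γ, φ.code = φ'.code → φ = φ' := by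
  induction φ with
  | eq t u =>
      intro φ' h
      cases φ' <;> simp only [Fm.code, pair_eq_pair] at h <;> try omega
      obtain ⟨_, h₁⟩ := Tm.code_injective _ _ h.2.1
      obtain ⟨_, h₂⟩ := Tm.code_injective _ _ h.2.2
      cases h₁
      cases h₂
      rfl
  | all σ φ ih =>
      intro φ' h
      cases φ' <;> simp only [Fm.code, pair_eq_pair] at h <;> try omega
      cases Ty.code_injective h.2.1
      rw [ih _ h.2.2]
  | ex σ φ ih =>
      intro φ' h
      cases φ' <;> simp only [Fm.code, pair_eq_pair] at h <;> try omega
      cases Ty.code_injective h.2.1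
      rw [ih _ h.2.2]
  | _ φ ψ ih₁ ih₂ =>
      intro φ' h
      cases φ' <;> simp only [Fm.code, pair_eq_pair] at h <;> try omega
      rw [ih₁ _ h.2.1, ih₂ _ h.2.2]

instance : Countable Ty := ⟨⟨Ty.code, fun _ _ => Ty.code_injective⟩⟩

instance {Γ : List Ty} : Countable (Fm Γ) := ⟨⟨Fm.code, fun _ _ => Fm.code_injective _ _⟩⟩

end Countability

/-- A many-sorted structure for the language, with a domain `D σ` for each type `σ`. The
interpretation `eq` of equality of numbers is an arbitrary relation. -/
structure Model where
  D : Ty → Type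
  app : {σ τ : Ty} → D (Ty.fn σ τ) → D σ → D τ
  con : {σ : Ty} → Con σ → D σ
  eq : D Ty.nat → D Ty.nat → Prop

/-- Assignments of values to the variables of a context. -/
abbrev Env (M : Model) (Γ : List Ty) : Type := ∀ σ : Ty, Var Γ σ → M.D σ

/-- The extension of an assignment by a value for one more variable. -/
def Env.cons {M : Model} {Γ : List Ty} {τ : Ty} (a : M.D τ) (ρ : Env M Γ) : Env M (τ :: Γ)
  | _, Var.z => a
  | _, Var.s v => ρ _ v

/-- The value of a term. -/
def Tm.eval {M : Model} {Γ : List Ty} (ρ : Env M Γ) : {σ : Ty} → Tm Γ σ → M.D σ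
  | _, Tm.var v => ρ _ v
  | _, Tm.con c => M.con c
  | _, Tm.app t u => M.app (t.eval ρ) (u.eval ρ)

/-- The value of a substitution. -/
def Sub.eval {M : Model} {Γ Δ : List Ty} (ρ : Env M Δ) (s : Sub Γ Δ) : Env M Γ :=
  fun _ v => (s _ v).eval ρ

/-- Satisfaction of a formula in a model. -/
def Sat {M : Model} : {Γ : List Ty} → Env M Γ → Fm Γ → Prop
  | _, ρ, Fm.eq t u => M.eq (t.eval ρ) (u.eval ρ)
  | _, ρ, Fm.and φ ψ => Sat ρ φ ∧ Sat ρ ψ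
  | _, ρ, Fm.or φ ψ => Sat ρ φ ∨ Sat ρ ψ
  | _, ρ, Fm.imp φ ψ => Sat ρ φ → Sat ρ ψ
  | _, ρ, Fm.all σ φ => ∀ a : M.D σ, Sat (Env.cons a ρ) φ
  | _, ρ, Fm.ex σ φ => ∃ a : M.D σ, Sat (Env.cons a ρ) φ

section Evaluation

variable {M : Model} {Γ Δ : List Ty}

theorem sat_and (ρ : Env M Γ) (φ ψ : Fm Γ) : Sat ρ (Fm.and φ ψ) ↔ Sat ρ φ ∧ Sat ρ ψ := Iff.rfl

theorem sat_or (ρ : Env M Γ) (φ ψ : Fm Γ) : Sat ρ (Fm.or φ ψ) ↔ Sat ρ φ ∨ Sat ρ ψ := Iff.rfl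

theorem sat_imp (ρ : Env M Γ) (φ ψ : Fm Γ) : Sat ρ (Fm.imp φ ψ) ↔ (Sat ρ φ → Sat ρ ψ) := Iff.rfl

theorem Tm.eval_subst (ρ : Env M Δ) (s : Sub Γ Δ) {σ : Ty} (t : Tm Γ σ) :
    (t.subst s).eval ρ = t.eval (s.eval ρ) := by
  induction t with
  | var v => rfl
  | con c => rfl
  | app t u iht ihu => simp only [Tm.subst, Tm.eval, iht, ihu]

theorem Tm.eval_wk (ρ : Env M Γ) {τ σ : Ty} (a : M.D τ) (t : Tm Γ σ) :
    (t.wk).eval (Env.cons a ρ) = t.eval ρ := by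
  rw [Tm.wk_eq_subst, Tm.eval_subst]
  rfl

theorem Sub.eval_lift (ρ : Env M Δ) (s : Sub Γ Δ) {τ : Ty} (a : M.D τ) :
    (s.lift τ).eval (Env.cons a ρ) = Env.cons a (s.eval ρ) := by
  funext σ v
  cases v with
  | z => rfl
  | s v => exact Tm.eval_wk _ _ _

theorem Sub.eval_cons (ρ : Env M Δ) (s : Sub Γ Δ) {τ : Ty} (t : Tm Δ τ) :
    (Sub.cons t s).eval ρ = Env.cons (t.eval ρ) (s.eval ρ) := by
  funext σ v
  cases v <;> rfl

theorem sat_subst (ρ : Env M Δ) (s : Sub Γ Δ) (φ : Fm Γ) :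
    Sat ρ (φ.subst s) ↔ Sat (s.eval ρ) φ := by
  induction φ generalizing Δ with
  | eq t u => simp only [Fm.subst, Sat, Tm.eval_subst]
  | and φ ψ h₁ h₂ => simp only [Fm.subst, Sat, h₁, h₂]
  | or φ ψ h₁ h₂ => simp only [Fm.subst, Sat, h₁, h₂]
  | imp φ ψ h₁ h₂ => simp only [Fm.subst, Sat, h₁, h₂]
  | all σ φ h => simp only [Fm.subst, Sat, h, Sub.eval_lift]
  | ex σ φ h => simp only [Fm.subst, Sat, h, Sub.eval_lift]

theorem sat_inst (ρ : Env M Γ) {τ : Ty} (t : Tm Γ τ) (φ : Fm (τ :: Γ)) :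
    Sat ρ (φ.inst t) ↔ Sat (Env.cons (t.eval ρ) ρ) φ := by
  rw [Fm.inst, sat_subst, Sub.eval_cons]
  rfl

theorem sat_wk (ρ : Env M Γ) {τ : Ty} (a : M.D τ) (φ : Fm Γ) :
    Sat (Env.cons a ρ) φ.wk ↔ Sat ρ φ := by
  rw [Fm.wk, sat_subst]
  rfl

end Evaluation

section Henkin

open Filter

/-- The sequence that continues `x` by the successor operation `next` from index `m` on; below
`m`, its members are dummies. -/
def extend {C : ℕ → Type} [∀ n, Inhabited (C n)] (next : ∀ n, C n → C (n + 1)) {m : ℕ}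
    (x : C m) (n : ℕ) : C n :=
  if h : m ≤ n then Nat.leRecOn h (next _) x else default

section Extend

variable {C : ℕ → Type} [∀ n, Inhabited (C n)] (next : ∀ n, C n → C (n + 1)) {m : ℕ} (x : C m)

theorem extend_self : extend next x m = x := by
  rw [extend, dif_pos le_rfl, Nat.leRecOn_self]

theorem extend_succ {n : ℕ} (h : m ≤ n) : extend next x (n + 1) = next n (extend next x n) := by
  rw [extend, extend, dif_pos h, dif_pos (Nat.le_succ_of_le h), Nat.leRecOn_succ]

end Extend

instance {Γ : List Ty} : Inhabited (Fm Γ) := ⟨Fm.bot⟩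

instance {Γ : List Ty} {σ : Ty} : Inhabited (Tm Γ σ) := ⟨Tm.inhabitant σ⟩

variable {Γ : List Ty}

/-- The contexts obtained from `Γ` by adding variables of the types `ty 0`, `ty 1`, …. -/
@[reducible] def lev (Γ : List Ty) (ty : ℕ → Ty) : ℕ → List Ty
  | 0 => Γ
  | n + 1 => ty n :: lev Γ ty n

/-- `S` together with `φ`, if this is consistent. -/
def decideSet (S : Set (Fm Γ)) (φ : Fm Γ) : Set (Fm Γ) :=
  {χ | χ ∈ S ∨ (χ = φ ∧ ¬ Entails (insert φ S) Fm.bot)}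

theorem decideSet_consistent {S : Set (Fm Γ)} (φ : Fm Γ) (hS : ¬ Entails S Fm.bot) :
    ¬ Entails (decideSet S φ) Fm.bot := by
  by_cases h : Entails (insert φ S) Fm.bot
  · exact fun h' => hS (h'.mono fun χ hχ => hχ.resolve_right fun h₂ => h₂.2 h)
  · exact fun h' => h (h'.mono fun χ hχ => hχ.elim (Set.mem_insert_of_mem _) fun h₂ =>
      h₂.1 ▸ Set.mem_insert _ _)

/-- One step of the Henkin construction: `φ` is decided, and if it is an existential statement
about objects of type `σ` that is accepted, then the new variable becomes a witness. -/
def henkinStep (σ : Ty) (S : Set (Fm Γ)) (φ : Fm Γ) : Set (Fm (σ :: Γ)) :=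
  Fm.wk '' decideSet S φ ∪ {ψ | Fm.ex σ ψ = φ ∧ φ ∈ decideSet S φ}

theorem henkinStep_consistent (σ : Ty) {S : Set (Fm Γ)} (φ : Fm Γ) (hS : ¬ Entails S Fm.bot) :
    ¬ Entails (henkinStep σ S φ) Fm.bot := by
  intro h
  refine decideSet_consistent φ hS ?_
  by_cases h' : ∃ ψ, Fm.ex σ ψ = φ ∧ φ ∈ decideSet S φ
  · obtain ⟨ψ, rfl, h₂⟩ := h'
    refine .exE (.hyp h₂) (h.mono ?_)
    rintro χ (hχ | ⟨h₃, -⟩)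
    · exact Set.mem_insert_of_mem _ hχ
    · cases h₃
      exact Set.mem_insert _ _
  · refine (h.mono ?_).bot_of_wk
    rintro χ (hχ | hχ)
    · exact hχ
    · exact absurd ⟨χ, hχ⟩ h'

variable (ty : ℕ → Ty)

/-- The sets of accepted formulas in the Henkin construction; `task n` is decided at step `n`. -/
def henkinSet (S : Set (Fm Γ)) (task : ∀ n, Fm (lev Γ ty n)) : ∀ n, Set (Fm (lev Γ ty n))
  | 0 => S
  | n + 1 => henkinStep (ty n) (henkinSet S task n) (task n)

variable {ty} in
/-- The weakenings of a term of level `m` at the higher levels. -/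
def extendTm {m : ℕ} {σ : Ty} (t : Tm (lev Γ ty m) σ) : ∀ n, Tm (lev Γ ty n) σ :=
  extend (C := fun n => Tm (lev Γ ty n) σ) (fun _ => Tm.wk) t

variable {ty} in
theorem extendTm_self {m : ℕ} {σ : Ty} (t : Tm (lev Γ ty m) σ) : extendTm t m = t :=
  extend_self (C := fun n => Tm (lev Γ ty n) σ) (fun _ => Tm.wk) t

variable {ty} in
theorem extendTm_succ {m n : ℕ} {σ : Ty} (t : Tm (lev Γ ty m) σ) (h : m ≤ n) :
    extendTm t (n + 1) = (extendTm t n).wk :=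
  extend_succ (C := fun n => Tm (lev Γ ty n) σ) (fun _ => Tm.wk) t h

/-- A sequence of formulas that are eventually the weakenings of each other. -/
def Coherent (F : ∀ n, Fm (lev Γ ty n)) : Prop := ∀ᶠ n in atTop, F (n + 1) = (F n).wk

/-- Every coherent sequence of formulas is treated infinitely often, with new variables of every
type. -/
def Exhaustive (ty : ℕ → Ty) (task : ∀ n, Fm (lev Γ ty n)) : Prop :=
  ∀ (σ : Ty) (F : ∀ n, Fm (lev Γ ty n)), Coherent ty F →
    ∃ᶠ n in atTop, ty n = σ ∧ task n = F n

theorem exists_exhaustive (Γ : List Ty) :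
    ∃ (ty : ℕ → Ty) (task : ∀ n, Fm (lev Γ ty n)), Exhaustive ty task := by
  have : Nonempty Ty := ⟨Ty.nat⟩
  obtain ⟨g, hg⟩ := exists_surjective_nat Ty
  let ty : ℕ → Ty := fun n => g n.unpair.1
  have : Nonempty (Σ m, Fm (lev Γ ty m)) := ⟨⟨0, Fm.bot⟩⟩
  obtain ⟨f, hf⟩ := exists_surjective_nat (Σ m, Fm (lev Γ ty m))
  let task : ∀ n, Fm (lev Γ ty n) := fun n =>
    extend (C := fun n => Fm (lev Γ ty n)) (fun _ => Fm.wk) (f n.unpair.2.unpair.1).2 n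
  refine ⟨ty, task, fun σ F hF => ?_⟩
  obtain ⟨N, hN⟩ := eventually_atTop.1 hF
  obtain ⟨a, ha⟩ := hg σ
  obtain ⟨b, hb⟩ := hf ⟨N, F N⟩
  have hext (n : ℕ) (hn : N ≤ n) :
      extend (C := fun n => Fm (lev Γ ty n)) (fun _ => Fm.wk) (F N) n = F n := by
    induction n, hn using Nat.le_induction with
    | base => exact extend_self _ _
    | succ n hn ih => rw [extend_succ _ _ hn, ih, hN n hn]
  rw [frequently_atTop]
  intro k
  have hk : max k N ≤ Nat.pair a (Nat.pair b (max k N)) :=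
    (Nat.right_le_pair _ _).trans (Nat.right_le_pair _ _)
  refine ⟨_, (le_max_left _ _).trans hk, ?_, ?_⟩
  · simp only [ty, Nat.unpair_pair, ha]
  · have hf' : f (Nat.pair a (Nat.pair b (max k N))).unpair.2.unpair.1 = ⟨N, F N⟩ := by
      rw [Nat.unpair_pair, Nat.unpair_pair, hb]
    simp only [task]
    rw [hf']
    exact hext _ ((le_max_right _ _).trans hk)

variable {ty}
variable {S : Set (Fm Γ)} {task : ∀ n, Fm (lev Γ ty n)}

theorem henkinSet_consistent (hS : ¬ Entails S Fm.bot) :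
    ∀ n, ¬ Entails (henkinSet ty S task n) Fm.bot
  | 0 => hS
  | n + 1 => henkinStep_consistent _ _ (henkinSet_consistent hS n)

theorem entails_henkinSet_succ {n : ℕ} {φ : Fm (lev Γ ty n)}
    (h : Entails (henkinSet ty S task n) φ) : Entails (henkinSet ty S task (n + 1)) φ.wk :=
  h.wk.mono fun _ hχ => Or.inl (Set.image_mono (fun _ => Or.inl) hχ)

/-- A sequence of formulas is eventually accepted. -/
def Accepts (ty : ℕ → Ty) (S : Set (Fm Γ)) (task : ∀ n, Fm (lev Γ ty n))
    (F : ∀ n, Fm (lev Γ ty n)) : Prop :=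
  ∀ᶠ n in atTop, Entails (henkinSet ty S task n) (F n)

variable {F G : ∀ n, Fm (lev Γ ty n)}

theorem accepts_of_entails {m : ℕ} (hF : ∀ n, m ≤ n → F (n + 1) = (F n).wk)
    (h : Entails (henkinSet ty S task m) (F m)) : Accepts ty S task F := by
  refine eventually_atTop.2 ⟨m, fun n hn => ?_⟩
  induction n, hn using Nat.le_induction with
  | base => exact h
  | succ n hn ih => exact hF n hn ▸ entails_henkinSet_succ ih

theorem accepts_of_frequently (hF : Coherent ty F)
    (h : ∃ᶠ n in atTop, Entails (henkinSet ty S task n) (F n)) : Accepts ty S task F := by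
  obtain ⟨N, hN⟩ := eventually_atTop.1 hF
  obtain ⟨m, hm, h⟩ := frequently_atTop.1 h N
  exact accepts_of_entails (fun n hn => hN n (hm.trans hn)) h

theorem Coherent.neg (hF : Coherent ty F) : Coherent ty fun n => (F n).neg :=
  hF.mono fun _ h => congrArg Fm.neg h

theorem Accepts.map (hF : Accepts ty S task F)
    (h : ∀ n, Entails (henkinSet ty S task n) (F n) → Entails (henkinSet ty S task n) (G n)) :
    Accepts ty S task G :=
  hF.mono h

theorem accepts_neg (ht : Exhaustive ty task) (hF : Coherent ty F)
    (h : ¬ Accepts ty S task F) : Accepts ty S task fun n => (F n).neg := by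
  have hnot : ∀ᶠ n in atTop, ¬ Entails (henkinSet ty S task n) (F n) :=
    not_frequently.1 fun h' => h (accepts_of_frequently hF h')
  refine accepts_of_frequently hF.neg (((ht Ty.nat F hF).and_eventually
    (hF.and ((tendsto_add_atTop_nat 1).eventually hnot))).mono ?_)
  rintro n ⟨⟨-, htask⟩, hwk, hn⟩
  by_contra hneg
  refine hn (hwk ▸ .hyp (Or.inl (Set.mem_image_of_mem _ (Or.inr ⟨htask.symm, fun hbot => ?_⟩))))
  exact hneg (.impI (htask ▸ hbot))

theorem not_accepts_neg (hS : ¬ Entails S Fm.bot) (h : Accepts ty S task F) :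
    ¬ Accepts ty S task fun n => (F n).neg := by
  intro h'
  obtain ⟨n, h₁, h₂⟩ := (h.and h').exists
  exact henkinSet_consistent hS n (.impE h₂ h₁)

theorem accepts_and_iff : (Accepts ty S task fun n => Fm.and (F n) (G n)) ↔
    Accepts ty S task F ∧ Accepts ty S task G :=
  ⟨fun h => ⟨h.map fun _ => .andL, h.map fun _ => .andR⟩,
    fun h => by filter_upwards [h.1, h.2] with n h₁ h₂ using .andI h₁ h₂⟩

theorem accepts_or_iff (hS : ¬ Entails S Fm.bot) (ht : Exhaustive ty task) (hF : Coherent ty F)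
    (hG : Coherent ty G) : (Accepts ty S task fun n => Fm.or (F n) (G n)) ↔
      Accepts ty S task F ∨ Accepts ty S task G := by
  refine ⟨fun h => ?_, fun h => h.elim (.map · fun _ => .orL) (.map · fun _ => .orR)⟩
  by_contra! hnot
  obtain ⟨n, h, h₁, h₂⟩ :=
    (h.and ((accepts_neg ht hF hnot.1).and (accepts_neg ht hG hnot.2))).exists
  exact henkinSet_consistent hS n (.orE h (.impE h₁.weaken (.insert_self _ _))
    (.impE h₂.weaken (.insert_self _ _)))

theorem accepts_imp_iff (ht : Exhaustive ty task) (hF : Coherent ty F) :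
    (Accepts ty S task fun n => Fm.imp (F n) (G n)) ↔
      (Accepts ty S task F → Accepts ty S task G) := by
  refine ⟨fun h h' => by filter_upwards [h, h'] with n h₁ h₂ using .impE h₁ h₂, fun h => ?_⟩
  by_cases h' : Accepts ty S task F
  · exact (h h').map fun _ hG => .impI hG.weaken
  · exact (accepts_neg ht hF h').map fun _ hneg =>
      .impI (.botE (.impE hneg.weaken (.insert_self _ _)))

/-- The term model of the Henkin construction: its elements are the sequences of terms that are
eventually the weakenings of each other. -/
def termModel (ty : ℕ → Ty) (S : Set (Fm Γ)) (task : ∀ n, Fm (lev Γ ty n)) : Model where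
  D σ := {d : ∀ n, Tm (lev Γ ty n) σ // ∀ᶠ n in atTop, d (n + 1) = (d n).wk}
  app f a := ⟨fun n => Tm.app (f.1 n) (a.1 n), by
    filter_upwards [f.2, a.2] with n h₁ h₂
    rw [h₁, h₂]
    rfl⟩
  con c := ⟨fun _ => Tm.con c, Eventually.of_forall fun _ => rfl⟩
  eq a b := Accepts ty S task fun n => Fm.eq (a.1 n) (b.1 n)

section Quantifiers

variable {σ : Ty} {F : ∀ n, Fm (σ :: lev Γ ty n)}

theorem exists_accepts_inst (hS : ¬ Entails S Fm.bot) (ht : Exhaustive ty task)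
    (hF : ∀ᶠ n in atTop, F (n + 1) = (F n).wkBelow)
    (h : Accepts ty S task fun n => Fm.ex σ (F n)) :
    ∃ d : (termModel ty S task).D σ, Accepts ty S task fun n => (F n).inst (d.1 n) := by
  obtain ⟨N, hN⟩ := eventually_atTop.1 (hF.and h)
  have hex : Coherent ty fun n => Fm.ex σ (F n) := hF.mono fun _ hn => congrArg (Fm.ex σ) hn
  obtain ⟨n, hn, rfl, htask⟩ := frequently_atTop.1 (ht σ _ hex) N
  let d : ∀ k, Tm (lev Γ ty k) (ty n) := extendTm (ty := ty) (m := n + 1) v0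
  have hd : ∀ k, n + 1 ≤ k → d (k + 1) = (d k).wk := fun k => extendTm_succ _
  have hstep : ∀ k, n + 1 ≤ k → (F (k + 1)).inst (d (k + 1)) = ((F k).inst (d k)).wk := by
    intro k hk
    rw [hd k hk, (hN k (by omega)).1, Fm.wk_eq_subst, Fm.subst_inst, Tm.wk_eq_subst]
    rfl
  refine ⟨⟨d, eventually_atTop.2 ⟨n + 1, hd⟩⟩, accepts_of_entails hstep (.hyp (Or.inr ?_))⟩
  have hmem : task n ∈ decideSet (henkinSet ty S task n) (task n) := by
    refine Or.inr ⟨rfl, fun hbot => henkinSet_consistent hS n (.cut ?_ hbot)⟩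
    exact htask ▸ (hN n hn).2
  refine ⟨?_, hmem⟩
  change Fm.ex (ty n) ((F (n + 1)).inst (d (n + 1))) = task n
  rw [htask, (hN n hn).1, show d (n + 1) = v0 from extendTm_self _, Fm.inst_v0_wkBelow]

theorem accepts_ex_iff (hS : ¬ Entails S Fm.bot) (ht : Exhaustive ty task)
    (hF : ∀ᶠ n in atTop, F (n + 1) = (F n).wkBelow) :
    (Accepts ty S task fun n => Fm.ex σ (F n)) ↔
      ∃ d : (termModel ty S task).D σ, Accepts ty S task fun n => (F n).inst (d.1 n) :=
  ⟨exists_accepts_inst hS ht hF, fun ⟨d, h⟩ => h.map fun n => .exI (d.1 n)⟩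

theorem accepts_all_iff (hS : ¬ Entails S Fm.bot) (ht : Exhaustive ty task)
    (hF : ∀ᶠ n in atTop, F (n + 1) = (F n).wkBelow) :
    (Accepts ty S task fun n => Fm.all σ (F n)) ↔
      ∀ d : (termModel ty S task).D σ, Accepts ty S task fun n => (F n).inst (d.1 n) := by
  refine ⟨fun h d => h.map fun n => .allE (d.1 n), fun h => ?_⟩
  by_contra hnot
  have hall : Coherent ty fun n => Fm.all σ (F n) := hF.mono fun _ hn => congrArg (Fm.all σ) hn
  have hex : Accepts ty S task fun n => Fm.ex σ (F n).neg :=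
    (accepts_neg ht hall hnot).map fun _ => .ex_neg_of_neg_all
  obtain ⟨d, hd⟩ := exists_accepts_inst hS ht (hF.mono fun _ => congrArg Fm.neg) hex
  exact not_accepts_neg hS (h d) hd

end Quantifiers

variable {Δ : List Ty}

/-- The substitutions that make up an assignment in the term model. -/
def Env.level (ρ : Env (termModel ty S task) Δ) (n : ℕ) : Sub Δ (lev Γ ty n) :=
  fun σ v => (ρ σ v).1 n

theorem Env.level_succ (ρ : Env (termModel ty S task) Δ) :
    ∀ᶠ n in atTop, ρ.level (n + 1) = (ρ.level n).comp Sub.shift := by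
  suffices ∀ᶠ n in atTop, ∀ σ v, ρ.level (n + 1) σ v = (ρ.level n σ v).wk from
    this.mono fun n hn => funext fun σ => funext fun v => (hn σ v).trans (Tm.wk_eq_subst _)
  induction Δ with
  | nil => exact Eventually.of_forall fun _ _ v => nomatch v
  | cons τ Δ ih =>
      filter_upwards [ih fun σ v => ρ σ (Var.s v), (ρ τ Var.z).2] with n h₁ h₂ σ v
      cases v with
      | z => exact h₂
      | s v => exact h₁ σ v

theorem Env.level_cons (ρ : Env (termModel ty S task) Δ) {σ : Ty}
    (d : (termModel ty S task).D σ) (n : ℕ) :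
    (Env.cons d ρ).level n = Sub.cons (d.1 n) (ρ.level n) := by
  funext τ v
  cases v <;> rfl

theorem coherent_subst_level (ρ : Env (termModel ty S task) Δ) (φ : Fm Δ) :
    Coherent ty fun n => φ.subst (ρ.level n) :=
  ρ.level_succ.mono fun n hn => by
    beta_reduce
    rw [hn, Fm.wk_eq_subst, Fm.subst_subst]

theorem subst_lift_level_succ (ρ : Env (termModel ty S task) Δ) {σ : Ty} (φ : Fm (σ :: Δ)) :
    ∀ᶠ n in atTop, φ.subst ((ρ.level (n + 1)).lift σ) =
      (φ.subst ((ρ.level n).lift σ)).wkBelow :=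
  ρ.level_succ.mono fun n hn => by
    rw [hn, ← Sub.lift_comp_lift, ← Fm.subst_subst]
    rfl

theorem eval_termModel (ρ : Env (termModel ty S task) Δ) {σ : Ty} (t : Tm Δ σ) (n : ℕ) :
    (t.eval ρ).1 n = t.subst (ρ.level n) := by
  induction t with
  | var v => rfl
  | con c => rfl
  | app t u iht ihu => exact congrArg₂ Tm.app iht ihu

theorem sat_termModel (hS : ¬ Entails S Fm.bot) (ht : Exhaustive ty task) (φ : Fm Δ)
    (ρ : Env (termModel ty S task) Δ) :
    Sat ρ φ ↔ Accepts ty S task fun n => φ.subst (ρ.level n) := by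
  induction φ with
  | eq t u =>
      simp only [Sat, termModel, Fm.subst, ← eval_termModel]
  | and φ ψ h₁ h₂ =>
      rw [Sat, h₁, h₂, ← accepts_and_iff]
      rfl
  | or φ ψ h₁ h₂ =>
      rw [Sat, h₁, h₂,
        ← accepts_or_iff hS ht (coherent_subst_level ρ φ) (coherent_subst_level ρ ψ)]
      rfl
  | imp φ ψ h₁ h₂ =>
      rw [Sat, h₁, h₂, ← accepts_imp_iff ht (coherent_subst_level ρ φ)]
      rfl
  | all σ φ ih =>
      simp only [Sat, ih, Env.level_cons, ← Fm.inst_subst_lift]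
      exact (accepts_all_iff hS ht (subst_lift_level_succ ρ φ)).symm
  | ex σ φ ih =>
      simp only [Sat, ih, Env.level_cons, ← Fm.inst_subst_lift]
      exact (accepts_ex_iff hS ht (subst_lift_level_succ ρ φ)).symm

theorem exists_model {S : Set (Fm Γ)} (hS : ¬ Entails S Fm.bot) :
    ∃ (M : Model) (ρ : Env M Γ), (∀ φ ∈ S, Sat ρ φ) ∧ ¬ Sat ρ Fm.bot := by
  obtain ⟨ty, task, ht⟩ := exists_exhaustive Γ
  let ρ : Env (termModel ty S task) Γ := fun σ v => ⟨extendTm (m := 0) (Tm.var v),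
    eventually_atTop.2 ⟨0, fun n => extendTm_succ _⟩⟩
  have level_zero : ρ.level 0 = Sub.id := funext fun σ => funext fun v =>
    extendTm_self (ty := ty) (m := 0) (Tm.var v)
  have level_succ (n : ℕ) : ρ.level (n + 1) = (ρ.level n).comp Sub.shift :=
    funext fun σ => funext fun v =>
      (extendTm_succ _ n.zero_le).trans (Tm.wk_eq_subst _)
  refine ⟨termModel ty S task, ρ, fun φ hφ => ?_, fun h => ?_⟩
  · refine (sat_termModel hS ht φ ρ).2 (accepts_of_entails (m := 0) (fun n _ => ?_) (.hyp ?_))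
    · rw [level_succ, Fm.wk_eq_subst, Fm.subst_subst]
    · rwa [level_zero, Fm.subst_id]
  · obtain ⟨n, hn⟩ := ((sat_termModel hS ht _ ρ).1 h).exists
    exact henkinSet_consistent hS n hn

end Henkin

theorem proves_of_forall_model {T : Theory} {Γ : List Ty} {φ : Fm Γ}
    (h : ∀ (M : Model) (ρ : Env M Γ), (∀ χ : Fm Γ, Proves T χ → Sat ρ χ) → ¬ Sat ρ Fm.bot →
      Sat ρ φ) :
    Proves T φ := by
  refine .raa ?_
  by_cases hS : Entails (insert φ.neg {χ : Fm Γ | Proves T χ}) Fm.bot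
  · obtain ⟨L, hL, d⟩ := hS.derivesFrom (T := T)
    refine d.cut fun χ hχ => ?_
    rcases hL χ hχ with rfl | h'
    · exact .hyp List.mem_cons_self
    · exact Derives.mono h' (List.nil_subset _)
  · obtain ⟨M, ρ, hM, hbot⟩ := exists_model hS
    have hφ : Sat ρ φ := h M ρ (fun χ hχ => hM χ (Set.mem_insert_of_mem _ hχ)) hbot
    exact absurd (hM φ.neg (Set.mem_insert _ _) hφ) hbot

/-- A theory that contains the axioms for probability contents. -/
def ExtendsFP (T : Theory) : Prop := ∀ (Γ : List Ty) (φ : Fm Γ), FP Γ φ → T Γ φ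

/-- A model of the theorems in the context `Γ` of a theory that extends the basic system, with a
fixed assignment for `Γ`. -/
structure TModel (Γ : List Ty) where
  T : Theory
  extendsFP : ExtendsFP T
  M : Model
  base : Env M Γ
  valid : ∀ χ : Fm Γ, Proves T χ → Sat base χ
  zero_ne_one : ¬ Sat base Fm.bot

/-- The assignments that extend the fixed assignment of a model. -/
class inductive Good {Γ : List Ty} (𝔐 : TModel Γ) : {Δ : List Ty} → Env 𝔐.M Δ → Prop
  | base : Good 𝔐 𝔐.base
  | cons {Δ : List Ty} {ρ : Env 𝔐.M Δ} {σ : Ty} (a : 𝔐.M.D σ) : Good 𝔐 ρ → Good 𝔐 (Env.cons a ρ)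

instance {Γ : List Ty} (𝔐 : TModel Γ) : Good 𝔐 𝔐.base := .base

instance {Γ Δ : List Ty} (𝔐 : TModel Γ) {ρ : Env 𝔐.M Δ} {σ : Ty} (a : 𝔐.M.D σ) [h : Good 𝔐 ρ] :
    Good 𝔐 (Env.cons a ρ) := .cons a h

/-- The interpretation of equality in all types. -/
def EqM {M : Model} : {σ : Ty} → M.D σ → M.D σ → Prop
  | Ty.nat, a, b => M.eq a b
  | Ty.Om, a, b => M.eq (M.app (M.app (M.con Con.eqOm) a) b) (M.con Con.zero)
  | Ty.Ev, a, b => ∀ x : M.D Ty.Om, M.eq (M.app (M.app (M.con Con.mem) x) a) (M.con Con.zero) ↔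
      M.eq (M.app (M.app (M.con Con.mem) x) b) (M.con Con.zero)
  | Ty.fn ρ _, a, b => ∀ d : M.D ρ, EqM (M.app a d) (M.app b d)

theorem sat_eqF {M : Model} {σ : Ty} : ∀ {Δ : List Ty} (ρ : Env M Δ) (s t : Tm Δ σ),
    Sat ρ (eqF σ s t) ↔ EqM (s.eval ρ) (t.eval ρ) := by
  induction σ with
  | nat => exact fun ρ s t => Iff.rfl
  | Om => exact fun ρ s t => Iff.rfl
  | Ev =>
      intro Δ ρ s t
      simp only [eqF, Sat, Fm.iff, memF, memT, Tm.eval, Tm.eval_wk, EqM]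
      exact forall_congr' fun x => iff_iff_implies_and_implies.symm
  | fn σ τ _ ih =>
      intro Δ ρ s t
      simp only [eqF, Sat, ih, Tm.eval, Tm.eval_wk, EqM]
      rfl

namespace TModel

variable {Γ : List Ty} (𝔐 : TModel Γ)

theorem sat_of_proves {Δ : List Ty} (ρ : Env 𝔐.M Δ) [h : Good 𝔐 ρ] :
    ∀ {φ : Fm Δ}, Proves 𝔐.T φ → Sat ρ φ := by
  induction h with
  | base => exact fun h => 𝔐.valid _ h
  | cons a _ ih => exact fun h => ih (.allI h) a

theorem sat_arith {Δ : List Ty} (ρ : Env 𝔐.M Δ) [Good 𝔐 ρ] {φ : Fm Δ} (h : Arith Δ φ) :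
    Sat ρ φ :=
  𝔐.sat_of_proves ρ (.ax (𝔐.extendsFP _ _ (Or.inl (Or.inl h))))

theorem sat_content {Δ : List Ty} (ρ : Env 𝔐.M Δ) [Good 𝔐 ρ] {φ : Fm Δ} (h : Content Δ φ) :
    Sat ρ φ :=
  𝔐.sat_of_proves ρ (.ax (𝔐.extendsFP _ _ (Or.inr h)))

theorem eq_refl (a : 𝔐.M.D Ty.nat) : 𝔐.M.eq a a :=
  𝔐.sat_arith (Env.cons a 𝔐.base) (.eqRefl v0)

theorem eq_symm {a b : 𝔐.M.D Ty.nat} : 𝔐.M.eq a b → 𝔐.M.eq b a :=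
  𝔐.sat_arith (Env.cons b (Env.cons a 𝔐.base)) (.eqSymm v1 v0)

theorem eq_trans {a b c : 𝔐.M.D Ty.nat} (h₁ : 𝔐.M.eq a b) (h₂ : 𝔐.M.eq b c) : 𝔐.M.eq a c :=
  𝔐.sat_arith (Env.cons c (Env.cons b (Env.cons a 𝔐.base))) (.eqTrans v2 v1 v0) ⟨h₁, h₂⟩

theorem eqM_trans : ∀ {σ : Ty} {a b c : 𝔐.M.D σ}, EqM a b → EqM b c → EqM a c
  | Ty.nat, _, _, _, h, h' => 𝔐.eq_trans h h'
  | Ty.Om, a, b, c, h, h' =>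
      𝔐.sat_content (Env.cons c (Env.cons b (Env.cons a 𝔐.base))) (.omTrans v2 v1 v0) ⟨h, h'⟩
  | Ty.Ev, _, _, _, h, h' => fun x => (h x).trans (h' x)
  | Ty.fn _ _, _, _, _, h, h' => fun d => eqM_trans (h d) (h' d)

theorem comb_eq {δ ρ τ : Ty} (s : 𝔐.M.D (Ty.fn δ (Ty.fn ρ τ))) (t : 𝔐.M.D (Ty.fn δ ρ))
    (u : 𝔐.M.D δ) :
    EqM (𝔐.M.app (𝔐.M.app (𝔐.M.app (𝔐.M.con (Con.comb δ ρ τ)) s) t) u)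
      (𝔐.M.app (𝔐.M.app s u) (𝔐.M.app t u)) :=
  (sat_eqF _ _ _).1
    (𝔐.sat_arith (Env.cons u (Env.cons t (Env.cons s 𝔐.base))) (.comb v2 v1 v0))

theorem proj_eq {ρ τ : Ty} (s : 𝔐.M.D ρ) (t : 𝔐.M.D τ) :
    EqM (𝔐.M.app (𝔐.M.app (𝔐.M.con (Con.proj ρ τ)) s) t) s :=
  (sat_eqF _ _ _).1 (𝔐.sat_arith (Env.cons t (Env.cons s 𝔐.base)) (.proj v1 v0))

theorem congr_of_proves {Δ : List Ty} (ρ : Env 𝔐.M Δ) [Good 𝔐 ρ] {σ τ : Ty} {s t : Tm Δ σ}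
    (h : Proves 𝔐.T (eqF σ s t)) (r : Tm (σ :: Δ) τ) :
    EqM (r.eval (Env.cons (s.eval ρ) ρ)) (r.eval (Env.cons (t.eval ρ) ρ)) := by
  have h₁ : Derives 𝔐.T [] (Fm.imp (Fm.eq zro zro) (eqF σ s t)) :=
    .impI (h.mono (List.nil_subset _))
  have h₂ := 𝔐.sat_of_proves ρ (.qfer (φ := Fm.eq zro zro) r trivial h₁) (𝔐.eq_refl _)
  rw [sat_eqF, Tm.eval_subst, Tm.eval_subst, Sub.eval_cons, Sub.eval_cons] at h₂
  exact h₂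

theorem congr_nat {Δ : List Ty} (ρ : Env 𝔐.M Δ) [Good 𝔐 ρ] {τ : Ty} (r : Tm (Ty.nat :: Δ) τ)
    {a b : 𝔐.M.D Ty.nat} (h : 𝔐.M.eq a b) :
    EqM (r.eval (Env.cons a ρ)) (r.eval (Env.cons b ρ)) := by
  have h₁ : Derives 𝔐.T [] (Fm.imp (Fm.eq (Γ := Ty.nat :: Ty.nat :: Δ) v1 v0) (eqF Ty.nat v1 v0)) :=
    .impI (.hyp List.mem_cons_self)
  have h₂ := 𝔐.sat_of_proves (Env.cons b (Env.cons a ρ))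
    (.qfer (φ := Fm.eq v1 v0)
      (r.subst (Sub.cons v0 fun _ v => Tm.var (Var.s (Var.s (Var.s v))))) trivial h₁) h
  simp only [sat_eqF, Tm.eval_subst, Sub.eval_cons] at h₂
  exact h₂

end TModel

theorem proves_of_forall_tmodel {T : Theory} (hT : ExtendsFP T) {Γ : List Ty} {φ : Fm Γ}
    (h : ∀ 𝔐 : TModel Γ, 𝔐.T = T → Sat 𝔐.base φ) : Proves T φ :=
  proves_of_forall_model fun M ρ hM hb => h ⟨T, hT, M, ρ, hM, hb⟩ rfl

theorem proves_beta {T : Theory} (hT : ExtendsFP T) {Δ : List Ty} {σ τ : Ty} (t : Tm (σ :: Δ) τ) :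
    Proves T (eqF τ (Tm.app t.lam.wk v0) t) := by
  suffices h : ∀ (Ξ : List Ty) (t : Tm Ξ τ) (e : Ξ = σ :: Δ),
      Proves T (eqF τ (Tm.app (e ▸ t).lam.wk v0) (e ▸ t)) from h _ t rfl
  clear t
  intro Ξ t
  induction t with
  | var v =>
      rintro rfl
      refine proves_of_forall_tmodel hT fun 𝔐 h𝔐 => ?_
      subst h𝔐
      rw [sat_eqF]
      cases v with
      | z => exact 𝔐.eqM_trans (𝔐.comb_eq _ _ _) (𝔐.proj_eq _ _)
      | s v => exact 𝔐.proj_eq (τ := σ) (𝔐.base _ (Var.s v)) _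
  | con c =>
      rintro rfl
      refine proves_of_forall_tmodel hT fun 𝔐 h𝔐 => ?_
      subst h𝔐
      rw [sat_eqF]
      exact 𝔐.proj_eq _ _
  | app t u iht ihu =>
      rintro rfl
      refine proves_of_forall_tmodel hT fun 𝔐 h𝔐 => ?_
      subst h𝔐
      rw [sat_eqF]
      have h₁ := (sat_eqF _ _ _).1 (𝔐.valid _ (iht rfl))
      have h₂ := 𝔐.congr_of_proves 𝔐.base (ihu rfl) (Tm.app t.wk v0)
      simp only [Tm.eval, Tm.eval_wk] at h₂
      exact 𝔐.eqM_trans (𝔐.comb_eq _ _ _) (𝔐.eqM_trans (h₁ _) h₂)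

theorem TModel.eval_lam {Γ : List Ty} (𝔐 : TModel Γ) {Δ : List Ty} (ρ : Env 𝔐.M Δ) [Good 𝔐 ρ]
    {σ τ : Ty} (t : Tm (σ :: Δ) τ) (a : 𝔐.M.D σ) :
    EqM (𝔐.M.app (t.lam.eval ρ) a) (t.eval (Env.cons a ρ)) := by
  have h := (sat_eqF _ _ _).1
    (𝔐.sat_of_proves (Env.cons a ρ) (proves_beta 𝔐.extendsFP t))
  rw [Tm.eval, Tm.eval_wk] at h
  exact h

/-! ### Arithmetic in a model -/

infixr:67 " ▹ " => Env.cons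

namespace TModel

variable {Γ : List Ty} (𝔐 : TModel Γ)

/-- Equality of numbers in the sense of the model. -/
instance numSetoid : Setoid (𝔐.M.D Ty.nat) where
  r := 𝔐.M.eq
  iseqv := ⟨𝔐.eq_refl, 𝔐.eq_symm, 𝔐.eq_trans⟩

/-- The numbers of a model, up to equality in the sense of the model. -/
def Num : Type := Quotient 𝔐.numSetoid

/-- The number that an object of type `0` stands for. -/
def num (a : 𝔐.M.D Ty.nat) : 𝔐.Num := Quotient.mk _ a

variable {𝔐}

theorem num_eq {a b : 𝔐.M.D Ty.nat} : 𝔐.num a = 𝔐.num b ↔ 𝔐.M.eq a b := Quotient.eq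

theorem exists_num (n : 𝔐.Num) : ∃ a, 𝔐.num a = n := Quotient.exists_rep n

theorem num_out (n : 𝔐.Num) : 𝔐.num (Quotient.out n) = n := Quotient.out_eq n

variable {Δ Δ' : List Ty}

/-- The number denoted by a term. -/
def value (ρ : Env 𝔐.M Δ) (t : Tm Δ Ty.nat) : 𝔐.Num := 𝔐.num (t.eval ρ)

theorem value_wk (ρ : Env 𝔐.M Δ) {σ : Ty} (a : 𝔐.M.D σ) (t : Tm Δ Ty.nat) :
    value (a ▹ ρ) t.wk = value ρ t := by
  rw [value, Tm.eval_wk, value]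

theorem value_v0 (ρ : Env 𝔐.M Δ) (a : 𝔐.M.D Ty.nat) : value (a ▹ ρ) v0 = 𝔐.num a := rfl

theorem value_v1 (ρ : Env 𝔐.M Δ) (a : 𝔐.M.D Ty.nat) {σ : Ty} (b : 𝔐.M.D σ) :
    value (b ▹ a ▹ ρ) v1 = 𝔐.num a := rfl

theorem value_v2 (ρ : Env 𝔐.M Δ) (a : 𝔐.M.D Ty.nat) {σ τ : Ty} (b : 𝔐.M.D σ) (c : 𝔐.M.D τ) :
    value (c ▹ b ▹ a ▹ ρ) v2 = 𝔐.num a := rfl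

theorem sat_eq (ρ : Env 𝔐.M Δ) (s t : Tm Δ Ty.nat) : Sat ρ (Fm.eq s t) ↔ value ρ s = value ρ t :=
  num_eq.symm

theorem num_app_congr (f : 𝔐.M.D one) {a b : 𝔐.M.D Ty.nat} (h : 𝔐.num a = 𝔐.num b) :
    𝔐.num (𝔐.M.app f a) = 𝔐.num (𝔐.M.app f b) :=
  num_eq.2 (𝔐.congr_nat (f ▹ 𝔐.base) (Tm.app v1 v0) (num_eq.1 h))

instance : Zero 𝔐.Num := ⟨𝔐.num (𝔐.M.con Con.zero)⟩

/-- The successor of the model. -/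
noncomputable def succ (n : 𝔐.Num) : 𝔐.Num := 𝔐.num (𝔐.M.app (𝔐.M.con Con.succ) n.out)

theorem value_zro (ρ : Env 𝔐.M Δ) : value ρ zro = 0 := rfl

theorem num_succ (a : 𝔐.M.D Ty.nat) : 𝔐.num (𝔐.M.app (𝔐.M.con Con.succ) a) = succ (𝔐.num a) :=
  num_app_congr _ (num_out _).symm

theorem value_suc (ρ : Env 𝔐.M Δ) (t : Tm Δ Ty.nat) : value ρ (suc t) = succ (value ρ t) :=
  num_succ _

theorem succ_ne_zero (n : 𝔐.Num) : succ n ≠ 0 := by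
  obtain ⟨a, rfl⟩ := exists_num n
  rw [← num_succ]
  intro h
  exact 𝔐.zero_ne_one (𝔐.sat_arith (a ▹ 𝔐.base) (.succNe v0) (num_eq.1 h))

theorem succ_injective {m n : 𝔐.Num} (h : succ m = succ n) : m = n := by
  obtain ⟨a, rfl⟩ := exists_num m
  obtain ⟨b, rfl⟩ := exists_num n
  rw [← num_succ, ← num_succ] at h
  exact num_eq.2 (𝔐.sat_arith (b ▹ a ▹ 𝔐.base) (.succInj v1 v0) (num_eq.1 h))

theorem sat_induct (ρ : Env 𝔐.M Δ) [Good 𝔐 ρ] (φ : Fm (Ty.nat :: Δ))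
    (h0 : Sat (𝔐.M.con Con.zero ▹ ρ) φ)
    (hs : ∀ x, Sat (x ▹ ρ) φ → Sat (𝔐.M.app (𝔐.M.con Con.succ) x ▹ ρ) φ) (x : 𝔐.M.D Ty.nat) :
    Sat (x ▹ ρ) φ := by
  refine 𝔐.sat_arith ρ (.ind φ) ⟨?_, fun x hx => ?_⟩ x
  · rw [sat_inst]
    exact h0
  · rw [sat_subst, Sub.eval_cons]
    exact hs x hx

theorem num_induct (ρ : Env 𝔐.M Δ) [Good 𝔐 ρ] (φ : Fm (Ty.nat :: Δ)) {P : 𝔐.Num → Prop}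
    (hP : ∀ x, Sat (x ▹ ρ) φ ↔ P (𝔐.num x)) (h0 : P 0) (hs : ∀ n, P n → P (succ n)) (n : 𝔐.Num) :
    P n := by
  obtain ⟨a, rfl⟩ := exists_num n
  refine (hP a).1 (sat_induct ρ φ ((hP _).2 h0) (fun x hx => (hP _).2 ?_) a)
  rw [num_succ]
  exact hs _ ((hP x).1 hx)

theorem num_lam (ρ : Env 𝔐.M Δ) [Good 𝔐 ρ] (t : Tm (Ty.nat :: Δ) Ty.nat) (a : 𝔐.M.D Ty.nat) :
    𝔐.num (𝔐.M.app (t.lam.eval ρ) a) = value (a ▹ ρ) t :=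
  num_eq.2 (𝔐.eval_lam ρ t a)

theorem num_lam_lam (ρ : Env 𝔐.M Δ) [Good 𝔐 ρ] (t : Tm (Ty.nat :: Ty.nat :: Δ) Ty.nat)
    (a b : 𝔐.M.D Ty.nat) :
    𝔐.num (𝔐.M.app (𝔐.M.app (t.lam.lam.eval ρ) a) b) = value (b ▹ a ▹ ρ) t :=
  num_eq.2 (𝔐.eqM_trans (𝔐.eval_lam ρ t.lam a b) (𝔐.eval_lam (a ▹ ρ) t b))

theorem num_lam_lam_lam (ρ : Env 𝔐.M Δ) [Good 𝔐 ρ]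
    (t : Tm (Ty.nat :: Ty.nat :: Ty.nat :: Δ) Ty.nat) (a b c : 𝔐.M.D Ty.nat) :
    𝔐.num (𝔐.M.app (𝔐.M.app (𝔐.M.app (t.lam.lam.lam.eval ρ) a) b) c) =
      value (c ▹ b ▹ a ▹ ρ) t :=
  num_eq.2 (𝔐.eqM_trans (𝔐.eval_lam ρ t.lam.lam a b c)
    (𝔐.eqM_trans (𝔐.eval_lam (a ▹ ρ) t.lam b c) (𝔐.eval_lam (b ▹ a ▹ ρ) t c)))

theorem num_rec_zero (a : 𝔐.M.D Ty.nat) (f : 𝔐.M.D (Ty.fn Ty.nat one)) :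
    𝔐.num (𝔐.M.app (𝔐.M.app (𝔐.M.app (𝔐.M.con (Con.recursor [Ty.nat] Var.z))
      (𝔐.M.con Con.zero)) a) f) = 𝔐.num a :=
  num_eq.2 ((sat_eqF _ _ _).1 (𝔐.sat_arith (f ▹ a ▹ 𝔐.base) (.recZero [Ty.nat] Var.z
    (Sub.cons v1 fun _ v => nomatch v) (Sub.cons v0 fun _ v => nomatch v))))

theorem num_rec_succ (a : 𝔐.M.D Ty.nat) (f : 𝔐.M.D (Ty.fn Ty.nat one)) (x : 𝔐.M.D Ty.nat) :
    𝔐.num (𝔐.M.app (𝔐.M.app (𝔐.M.app (𝔐.M.con (Con.recursor [Ty.nat] Var.z))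
      (𝔐.M.app (𝔐.M.con Con.succ) x)) a) f) =
    𝔐.num (𝔐.M.app (𝔐.M.app f (𝔐.M.app (𝔐.M.app (𝔐.M.app
      (𝔐.M.con (Con.recursor [Ty.nat] Var.z)) x) a) f)) x) :=
  num_eq.2 ((sat_eqF _ _ _).1 (𝔐.sat_arith (x ▹ f ▹ a ▹ 𝔐.base) (.recSucc [Ty.nat] Var.z v0
    (Sub.cons v2 fun _ v => nomatch v) (Sub.cons v1 fun _ v => nomatch v))))

theorem natRec_zro (ρ : Env 𝔐.M Δ) (a : Tm Δ Ty.nat)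
    (b : Tm (Ty.nat :: Ty.nat :: Δ) Ty.nat) : value ρ (natRec a b zro) = value ρ a :=
  num_rec_zero _ _

theorem natRec_suc (ρ : Env 𝔐.M Δ) [Good 𝔐 ρ] (a : Tm Δ Ty.nat)
    (b : Tm (Ty.nat :: Ty.nat :: Δ) Ty.nat) (n : Tm Δ Ty.nat) :
    value ρ (natRec a b (suc n)) = value (n.eval ρ ▹ (natRec a b n).eval ρ ▹ ρ) b :=
  (num_rec_succ _ _ _).trans (num_lam_lam _ _ _ _)

theorem natRec_congr {ρ : Env 𝔐.M Δ} [Good 𝔐 ρ] {ρ' : Env 𝔐.M Δ'} [Good 𝔐 ρ']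
    {a : Tm Δ Ty.nat} {a' : Tm Δ' Ty.nat} {b : Tm (Ty.nat :: Ty.nat :: Δ) Ty.nat}
    {b' : Tm (Ty.nat :: Ty.nat :: Δ') Ty.nat} {n : Tm Δ Ty.nat} {n' : Tm Δ' Ty.nat}
    (ha : value ρ a = value ρ' a')
    (hb : ∀ x x' y y', 𝔐.num x = 𝔐.num x' → 𝔐.num y = 𝔐.num y' →
      value (y ▹ x ▹ ρ) b = value (y' ▹ x' ▹ ρ') b') (hn : value ρ n = value ρ' n') :
    value ρ (natRec a b n) = value ρ' (natRec a' b' n') := by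
  let E := a.eval ρ ▹ b.lam.lam.eval ρ ▹ a'.eval ρ' ▹ b'.lam.lam.eval ρ' ▹ 𝔐.base
  let G : Tm (Ty.nat :: Ty.nat :: Ty.fn Ty.nat one :: Ty.nat :: Ty.fn Ty.nat one :: Γ) Ty.nat :=
    Tm.app (Tm.app (Tm.app (Tm.con (Con.recursor [Ty.nat] Var.z)) v0) v1) v2
  let G' : Tm (Ty.nat :: Ty.nat :: Ty.fn Ty.nat one :: Ty.nat :: Ty.fn Ty.nat one :: Γ) Ty.nat :=
    Tm.app (Tm.app (Tm.app (Tm.con (Con.recursor [Ty.nat] Var.z)) v0)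
      (Tm.var (Var.s (Var.s (Var.s Var.z))))) (Tm.var (Var.s (Var.s (Var.s (Var.s Var.z)))))
  have key : ∀ x, Sat (x ▹ E) (Fm.eq G G') := by
    refine sat_induct E _ ?_ fun x hx => ?_
    · exact num_eq.1 ((num_rec_zero _ _).trans (ha.trans (num_rec_zero _ _).symm))
    · refine num_eq.1 ((num_rec_succ _ _ _).trans (Eq.trans ?_ (num_rec_succ _ _ _).symm))
      exact (num_lam_lam _ _ _ _).trans
        ((hb _ _ _ _ (num_eq.2 hx) rfl).trans (num_lam_lam _ _ _ _).symm)
  exact (num_eq.2 (key (n.eval ρ))).trans (num_eq.2 (𝔐.congr_nat E G' (num_eq.1 hn)))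

/-- The predecessor of the model; it maps `0` to `0`. -/
noncomputable def pred (n : 𝔐.Num) : 𝔐.Num := value (n.out ▹ 𝔐.base) (predT v0)

theorem value_predT (ρ : Env 𝔐.M Δ) [Good 𝔐 ρ] (n : Tm Δ Ty.nat) :
    value ρ (predT n) = pred (value ρ n) :=
  natRec_congr rfl (fun _ _ _ _ _ h => h) (num_out _).symm

noncomputable instance : Add 𝔐.Num := ⟨fun m n => value (m.out ▹ n.out ▹ 𝔐.base) (addT v0 v1)⟩

theorem value_addT (ρ : Env 𝔐.M Δ) [Good 𝔐 ρ] (m n : Tm Δ Ty.nat) :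
    value ρ (addT m n) = value ρ m + value ρ n :=
  natRec_congr (num_out _).symm
    (fun _ _ _ _ h _ => by rw [value_suc, value_suc, value_v1, value_v1, h]) (num_out _).symm

noncomputable instance : _root_.Sub 𝔐.Num :=
  ⟨fun m n => value (m.out ▹ n.out ▹ 𝔐.base) (subT v0 v1)⟩

theorem value_subT (ρ : Env 𝔐.M Δ) [Good 𝔐 ρ] (m n : Tm Δ Ty.nat) :
    value ρ (subT m n) = value ρ m - value ρ n :=
  natRec_congr (num_out _).symm
    (fun _ _ _ _ h _ => by rw [value_predT, value_predT, value_v1, value_v1, h]) (num_out _).symm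

noncomputable instance : Mul 𝔐.Num := ⟨fun m n => value (m.out ▹ n.out ▹ 𝔐.base) (mulT v0 v1)⟩

theorem value_mulT (ρ : Env 𝔐.M Δ) [Good 𝔐 ρ] (m n : Tm Δ Ty.nat) :
    value ρ (mulT m n) = value ρ m * value ρ n :=
  natRec_congr rfl
    (fun _ _ _ _ h _ => by
      rw [value_addT, value_addT, value_v1, value_v1, h, value_wk, value_wk, value_wk, value_wk,
        value_v0, num_out])
    (num_out _).symm

/-- The powers of `2` of the model. -/
noncomputable def pow2 (n : 𝔐.Num) : 𝔐.Num := value (n.out ▹ 𝔐.base) (powT v0)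

theorem value_powT (ρ : Env 𝔐.M Δ) [Good 𝔐 ρ] (n : Tm Δ Ty.nat) :
    value ρ (powT n) = pow2 (value ρ n) :=
  natRec_congr rfl (fun _ _ _ _ h _ => by rw [value_addT, value_addT, value_v1, value_v1, h])
    (num_out _).symm

/-- The triangular numbers `0 + 1 + ⋯ + n` of the model. -/
noncomputable def tri (n : 𝔐.Num) : 𝔐.Num := value (n.out ▹ 𝔐.base) (triT v0)

theorem value_triT (ρ : Env 𝔐.M Δ) [Good 𝔐 ρ] (n : Tm Δ Ty.nat) :
    value ρ (triT n) = tri (value ρ n) :=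
  natRec_congr rfl
    (fun _ _ _ _ h h' => by
      rw [value_addT, value_addT, value_v1, value_v1, h, value_suc, value_suc, value_v0, value_v0,
        h'])
    (num_out _).symm

/-- Definition by cases in the model: `a` if `c = 0`, and `b` otherwise. -/
noncomputable def cond (c a b : 𝔐.Num) : 𝔐.Num :=
  value (c.out ▹ a.out ▹ b.out ▹ 𝔐.base) (condT v0 v1 v2)

theorem value_condT (ρ : Env 𝔐.M Δ) [Good 𝔐 ρ] (c a b : Tm Δ Ty.nat) :
    value ρ (condT c a b) = cond (value ρ c) (value ρ a) (value ρ b) :=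
  natRec_congr (num_out _).symm
    (fun _ _ _ _ _ _ => by rw [value_wk, value_wk, value_wk, value_wk]; exact (num_out _).symm)
    (num_out _).symm

theorem pred_zero : pred (0 : 𝔐.Num) = 0 := by
  rw [← value_zro 𝔐.base, ← value_predT]
  exact natRec_zro _ _ _

theorem pred_succ (n : 𝔐.Num) : pred (succ n) = n := by
  obtain ⟨a, rfl⟩ := exists_num n
  rw [← value_v0 𝔐.base a, ← value_suc, ← value_predT]
  exact natRec_suc _ _ _ _

theorem num_add_zero (m : 𝔐.Num) : m + 0 = m := by
  obtain ⟨a, rfl⟩ := exists_num m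
  rw [← value_v0 𝔐.base a, ← value_zro (a ▹ 𝔐.base), ← value_addT]
  exact natRec_zro _ _ _

theorem add_succ (m n : 𝔐.Num) : m + succ n = succ (m + n) := by
  obtain ⟨a, rfl⟩ := exists_num m
  obtain ⟨b, rfl⟩ := exists_num n
  rw [← value_v0 (b ▹ 𝔐.base) a, ← value_v1 𝔐.base b a, ← value_suc, ← value_addT, ← value_addT]
  exact (natRec_suc _ _ _ _).trans (value_suc _ _)

theorem num_sub_zero (m : 𝔐.Num) : m - 0 = m := by
  obtain ⟨a, rfl⟩ := exists_num m
  rw [← value_v0 𝔐.base a, ← value_zro (a ▹ 𝔐.base), ← value_subT]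
  exact natRec_zro _ _ _

theorem sub_succ (m n : 𝔐.Num) : m - succ n = pred (m - n) := by
  obtain ⟨a, rfl⟩ := exists_num m
  obtain ⟨b, rfl⟩ := exists_num n
  rw [← value_v0 (b ▹ 𝔐.base) a, ← value_v1 𝔐.base b a, ← value_suc, ← value_subT, ← value_subT]
  exact (natRec_suc _ _ _ _).trans (value_predT _ _)

theorem num_mul_zero (m : 𝔐.Num) : m * 0 = 0 := by
  obtain ⟨a, rfl⟩ := exists_num m
  rw [← value_v0 𝔐.base a, ← value_zro (a ▹ 𝔐.base), ← value_mulT]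
  exact natRec_zro _ _ _

theorem mul_succ (m n : 𝔐.Num) : m * succ n = m * n + m := by
  obtain ⟨a, rfl⟩ := exists_num m
  obtain ⟨b, rfl⟩ := exists_num n
  rw [← value_v0 (b ▹ 𝔐.base) a, ← value_v1 𝔐.base b a, ← value_suc, ← value_mulT, ← value_mulT]
  refine (natRec_suc _ _ _ _).trans ((value_addT _ _ _).trans ?_)
  rw [value_wk, value_wk]
  rfl

theorem pow2_zero : pow2 (0 : 𝔐.Num) = succ 0 := by
  rw [← value_zro 𝔐.base, ← value_powT, ← value_suc]
  exact natRec_zro _ _ _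

theorem pow2_succ (n : 𝔐.Num) : pow2 (succ n) = pow2 n + pow2 n := by
  obtain ⟨a, rfl⟩ := exists_num n
  rw [← value_v0 𝔐.base a, ← value_suc, ← value_powT, ← value_powT]
  exact (natRec_suc _ _ _ _).trans (value_addT _ _ _)

theorem tri_zero : tri (0 : 𝔐.Num) = 0 := by
  rw [← value_zro 𝔐.base, ← value_triT]
  exact natRec_zro _ _ _

theorem tri_succ (n : 𝔐.Num) : tri (succ n) = tri n + succ n := by
  obtain ⟨a, rfl⟩ := exists_num n
  rw [← value_v0 𝔐.base a, ← value_suc, ← value_triT, ← value_triT]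
  refine (natRec_suc _ _ _ _).trans ((value_addT _ _ _).trans ?_)
  rw [value_suc, value_suc]
  rfl

theorem cond_zero (a b : 𝔐.Num) : cond 0 a b = a := by
  obtain ⟨a, rfl⟩ := exists_num a
  obtain ⟨b, rfl⟩ := exists_num b
  rw [← value_v0 (b ▹ 𝔐.base) a, ← value_v1 𝔐.base b a, ← value_zro (a ▹ b ▹ 𝔐.base), ← value_condT]
  exact natRec_zro _ _ _

theorem cond_succ (c a b : 𝔐.Num) : cond (succ c) a b = b := by
  obtain ⟨a, rfl⟩ := exists_num a
  obtain ⟨b, rfl⟩ := exists_num b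
  obtain ⟨c, rfl⟩ := exists_num c
  rw [← value_v0 (b ▹ c ▹ 𝔐.base) a, ← value_v1 (c ▹ 𝔐.base) b a, ← value_v2 𝔐.base c b a,
    ← value_suc, ← value_condT]
  refine (natRec_suc _ _ _ _).trans ?_
  rw [value_wk, value_wk]

section OrderedSemiring

attribute [local simp] sat_eq sat_and sat_or sat_imp value_v0 value_v1 value_v2 value_wk value_zro
  value_suc value_addT value_mulT value_subT value_predT pred_zero pred_succ num_add_zero add_succ
  num_sub_zero sub_succ num_mul_zero mul_succ succ_ne_zero

noncomputable instance : One 𝔐.Num := ⟨succ 0⟩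

theorem succ_zero : succ (0 : 𝔐.Num) = 1 := rfl

theorem num_zero_add (n : 𝔐.Num) : 0 + n = n :=
  num_induct 𝔐.base (Fm.eq (addT zro v0) v0) (P := fun n => 0 + n = n) (fun x => by simp) (by simp)
    (fun n h => by simp [h]) n

theorem succ_add (m n : 𝔐.Num) : succ m + n = succ (m + n) := by
  obtain ⟨a, rfl⟩ := exists_num m
  exact num_induct (a ▹ 𝔐.base) (Fm.eq (addT (suc v1) v0) (suc (addT v1 v0)))
    (P := fun n => succ (𝔐.num a) + n = succ (𝔐.num a + n)) (fun x => by simp) (by simp)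
    (fun n h => by simp [h]) n

theorem num_add_comm (m n : 𝔐.Num) : m + n = n + m := by
  obtain ⟨a, rfl⟩ := exists_num m
  exact num_induct (a ▹ 𝔐.base) (Fm.eq (addT v1 v0) (addT v0 v1))
    (P := fun n => 𝔐.num a + n = n + 𝔐.num a) (fun x => by simp) (by simp [num_zero_add])
    (fun n h => by simp [h, succ_add]) n

theorem num_add_assoc (k m n : 𝔐.Num) : k + m + n = k + (m + n) := by
  obtain ⟨a, rfl⟩ := exists_num k
  obtain ⟨b, rfl⟩ := exists_num m
  exact num_induct (a ▹ b ▹ 𝔐.base) (Fm.eq (addT (addT v1 v2) v0) (addT v1 (addT v2 v0)))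
    (P := fun n => 𝔐.num a + 𝔐.num b + n = 𝔐.num a + (𝔐.num b + n)) (fun x => by simp) (by simp)
    (fun n h => by simp [h]) n

noncomputable instance : AddCommMonoid 𝔐.Num where
  add_assoc := num_add_assoc
  zero_add := num_zero_add
  add_zero := num_add_zero
  add_comm := num_add_comm
  nsmul := nsmulRec

theorem succ_eq_add_one (n : 𝔐.Num) : succ n = n + 1 := by
  rw [← succ_zero, add_succ, num_add_zero]

theorem num_zero_mul (n : 𝔐.Num) : 0 * n = 0 :=
  num_induct 𝔐.base (Fm.eq (mulT zro v0) zro) (P := fun n => 0 * n = 0) (fun x => by simp)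
    (by simp) (fun n h => by simp [h]) n

theorem succ_mul (m n : 𝔐.Num) : succ m * n = m * n + n := by
  obtain ⟨a, rfl⟩ := exists_num m
  exact num_induct (a ▹ 𝔐.base) (Fm.eq (mulT (suc v1) v0) (addT (mulT v1 v0) v0))
    (P := fun n => succ (𝔐.num a) * n = 𝔐.num a * n + n) (fun x => by simp) (by simp)
    (fun n h => by simp [h, add_right_comm]) n

theorem num_mul_comm (m n : 𝔐.Num) : m * n = n * m := by
  obtain ⟨a, rfl⟩ := exists_num m
  exact num_induct (a ▹ 𝔐.base) (Fm.eq (mulT v1 v0) (mulT v0 v1))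
    (P := fun n => 𝔐.num a * n = n * 𝔐.num a) (fun x => by simp) (by simp [num_zero_mul])
    (fun n h => by simp [h, succ_mul]) n

theorem num_mul_add (k m n : 𝔐.Num) : k * (m + n) = k * m + k * n := by
  obtain ⟨a, rfl⟩ := exists_num k
  obtain ⟨b, rfl⟩ := exists_num m
  exact num_induct (a ▹ b ▹ 𝔐.base)
    (Fm.eq (mulT v1 (addT v2 v0)) (addT (mulT v1 v2) (mulT v1 v0)))
    (P := fun n => 𝔐.num a * (𝔐.num b + n) = 𝔐.num a * 𝔐.num b + 𝔐.num a * n) (fun x => by simp)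
    (by simp) (fun n h => by simp [h, add_assoc]) n

theorem num_mul_assoc (k m n : 𝔐.Num) : k * m * n = k * (m * n) := by
  obtain ⟨a, rfl⟩ := exists_num k
  obtain ⟨b, rfl⟩ := exists_num m
  exact num_induct (a ▹ b ▹ 𝔐.base) (Fm.eq (mulT (mulT v1 v2) v0) (mulT v1 (mulT v2 v0)))
    (P := fun n => 𝔐.num a * 𝔐.num b * n = 𝔐.num a * (𝔐.num b * n)) (fun x => by simp) (by simp)
    (fun n h => by simp [h, num_mul_add]) n

theorem num_one_mul (n : 𝔐.Num) : 1 * n = n := by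
  rw [← succ_zero, succ_mul, num_zero_mul, num_zero_add]

noncomputable instance : CommSemiring 𝔐.Num where
  mul_assoc := num_mul_assoc
  mul_comm := num_mul_comm
  zero_mul := num_zero_mul
  mul_zero := num_mul_zero
  left_distrib := num_mul_add
  right_distrib := fun k m n => by
    rw [num_mul_comm, num_mul_add, num_mul_comm n k, num_mul_comm n m]
  one_mul := num_one_mul
  mul_one := fun n => by rw [num_mul_comm, num_one_mul]

theorem zero_or_succ (n : 𝔐.Num) : n = 0 ∨ ∃ m, n = succ m := by
  have h := num_induct 𝔐.base (Fm.or (Fm.eq v0 zro) (Fm.eq v0 (suc (predT v0))))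
    (P := fun n => n = 0 ∨ n = succ (pred n)) (fun x => by simp) (by simp) (by simp) n
  exact h.imp_right fun h => ⟨_, h⟩

theorem num_add_right_cancel {m n k : 𝔐.Num} : m + k = n + k → m = n := by
  obtain ⟨a, rfl⟩ := exists_num m
  obtain ⟨b, rfl⟩ := exists_num n
  exact num_induct (a ▹ b ▹ 𝔐.base) (Fm.imp (Fm.eq (addT v1 v0) (addT v2 v0)) (Fm.eq v1 v2))
    (P := fun k => 𝔐.num a + k = 𝔐.num b + k → 𝔐.num a = 𝔐.num b) (fun x => by simp)
    (by simp) (fun k h h' => h (succ_injective (by simpa using h'))) k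

theorem num_add_left_cancel {m n k : 𝔐.Num} (h : k + m = k + n) : m = n :=
  num_add_right_cancel (k := k) (by rw [add_comm m, add_comm n, h])

theorem succ_sub_succ (m n : 𝔐.Num) : succ m - succ n = m - n := by
  obtain ⟨a, rfl⟩ := exists_num m
  exact num_induct (a ▹ 𝔐.base) (Fm.eq (subT (suc v1) (suc v0)) (subT v1 v0))
    (P := fun n => succ (𝔐.num a) - succ n = 𝔐.num a - n) (fun x => by simp [-sub_succ])
    (by simp) (fun n h => by rw [sub_succ, h, sub_succ]) n

theorem add_sub_self (m n : 𝔐.Num) : m + n - m = n := by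
  obtain ⟨b, rfl⟩ := exists_num n
  exact num_induct (b ▹ 𝔐.base) (Fm.eq (subT (addT v0 v1) v0) v1)
    (P := fun m => m + 𝔐.num b - m = 𝔐.num b) (fun x => by simp) (by simp)
    (fun m h => by rw [succ_add, succ_sub_succ, h]) m

theorem num_sub_self (m : 𝔐.Num) : m - m = 0 := by simpa using add_sub_self m 0

theorem sub_add_self (m n : 𝔐.Num) : m - (m + n) = 0 := by
  obtain ⟨a, rfl⟩ := exists_num m
  exact num_induct (a ▹ 𝔐.base) (Fm.eq (subT v1 (addT v1 v0)) zro)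
    (P := fun n => 𝔐.num a - (𝔐.num a + n) = 0) (fun x => by simp) (by simp [num_sub_self])
    (fun n h => by simp [h]) n

theorem add_sub_or (m n : 𝔐.Num) : n + (m - n) = m ∨ m + (n - m) = n := by
  obtain ⟨a, rfl⟩ := exists_num m
  refine num_induct (a ▹ 𝔐.base)
    (Fm.or (Fm.eq (addT v0 (subT v1 v0)) v1) (Fm.eq (addT v1 (subT v0 v1)) v0))
    (P := fun n => n + (𝔐.num a - n) = 𝔐.num a ∨ 𝔐.num a + (n - 𝔐.num a) = n)
    (fun x => by simp) (by simp) (fun n h => ?_) n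
  rcases h with h | h
  · rcases zero_or_succ (𝔐.num a - n) with h₁ | ⟨k, h₁⟩
    · rw [h₁, num_add_zero] at h
      subst h
      right
      rw [succ_eq_add_one, add_sub_self]
    · left
      rw [h₁, add_succ] at h
      rw [← h, ← succ_add, add_sub_self]
  · right
    rw [← h, ← add_succ, add_sub_self]

instance : LE 𝔐.Num := ⟨fun m n => ∃ k, n = m + k⟩

theorem eq_zero_of_add_eq_zero {m n : 𝔐.Num} (h : m + n = 0) : n = 0 := by
  rcases zero_or_succ n with h' | ⟨k, rfl⟩
  · exact h'
  · exact absurd (add_succ m k ▸ h) (succ_ne_zero _)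

theorem num_le_antisymm {m n : 𝔐.Num} (h : m ≤ n) (h' : n ≤ m) : m = n := by
  obtain ⟨k, rfl⟩ := h
  obtain ⟨l, h'⟩ := h'
  have h₁ : k + l = 0 := num_add_left_cancel (k := m) (by rw [← add_assoc, ← h', num_add_zero])
  rw [eq_zero_of_add_eq_zero ((add_comm l k).trans h₁), num_add_zero]

noncomputable instance : LinearOrder 𝔐.Num where
  le_refl n := ⟨0, (num_add_zero n).symm⟩
  le_trans := by
    rintro m _ _ ⟨k, rfl⟩ ⟨l, rfl⟩
    exact ⟨k + l, add_assoc _ _ _⟩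
  le_antisymm _ _ := num_le_antisymm
  le_total m n := (add_sub_or m n).symm.imp (fun h => ⟨_, h.symm⟩) fun h => ⟨_, h.symm⟩
  toDecidableLE := Classical.decRel _

theorem sub_eq_zero_iff {m n : 𝔐.Num} : m - n = 0 ↔ m ≤ n := by
  constructor
  · intro h
    rcases add_sub_or m n with h' | h'
    · rw [h, num_add_zero] at h'
      exact h'.ge
    · exact ⟨_, h'.symm⟩
  · rintro ⟨k, rfl⟩
    exact sub_add_self _ _

theorem succ_le_iff {m n : 𝔐.Num} : succ m ≤ n ↔ m < n := by
  rw [lt_iff_le_and_ne]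
  constructor
  · rintro ⟨k, rfl⟩
    refine ⟨⟨succ k, by rw [succ_add, add_succ]⟩, fun h => succ_ne_zero k ?_⟩
    refine (num_add_left_cancel (k := m) ?_).symm
    rw [num_add_zero, add_succ, ← succ_add]
    exact h
  · rintro ⟨⟨k, rfl⟩, h⟩
    rcases zero_or_succ k with rfl | ⟨k, rfl⟩
    · exact absurd (num_add_zero m).symm h
    · exact ⟨k, by rw [succ_add, add_succ]⟩

instance : Nontrivial 𝔐.Num := ⟨⟨0, 1, (succ_ne_zero 0).symm⟩⟩

instance : ExistsAddOfLE 𝔐.Num := ⟨fun h => h⟩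

theorem num_zero_le (n : 𝔐.Num) : 0 ≤ n := ⟨n, (zero_add n).symm⟩

instance : IsOrderedCancelAddMonoid 𝔐.Num where
  add_le_add_left := by
    rintro m _ ⟨k, rfl⟩ n
    exact ⟨k, by rw [add_right_comm]⟩
  le_of_add_le_add_left := by
    rintro n m l ⟨k, h⟩
    exact ⟨k, num_add_left_cancel (k := n) (by rw [h, add_assoc])⟩

theorem num_mul_pos {m n : 𝔐.Num} (hm : 0 < m) (hn : 0 < n) : 0 < m * n := by
  obtain ⟨k, rfl⟩ := succ_le_iff.2 hm
  obtain ⟨l, rfl⟩ := succ_le_iff.2 hn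
  refine succ_le_iff.1 ⟨k + l + k * l, ?_⟩
  rw [succ_zero]
  ring

theorem num_mul_lt_mul {k m n : 𝔐.Num} (hk : 0 < k) (h : m < n) : k * m < k * n := by
  obtain ⟨l, rfl⟩ := succ_le_iff.2 h
  have hl : 0 < succ l := succ_le_iff.1 ⟨l, by rw [succ_add, zero_add]⟩
  obtain ⟨j, hj⟩ := succ_le_iff.2 (num_mul_pos hk hl)
  refine succ_le_iff.1 ⟨j, ?_⟩
  rw [succ_add, ← add_succ, mul_add, hj, succ_add, zero_add, succ_add, add_succ]

instance : IsStrictOrderedRing 𝔐.Num where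
  zero_le_one := num_zero_le 1
  mul_lt_mul_of_pos_left _ hk _ _ h := num_mul_lt_mul hk h
  mul_lt_mul_of_pos_right k hk m n h := by
    rw [mul_comm m, mul_comm n]
    exact num_mul_lt_mul hk h

end OrderedSemiring

end TModel

/-! ### The ordered field of an ordered semiring -/

section Differences

universe u

variable (N : Type u) [CommSemiring N] [LinearOrder N] [IsStrictOrderedRing N]

/-- The pairs `(a, b)` and `(c, d)` are equivalent if `a - b = c - d`, with both sides moved so that
no subtraction occurs. -/
def diffSetoid : Setoid (N × N) where
  r p q := p.1 + q.2 = q.1 + p.2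
  iseqv := by
    refine ⟨fun _ => rfl, fun h => h.symm, fun {p q r} h h' => ?_⟩
    have : (p.1 + r.2) + q.2 = (r.1 + p.2) + q.2 := by linear_combination h + h'
    exact add_right_cancel this

/-- The ring of formal differences of elements of an ordered semiring. -/
def Diff : Type u := Quotient (diffSetoid N)

namespace Diff

variable {N}

/-- The formal difference `p.1 - p.2`. -/
def mk (p : N × N) : Diff N := Quotient.mk (diffSetoid N) p

theorem mk_eq {p q : N × N} : mk p = mk q ↔ p.1 + q.2 = q.1 + p.2 := Quotient.eq

theorem exists_mk (x : Diff N) : ∃ p, mk p = x := Quotient.exists_rep x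

instance : Zero (Diff N) := ⟨mk (0, 0)⟩

instance : One (Diff N) := ⟨mk (1, 0)⟩

instance : Add (Diff N) :=
  ⟨Quotient.map₂ (fun p q => (p.1 + q.1, p.2 + q.2)) fun p p' h q q' h' => by
    change p.1 + p'.2 = p'.1 + p.2 at h
    change q.1 + q'.2 = q'.1 + q.2 at h'
    change p.1 + q.1 + (p'.2 + q'.2) = p'.1 + q'.1 + (p.2 + q.2)
    linear_combination h + h'⟩

instance : Mul (Diff N) :=
  ⟨Quotient.map₂ (fun p q => (p.1 * q.1 + p.2 * q.2, p.1 * q.2 + p.2 * q.1))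
    fun p p' h q q' h' => by
    change p.1 + p'.2 = p'.1 + p.2 at h
    change q.1 + q'.2 = q'.1 + q.2 at h'
    change p.1 * q.1 + p.2 * q.2 + (p'.1 * q'.2 + p'.2 * q'.1) =
      p'.1 * q'.1 + p'.2 * q'.2 + (p.1 * q.2 + p.2 * q.1)
    refine add_right_cancel (b := (p'.1 * q.1 + p'.2 * q.2) + (p'.1 * q.2 + p'.2 * q.1)) ?_
    linear_combination q.1 * h + q.2 * h.symm + p'.1 * h' + p'.2 * h'.symm⟩

instance : Neg (Diff N) :=
  ⟨Quotient.map (fun p => (p.2, p.1)) fun p p' h => by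
    change p.1 + p'.2 = p'.1 + p.2 at h
    change p.2 + p'.1 = p'.2 + p.1
    linear_combination h.symm⟩

instance : CommRing (Diff N) := .ofMinimalAxioms
  (by rintro ⟨p⟩ ⟨q⟩ ⟨r⟩; exact mk_eq.2 (by ring))
  (by rintro ⟨p⟩; exact mk_eq.2 (by ring))
  (by rintro ⟨p⟩; exact mk_eq.2 (by ring))
  (by rintro ⟨p⟩ ⟨q⟩ ⟨r⟩; exact mk_eq.2 (by ring))
  (by rintro ⟨p⟩ ⟨q⟩; exact mk_eq.2 (by ring))
  (by rintro ⟨p⟩; exact mk_eq.2 (by ring))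
  (by rintro ⟨p⟩ ⟨q⟩ ⟨r⟩; exact mk_eq.2 (by ring))

variable (N) in
/-- The inclusion of an ordered semiring into its ring of differences. -/
def of : N →+* Diff N where
  toFun a := mk (a, 0)
  map_one' := rfl
  map_zero' := rfl
  map_mul' a b := mk_eq.2 (by dsimp only; ring)
  map_add' a b := mk_eq.2 (by dsimp only; ring)

theorem of_injective : Function.Injective (of N) := fun a b h => by
  simpa using mk_eq.1 h

instance : Nontrivial (Diff N) := of_injective.nontrivial

variable [ExistsAddOfLE N]

theorem exists_of (x : Diff N) : ∃ a : N, 0 ≤ a ∧ (x = of N a ∨ x = -of N a) := by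
  obtain ⟨p, rfl⟩ := x.exists_mk
  rcases le_total p.1 p.2 with h | h
  · obtain ⟨a, ha⟩ := exists_add_of_le h
    refine ⟨a, by simpa [ha] using h, .inr (mk_eq.2 ?_)⟩
    rw [ha]
    dsimp only
    ring
  · obtain ⟨a, ha⟩ := exists_add_of_le h
    refine ⟨a, by simpa [ha] using h, .inl (mk_eq.2 ?_)⟩
    rw [ha]
    dsimp only
    ring

instance : NoZeroDivisors (Diff N) where
  eq_zero_or_eq_zero_of_mul_eq_zero {x y} h := by
    obtain ⟨a, -, hx⟩ := exists_of x
    obtain ⟨b, -, hy⟩ := exists_of y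
    have hab : of N a * of N b = 0 := by
      rcases hx with rfl | rfl <;> rcases hy with rfl | rfl <;> simpa using h
    rw [← map_mul, map_eq_zero_iff _ of_injective] at hab
    rcases mul_eq_zero.1 hab with rfl | rfl
    · exact .inl (by simpa using hx)
    · exact .inr (by simpa using hy)

instance : IsDomain (Diff N) := NoZeroDivisors.to_isDomain _

end Diff

variable {N}
variable {K : Type*} [Field K]

/-- The quotients of nonnegative by positive elements of an ordered semiring. -/
def fractionCone (f : N →+* K) (hf : Function.Injective f) : RingCone K where
  carrier := {x | ∃ a b : N, 0 ≤ a ∧ 0 < b ∧ x = f a / f b}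
  mul_mem' := by
    rintro _ _ ⟨a, b, ha, hb, rfl⟩ ⟨c, d, hc, hd, rfl⟩
    exact ⟨a * c, b * d, mul_nonneg ha hc, mul_pos hb hd, by
      rw [map_mul, map_mul, div_mul_div_comm]⟩
  one_mem' := ⟨1, 1, zero_le_one, zero_lt_one, by simp⟩
  add_mem' := by
    rintro _ _ ⟨a, b, ha, hb, rfl⟩ ⟨c, d, hc, hd, rfl⟩
    refine ⟨a * d + b * c, b * d, add_nonneg (mul_nonneg ha hd.le) (mul_nonneg hb.le hc),
      mul_pos hb hd, ?_⟩
    rw [div_add_div _ _ ((map_ne_zero_iff f hf).2 hb.ne') ((map_ne_zero_iff f hf).2 hd.ne')]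
    simp only [map_add, map_mul]
  zero_mem' := ⟨0, 1, le_rfl, zero_lt_one, by simp⟩
  eq_zero_of_mem_of_neg_mem' := by
    rintro _ ⟨a, b, ha, hb, rfl⟩ ⟨c, d, hc, hd, h⟩
    have hfb : f b ≠ 0 := (map_ne_zero_iff f hf).2 hb.ne'
    have hfd : f d ≠ 0 := (map_ne_zero_iff f hf).2 hd.ne'
    have hsum : a * d + b * c = 0 := by
      rw [← map_eq_zero_iff f hf, map_add, map_mul, map_mul]
      field_simp at h
      linear_combination -h
    have had : a * d = 0 := le_antisymm
      (hsum ▸ le_add_of_nonneg_right (mul_nonneg hb.le hc)) (mul_nonneg ha hd.le)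
    have ha₀ : a = 0 := ha.eq_or_lt'.resolve_right fun ha => (mul_pos ha hd).ne' had
    rw [ha₀, map_zero, zero_div]

variable [ExistsAddOfLE N]

theorem exists_order_of_fractions {f : N →+* K} (hf : Function.Injective f)
    (hK : ∀ x : K, ∃ a b : N, 0 ≤ a ∧ 0 < b ∧ (x = f a / f b ∨ x = -(f a / f b))) :
    ∃ _ : LinearOrder K, IsStrictOrderedRing K ∧ StrictMono f := by
  classical
  have : HasMemOrNegMem (fractionCone f hf) := ⟨fun x => by
    obtain ⟨a, b, ha, hb, h | h⟩ := hK x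
    · exact .inl ⟨a, b, ha, hb, h⟩
    · exact .inr ⟨a, b, ha, hb, by rw [h, neg_neg]⟩⟩
  let _ : LinearOrder K := LinearOrder.mkOfAddGroupCone (fractionCone f hf)
  have : IsOrderedRing K := IsOrderedRing.mkOfCone (fractionCone f hf)
  refine ⟨inferInstance, IsOrderedRing.toIsStrictOrderedRing K, fun a b hab => ?_⟩
  refine lt_of_le_of_ne ?_ (hf.ne hab.ne)
  obtain ⟨c, rfl⟩ := exists_add_of_le hab.le
  have hc : 0 ≤ c := (le_add_iff_nonneg_right a).1 hab.le
  exact show f (a + c) - f a ∈ fractionCone f hf from ⟨c, 1, hc, zero_lt_one, by simp⟩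

variable (N) in
theorem exists_ordered_field :
    ∃ (K : Type u) (_ : Field K) (_ : LinearOrder K) (_ : IsStrictOrderedRing K) (f : N →+* K),
      StrictMono f := by
  let f : N →+* FractionRing (Diff N) :=
    (algebraMap (Diff N) (FractionRing (Diff N))).comp (Diff.of N)
  have hf : Function.Injective f :=
    (IsFractionRing.injective (Diff N) (FractionRing (Diff N))).comp Diff.of_injective
  obtain ⟨hlin, hord, hmono⟩ := exists_order_of_fractions hf fun x => by
    obtain ⟨y, z, hz, rfl⟩ := IsFractionRing.div_surjective (A := Diff N) x
    obtain ⟨a, ha, hy⟩ := y.exists_of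
    obtain ⟨b, hb, hz'⟩ := z.exists_of
    have hb0 : b ≠ 0 := by
      rintro rfl
      exact nonZeroDivisors.ne_zero hz (by simpa using hz')
    refine ⟨a, b, ha, lt_of_le_of_ne hb hb0.symm, ?_⟩
    rcases hy with rfl | rfl <;> rcases hz' with rfl | rfl <;>
      simp [f, div_neg, neg_div]
  exact ⟨FractionRing (Diff N), inferInstance, hlin, hord, f, hmono⟩

end Differences

namespace TModel

variable {Γ Δ Δ' : List Ty} {𝔐 : TModel Γ}

/-- The step function for the first projection of pairs. -/
def unpairStepFst : Tm Δ (Ty.fn Ty.nat (Ty.fn Ty.nat one)) :=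
  Tm.lam (Tm.lam (Tm.lam (condT v2 (suc v1) (predT v2))))

/-- The step function for the second projection of pairs. -/
def unpairStepSnd : Tm Δ (Ty.fn Ty.nat (Ty.fn Ty.nat one)) :=
  Tm.lam (Tm.lam (Tm.lam (condT v2 zro (suc v1))))

theorem num_unpairStepFst (ρ : Env 𝔐.M Δ) [Good 𝔐 ρ] (a b c : 𝔐.M.D Ty.nat) :
    𝔐.num (𝔐.M.app (𝔐.M.app (𝔐.M.app (unpairStepFst.eval ρ) a) b) c) =
      cond (𝔐.num a) (succ (𝔐.num b)) (pred (𝔐.num a)) := by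
  rw [unpairStepFst, num_lam_lam_lam, value_condT, value_suc, value_predT]
  rfl

theorem num_unpairStepSnd (ρ : Env 𝔐.M Δ) [Good 𝔐 ρ] (a b c : 𝔐.M.D Ty.nat) :
    𝔐.num (𝔐.M.app (𝔐.M.app (𝔐.M.app (unpairStepSnd.eval ρ) a) b) c) =
      cond (𝔐.num a) 0 (succ (𝔐.num b)) := by
  rw [unpairStepSnd, num_lam_lam_lam, value_condT, value_suc]
  rfl

/-- The value of a simultaneous recursion for two sequences of numbers that starts with zeros. -/
def rec₂ (i : Var [Ty.nat, Ty.nat] Ty.nat) (f g : 𝔐.M.D (Ty.fn Ty.nat (Ty.fn Ty.nat one)))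
    (x : 𝔐.M.D Ty.nat) : 𝔐.M.D Ty.nat :=
  𝔐.M.app (𝔐.M.app (𝔐.M.app (𝔐.M.app (𝔐.M.app (𝔐.M.con (Con.recursor [Ty.nat, Ty.nat] i)) x)
    (𝔐.M.con Con.zero)) (𝔐.M.con Con.zero)) f) g

/-- The term with value `rec₂`. -/
def rec₂T (i : Var [Ty.nat, Ty.nat] Ty.nat) (f g : Tm Δ (Ty.fn Ty.nat (Ty.fn Ty.nat one)))
    (x : Tm Δ Ty.nat) : Tm Δ Ty.nat :=
  Tm.app (Tm.app (Tm.app (Tm.app (Tm.app (Tm.con (Con.recursor [Ty.nat, Ty.nat] i)) x) zro) zro) f)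
    g

theorem rec₂_zero (i : Var [Ty.nat, Ty.nat] Ty.nat)
    (f g : 𝔐.M.D (Ty.fn Ty.nat (Ty.fn Ty.nat one))) :
    𝔐.num (rec₂ i f g (𝔐.M.con Con.zero)) = 0 := by
  have h := (sat_eqF _ _ _).1 (𝔐.sat_arith (f ▹ g ▹ 𝔐.base) (.recZero [Ty.nat, Ty.nat] i
    (Sub.cons zro (Sub.cons zro fun _ v => nomatch v))
    (Sub.cons v0 (Sub.cons v1 fun _ v => nomatch v))))
  match i, h with
  | Var.z, h => exact num_eq.2 h
  | Var.s Var.z, h => exact num_eq.2 h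

theorem rec₂_succ_fst (f g : 𝔐.M.D (Ty.fn Ty.nat (Ty.fn Ty.nat one))) (x : 𝔐.M.D Ty.nat) :
    𝔐.num (rec₂ Var.z f g (𝔐.M.app (𝔐.M.con Con.succ) x)) =
      𝔐.num (𝔐.M.app (𝔐.M.app (𝔐.M.app f (rec₂ Var.z f g x)) (rec₂ (Var.s Var.z) f g x)) x) :=
  num_eq.2 ((sat_eqF _ _ _).1 (𝔐.sat_arith (f ▹ g ▹ x ▹ 𝔐.base)
    (.recSucc [Ty.nat, Ty.nat] Var.z v2 (Sub.cons zro (Sub.cons zro fun _ v => nomatch v))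
      (Sub.cons v0 (Sub.cons v1 fun _ v => nomatch v)))))

theorem rec₂_succ_snd (f g : 𝔐.M.D (Ty.fn Ty.nat (Ty.fn Ty.nat one))) (x : 𝔐.M.D Ty.nat) :
    𝔐.num (rec₂ (Var.s Var.z) f g (𝔐.M.app (𝔐.M.con Con.succ) x)) =
      𝔐.num (𝔐.M.app (𝔐.M.app (𝔐.M.app g (rec₂ Var.z f g x)) (rec₂ (Var.s Var.z) f g x)) x) :=
  num_eq.2 ((sat_eqF _ _ _).1 (𝔐.sat_arith (f ▹ g ▹ x ▹ 𝔐.base)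
    (.recSucc [Ty.nat, Ty.nat] (Var.s Var.z) v2 (Sub.cons zro (Sub.cons zro fun _ v => nomatch v))
      (Sub.cons v0 (Sub.cons v1 fun _ v => nomatch v)))))

theorem rec₂_congr {f g f' g' : 𝔐.M.D (Ty.fn Ty.nat (Ty.fn Ty.nat one))}
    (hf : ∀ a b a' b' c, 𝔐.num a = 𝔐.num a' → 𝔐.num b = 𝔐.num b' →
      𝔐.num (𝔐.M.app (𝔐.M.app (𝔐.M.app f a) b) c) =
        𝔐.num (𝔐.M.app (𝔐.M.app (𝔐.M.app f' a') b') c))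
    (hg : ∀ a b a' b' c, 𝔐.num a = 𝔐.num a' → 𝔐.num b = 𝔐.num b' →
      𝔐.num (𝔐.M.app (𝔐.M.app (𝔐.M.app g a) b) c) =
        𝔐.num (𝔐.M.app (𝔐.M.app (𝔐.M.app g' a') b') c))
    (i : Var [Ty.nat, Ty.nat] Ty.nat) {x y : 𝔐.M.D Ty.nat} (hxy : 𝔐.num x = 𝔐.num y) :
    𝔐.num (rec₂ i f g x) = 𝔐.num (rec₂ i f' g' y) := by
  let E := f ▹ g ▹ f' ▹ g' ▹ 𝔐.base
  let σ := Ty.fn Ty.nat (Ty.fn Ty.nat one)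
  let G (i : Var [Ty.nat, Ty.nat] Ty.nat) : Tm (Ty.nat :: σ :: σ :: σ :: σ :: Γ) Ty.nat :=
    rec₂T i v1 v2 v0
  let G' (i : Var [Ty.nat, Ty.nat] Ty.nat) : Tm (Ty.nat :: σ :: σ :: σ :: σ :: Γ) Ty.nat :=
    rec₂T i (Tm.var (Var.s (Var.s (Var.s Var.z)))) (Tm.var (Var.s (Var.s (Var.s (Var.s Var.z))))) v0
  have agree : ∀ x, Sat (x ▹ E) (Fm.and (Fm.eq (G Var.z) (G' Var.z))
      (Fm.eq (G (Var.s Var.z)) (G' (Var.s Var.z)))) := by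
    refine sat_induct E _ ?_ fun x hx => ?_
    · exact ⟨num_eq.1 ((rec₂_zero _ _ _).trans (rec₂_zero _ _ _).symm),
        num_eq.1 ((rec₂_zero _ _ _).trans (rec₂_zero _ _ _).symm)⟩
    · have h₁ : 𝔐.num (rec₂ Var.z f g x) = 𝔐.num (rec₂ Var.z f' g' x) := num_eq.2 hx.1
      have h₂ : 𝔐.num (rec₂ (Var.s Var.z) f g x) = 𝔐.num (rec₂ (Var.s Var.z) f' g' x) :=
        num_eq.2 hx.2
      have h_fst := (rec₂_succ_fst f g x).trans (hf _ _ _ _ x h₁ h₂)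
      have h_snd := (rec₂_succ_snd f g x).trans (hg _ _ _ _ x h₁ h₂)
      exact ⟨num_eq.1 (h_fst.trans (rec₂_succ_fst f' g' x).symm),
        num_eq.1 (h_snd.trans (rec₂_succ_snd f' g' x).symm)⟩
  have h : 𝔐.num (rec₂ i f g x) = 𝔐.num (rec₂ i f' g' x) := by
    match i with
    | Var.z => exact num_eq.2 (agree x).1
    | Var.s Var.z => exact num_eq.2 (agree x).2
  exact h.trans (num_eq.2 (𝔐.congr_nat E (G' i) (num_eq.1 hxy)))

theorem value_unpairT_congr {ρ : Env 𝔐.M Δ} [Good 𝔐 ρ] {ρ' : Env 𝔐.M Δ'} [Good 𝔐 ρ']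
    (i : Var [Ty.nat, Ty.nat] Ty.nat) {n : Tm Δ Ty.nat} {n' : Tm Δ' Ty.nat}
    (hn : value ρ n = value ρ' n') : value ρ (unpairT i n) = value ρ' (unpairT i n') :=
  rec₂_congr
    (fun a b a' b' c ha hb => (num_unpairStepFst ρ a b c).trans <| by
      rw [ha, hb, ← num_unpairStepFst ρ' a' b' c, unpairStepFst])
    (fun a b a' b' c ha hb => (num_unpairStepSnd ρ a b c).trans <| by
      rw [ha, hb, ← num_unpairStepSnd ρ' a' b' c, unpairStepSnd])
    i hn

/-- The first component of the pair coded by `n`. -/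
noncomputable def fst (n : 𝔐.Num) : 𝔐.Num := value (n.out ▹ 𝔐.base) (fstT v0)

/-- The second component of the pair coded by `n`. -/
noncomputable def snd (n : 𝔐.Num) : 𝔐.Num := value (n.out ▹ 𝔐.base) (sndT v0)

theorem value_fstT (ρ : Env 𝔐.M Δ) [Good 𝔐 ρ] (n : Tm Δ Ty.nat) :
    value ρ (fstT n) = fst (value ρ n) :=
  value_unpairT_congr _ (num_out _).symm

theorem value_sndT (ρ : Env 𝔐.M Δ) [Good 𝔐 ρ] (n : Tm Δ Ty.nat) :
    value ρ (sndT n) = snd (value ρ n) :=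
  value_unpairT_congr _ (num_out _).symm

theorem fst_zero : fst (0 : 𝔐.Num) = 0 := by
  rw [← value_zro 𝔐.base, ← value_fstT]
  exact rec₂_zero _ _ _

theorem snd_zero : snd (0 : 𝔐.Num) = 0 := by
  rw [← value_zro 𝔐.base, ← value_sndT]
  exact rec₂_zero _ _ _

theorem fst_succ (n : 𝔐.Num) : fst (succ n) = cond (fst n) (succ (snd n)) (pred (fst n)) := by
  obtain ⟨a, rfl⟩ := exists_num n
  rw [← value_v0 𝔐.base a, ← value_suc, ← value_fstT, ← value_fstT, ← value_sndT]
  exact (rec₂_succ_fst _ _ _).trans (num_unpairStepFst _ _ _ _)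

theorem snd_succ (n : 𝔐.Num) : snd (succ n) = cond (fst n) 0 (succ (snd n)) := by
  obtain ⟨a, rfl⟩ := exists_num n
  rw [← value_v0 𝔐.base a, ← value_suc, ← value_sndT, ← value_fstT, ← value_sndT]
  exact (rec₂_succ_snd _ _ _).trans (num_unpairStepSnd _ _ _ _)

theorem unpair_tri_add_of (s : 𝔐.Num) (h : fst (tri s) = s ∧ snd (tri s) = 0) (n : 𝔐.Num) :
    n ≤ s → fst (tri s + n) + n = s ∧ snd (tri s + n) = n := by
  obtain ⟨a, rfl⟩ := exists_num s
  refine num_induct (a ▹ 𝔐.base) (Fm.imp (Fm.eq (subT v0 v1) zro)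
    (Fm.and (Fm.eq (addT (fstT (addT (triT v1) v0)) v0) v1)
      (Fm.eq (sndT (addT (triT v1) v0)) v0)))
    (P := fun n => n ≤ 𝔐.num a → fst (tri (𝔐.num a) + n) + n = 𝔐.num a ∧
      snd (tri (𝔐.num a) + n) = n) (fun x => ?_) (fun _ => ?_) (fun n ih hn => ?_) n
  · simp only [sat_imp, sat_and, sat_eq, value_addT, value_fstT, value_sndT, value_triT, value_subT,
      value_zro, value_v0, value_v1, sub_eq_zero_iff]
  · simpa only [num_add_zero] using h
  · rw [succ_le_iff] at hn
    obtain ⟨h₁, h₂⟩ := ih hn.le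
    rw [add_succ (tri (𝔐.num a)) n, fst_succ, snd_succ, h₂]
    rcases zero_or_succ (fst (tri (𝔐.num a) + n)) with h₃ | ⟨k, h₃⟩
    · rw [h₃, zero_add] at h₁
      exact absurd h₁ hn.ne
    · rw [h₃, cond_succ, cond_succ, pred_succ, add_succ, ← succ_add]
      rw [h₃] at h₁
      exact ⟨h₁, rfl⟩

theorem unpair_tri (s : 𝔐.Num) : fst (tri s) = s ∧ snd (tri s) = 0 := by
  refine num_induct 𝔐.base (Fm.and (Fm.eq (fstT (triT v0)) v0) (Fm.eq (sndT (triT v0)) zro))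
    (P := fun s => fst (tri s) = s ∧ snd (tri s) = 0) (fun x => ?_) ?_ (fun n ih => ?_) s
  · simp only [sat_and, sat_eq, value_fstT, value_sndT, value_triT, value_zro, value_v0]
  · rw [tri_zero, fst_zero, snd_zero]
    exact ⟨rfl, rfl⟩
  · obtain ⟨h₁, h₂⟩ := unpair_tri_add_of n ih n le_rfl
    have h₃ : fst (tri n + n) = 0 := num_add_right_cancel (k := n) (by rw [h₁, zero_add])
    rw [tri_succ, add_succ, fst_succ, snd_succ, h₃, h₂, cond_zero, cond_zero]
    exact ⟨rfl, rfl⟩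

theorem value_fst_pairT (ρ : Env 𝔐.M Δ) [Good 𝔐 ρ] (a b : Tm Δ Ty.nat) :
    fst (value ρ (pairT a b)) = value ρ a := by
  rw [pairT, value_addT, value_triT, value_addT]
  exact add_right_cancel
    (unpair_tri_add_of _ (unpair_tri _) _ (le_add_of_nonneg_left (num_zero_le _))).1

theorem value_snd_pairT (ρ : Env 𝔐.M Δ) [Good 𝔐 ρ] (a b : Tm Δ Ty.nat) :
    snd (value ρ (pairT a b)) = value ρ b := by
  rw [pairT, value_addT, value_triT, value_addT]
  exact (unpair_tri_add_of _ (unpair_tri _) _ (le_add_of_nonneg_left (num_zero_le _))).2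

theorem succ_pred_of_pos {n : 𝔐.Num} (h : 0 < n) : succ (pred n) = n := by
  rcases zero_or_succ n with rfl | ⟨k, rfl⟩
  · exact absurd h (lt_irrefl _)
  · rw [pred_succ]

theorem succ_pos (n : 𝔐.Num) : 0 < succ n :=
  lt_of_le_of_ne (num_zero_le _) (succ_ne_zero n).symm

theorem pow2_pos (n : 𝔐.Num) : 0 < pow2 n := by
  have h := num_induct 𝔐.base (Fm.eq (subT (suc zro) (powT v0)) zro) (P := fun n => succ 0 ≤ pow2 n)
    (fun x => by
      simp only [sat_eq, value_subT, value_suc, value_zro, value_powT, value_v0, sub_eq_zero_iff])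
    (by rw [pow2_zero])
    (fun n h => by
      rw [pow2_succ]
      exact h.trans (le_add_of_nonneg_left (num_zero_le _))) n
  exact succ_le_iff.1 h

section Codes

variable (ρ : Env 𝔐.M Δ) [Good 𝔐 ρ]

theorem value_denT (q : Tm Δ Ty.nat) : value ρ (denT q) = succ (snd (value ρ q)) := by
  rw [denT, value_suc, value_sndT]

theorem value_posT (q : Tm Δ Ty.nat) : value ρ (posT q) = fst (fst (value ρ q)) := by
  rw [posT, value_fstT, value_fstT]

theorem value_negT (q : Tm Δ Ty.nat) : value ρ (negT q) = snd (fst (value ρ q)) := by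
  rw [negT, value_sndT, value_fstT]

section Rationals

variable {K : Type*} [Field K]

/-- The rational number with a given code, in an ordered field that contains the numbers. -/
noncomputable def val (f : 𝔐.Num →+* K) (q : 𝔐.Num) : K :=
  (f (fst (fst q)) - f (snd (fst q))) / (f (snd q) + 1)

/-- The rational number `2 ^ (-n)`. -/
noncomputable def half (f : 𝔐.Num →+* K) (n : 𝔐.Num) : K := (f (pow2 n))⁻¹

variable {f : 𝔐.Num →+* K}

theorem map_succ (n : 𝔐.Num) : f (succ n) = f n + 1 := by
  rw [succ_eq_add_one, map_add, map_one]

theorem map_pred (n : 𝔐.Num) (h : 0 < n) : f (pred n) + 1 = f n := by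
  rw [← map_succ, succ_pred_of_pos h]

theorem half_succ (n : 𝔐.Num) : half f (succ n) = half f n / 2 := by
  rw [half, half, pow2_succ, map_add, ← two_mul, mul_inv, div_eq_inv_mul]

theorem val_ratT (a b c : Tm Δ Ty.nat) :
    val f (value ρ (ratT a b c)) = (f (value ρ a) - f (value ρ b)) / (f (value ρ c) + 1) := by
  rw [val, ratT, value_fst_pairT, value_snd_pairT, value_fst_pairT, value_snd_pairT]

theorem map_crossT (q r : Tm Δ Ty.nat) :
    f (value ρ (crossT q r)) = f (fst (fst (value ρ q))) * (f (snd (value ρ r)) + 1) +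
      f (snd (fst (value ρ r))) * (f (snd (value ρ q)) + 1) := by
  rw [crossT, value_addT, value_mulT, value_mulT, value_denT, value_denT, value_posT, value_negT,
    map_add, map_mul, map_mul, map_succ, map_succ]

theorem val_qzero : val f (value ρ qzero) = 0 := by
  rw [qzero, val_ratT, sub_self, zero_div]

theorem val_qone : val f (value ρ qone) = 1 := by
  rw [qone, val_ratT, value_suc, value_zro, succ_zero, map_one, map_zero, sub_zero, zero_add,
    div_one]

theorem val_qhalf (n : Tm Δ Ty.nat) : val f (value ρ (qhalf n)) = half f (value ρ n) := by
  rw [qhalf, val_ratT, value_suc, value_zro, succ_zero, map_one, map_zero, sub_zero, value_predT,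
    value_powT, map_pred _ (pow2_pos _), one_div, half]

theorem val_qneg (q : Tm Δ Ty.nat) : val f (value ρ (qneg q)) = -val f (value ρ q) := by
  rw [qneg, val_ratT, value_negT, value_posT, value_sndT, val]
  ring

variable [LinearOrder K]

theorem map_nonneg (hf : StrictMono f) (n : 𝔐.Num) : 0 ≤ f n := by
  rw [← map_zero f]
  exact hf.monotone (num_zero_le n)

variable [IsStrictOrderedRing K]

theorem den_pos (hf : StrictMono f) (n : 𝔐.Num) : 0 < f n + 1 :=
  add_pos_of_nonneg_of_pos (map_nonneg hf n) one_pos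

theorem half_pos (hf : StrictMono f) (n : 𝔐.Num) : 0 < half f n := by
  rw [half, inv_pos, ← map_zero f]
  exact hf (pow2_pos n)

theorem map_sub_add_sub (hf : StrictMono f) (m n : 𝔐.Num) :
    f (m - n + (n - m)) = |f m - f n| := by
  rcases le_total m n with h | h
  · rw [sub_eq_zero_iff.2 h, zero_add, abs_of_nonpos (sub_nonpos.2 (hf.monotone h))]
    obtain ⟨k, rfl⟩ := h
    rw [add_sub_self, map_add]
    ring
  · rw [sub_eq_zero_iff.2 h, add_zero, abs_of_nonneg (sub_nonneg.2 (hf.monotone h))]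
    obtain ⟨k, rfl⟩ := h
    rw [add_sub_self, map_add]
    ring

theorem crossT_lt (hf : StrictMono f) (q r : Tm Δ Ty.nat) :
    value ρ (crossT q r) < value ρ (crossT r q) ↔ val f (value ρ q) < val f (value ρ r) := by
  rw [← hf.lt_iff_lt, map_crossT, map_crossT, val, val,
    div_lt_div_iff₀ (den_pos hf _) (den_pos hf _)]
  constructor <;> intro h <;> linarith

theorem crossT_le (hf : StrictMono f) (q r : Tm Δ Ty.nat) :
    value ρ (crossT q r) ≤ value ρ (crossT r q) ↔ val f (value ρ q) ≤ val f (value ρ r) := by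
  rw [← hf.le_iff_le, map_crossT, map_crossT, val, val,
    div_le_div_iff₀ (den_pos hf _) (den_pos hf _)]
  constructor <;> intro h <;> linarith

theorem value_qltT (hf : StrictMono f) (q r : Tm Δ Ty.nat) :
    value ρ (qltT q r) = 0 ↔ val f (value ρ q) < val f (value ρ r) := by
  rw [qltT, value_subT, value_suc, sub_eq_zero_iff, succ_le_iff, crossT_lt ρ hf]

theorem sat_qltF (hf : StrictMono f) (q r : Tm Δ Ty.nat) :
    Sat ρ (qltF q r) ↔ val f (value ρ q) < val f (value ρ r) := by
  rw [qltF, sat_eq, value_zro, value_qltT ρ hf]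

theorem sat_qleF (hf : StrictMono f) (q r : Tm Δ Ty.nat) :
    Sat ρ (qleF q r) ↔ val f (value ρ q) ≤ val f (value ρ r) := by
  rw [qleF, sat_eq, value_zro, value_subT, sub_eq_zero_iff, crossT_le ρ hf]

theorem val_qadd (hf : StrictMono f) (q r : Tm Δ Ty.nat) :
    val f (value ρ (qadd q r)) = val f (value ρ q) + val f (value ρ r) := by
  have hq := den_pos hf (snd (value ρ q))
  have hr := den_pos hf (snd (value ρ r))
  rw [qadd, val_ratT, value_predT, value_mulT, value_denT, value_denT,
    map_pred _ (num_mul_pos (succ_pos _) (succ_pos _)), val, val, div_add_div _ _ hq.ne' hr.ne']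
  simp only [value_addT, value_mulT, value_denT, value_posT, value_negT, map_add, map_mul, map_succ]
  congr 1
  ring

theorem val_qsub (hf : StrictMono f) (q r : Tm Δ Ty.nat) :
    val f (value ρ (qsub q r)) = val f (value ρ q) - val f (value ρ r) := by
  rw [qsub, val_qadd ρ hf, val_qneg, sub_eq_add_neg]

theorem val_qabs (hf : StrictMono f) (q : Tm Δ Ty.nat) :
    val f (value ρ (qabs q)) = |val f (value ρ q)| := by
  rw [qabs, val_ratT, value_addT, value_subT, value_subT, value_zro, map_zero, sub_zero, value_posT,
    value_negT, value_sndT, map_sub_add_sub hf, val, abs_div, abs_of_pos (den_pos hf _)]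

end Rationals

end Codes

/-! ### Real numbers in a model -/

theorem forall_num {P : 𝔐.Num → Prop} : (∀ n, P n) ↔ ∀ x, P (𝔐.num x) :=
  ⟨fun h x => h _, fun h n => by
    obtain ⟨x, rfl⟩ := exists_num n
    exact h x⟩

/-- Application of an object of type `1` to a number. -/
noncomputable def ap (a : 𝔐.M.D one) (n : 𝔐.Num) : 𝔐.Num := 𝔐.num (𝔐.M.app a n.out)

theorem ap_num (a : 𝔐.M.D one) (x : 𝔐.M.D Ty.nat) : ap a (𝔐.num x) = 𝔐.num (𝔐.M.app a x) :=
  num_app_congr a (num_out _)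

theorem value_app (ρ : Env 𝔐.M Δ) (t : Tm Δ one) (n : Tm Δ Ty.nat) :
    value ρ (Tm.app t n) = ap (t.eval ρ) (value ρ n) :=
  (ap_num _ _).symm

theorem ap_lam (ρ : Env 𝔐.M Δ) [Good 𝔐 ρ] (t : Tm (Ty.nat :: Δ) Ty.nat) (x : 𝔐.M.D Ty.nat) :
    ap (t.lam.eval ρ) (𝔐.num x) = value (x ▹ ρ) t := by
  rw [ap_num, num_lam]

section Congruence

variable {ρ : Env 𝔐.M Δ} [Good 𝔐 ρ] {ρ' : Env 𝔐.M Δ'} [Good 𝔐 ρ'] {q r : Tm Δ Ty.nat}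
  {q' r' : Tm Δ' Ty.nat}

theorem value_qltT_congr (hq : value ρ q = value ρ' q') (hr : value ρ r = value ρ' r') :
    value ρ (qltT q r) = value ρ' (qltT q' r') := by
  simp only [qltT, crossT, value_subT, value_suc, value_addT, value_mulT, value_posT, value_negT,
    value_denT, hq, hr]

theorem value_qsub_congr (hq : value ρ q = value ρ' q') (hr : value ρ r = value ρ' r') :
    value ρ (qsub q r) = value ρ' (qsub q' r') := by
  have h : value ρ (qneg r) = value ρ' (qneg r') := by
    simp only [qneg, ratT, pairT, value_addT, value_triT, value_posT, value_negT, value_sndT, hr]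
  simp only [qsub, qadd, ratT, pairT, value_addT, value_triT, value_mulT, value_predT, value_posT,
    value_negT, value_denT, hq, h]

theorem value_qabs_congr (hq : value ρ q = value ρ' q') :
    value ρ (qabs q) = value ρ' (qabs q') := by
  simp only [qabs, ratT, pairT, value_addT, value_triT, value_subT, value_posT, value_negT,
    value_sndT, value_zro, hq]

theorem value_qhalf_congr (hq : value ρ q = value ρ' q') :
    value ρ (qhalf q) = value ρ' (qhalf q') := by
  simp only [qhalf, ratT, pairT, value_addT, value_triT, value_suc, value_zro, value_predT,
    value_powT, hq]

end Congruence

/-- A term that is `0` exactly if `|t n - t (n + 1)| < 2 ^ (-n - 1)`. -/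
def gapT (t : Tm Δ one) (n : Tm Δ Ty.nat) : Tm Δ Ty.nat :=
  qltT (qabs (qsub (Tm.app t n) (Tm.app t (suc n)))) (qhalf (suc n))

theorem value_gapT_congr {ρ : Env 𝔐.M Δ} [Good 𝔐 ρ] {ρ' : Env 𝔐.M Δ'} [Good 𝔐 ρ'] {t : Tm Δ one}
    {t' : Tm Δ' one} {n : Tm Δ Ty.nat} {n' : Tm Δ' Ty.nat} (ht : t.eval ρ = t'.eval ρ')
    (hn : value ρ n = value ρ' n') : value ρ (gapT t n) = value ρ' (gapT t' n') := by
  have h : value ρ (suc n) = value ρ' (suc n') := by rw [value_suc, value_suc, hn]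
  have h' : ∀ {k k'}, value ρ k = value ρ' k' → value ρ (Tm.app t k) = value ρ' (Tm.app t' k') :=
    fun hk => by rw [value_app, value_app, ht, hk]
  exact value_qltT_congr (value_qabs_congr (value_qsub_congr (h' hn) (h' h))) (value_qhalf_congr h)

/-- A number that is `0` exactly if the first `n` steps of the sequence `a` are small enough for the
modulus `2 ^ (-n)`. -/
noncomputable def bad (a : 𝔐.M.D one) (n : 𝔐.Num) : 𝔐.Num :=
  value (n.out ▹ a ▹ 𝔐.base) (badT v1 v0)

theorem value_badT (ρ : Env 𝔐.M Δ) [Good 𝔐 ρ] (t : Tm Δ one) (n : Tm Δ Ty.nat) :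
    value ρ (badT t n) = bad (t.eval ρ) (value ρ n) := by
  refine natRec_congr rfl (fun x x' y y' hy hx => ?_) (num_out _).symm
  rw [value_addT, value_addT, value_v1, value_v1, hy]
  congr 1
  exact value_gapT_congr (t := t.wk.wk) (n := v0) (n' := v0)
    (by rw [Tm.eval_wk, Tm.eval_wk, Tm.eval_wk, Tm.eval_wk]; rfl) hx

/-- The sequence `a`, frozen just before its first step that is too large, so that it has the
modulus `2 ^ (-n)`. -/
noncomputable def hat (a : 𝔐.M.D one) (n : 𝔐.Num) : 𝔐.Num :=
  value (n.out ▹ a ▹ 𝔐.base) (hatT v1 v0)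

theorem value_hatT (ρ : Env 𝔐.M Δ) [Good 𝔐 ρ] (t : Tm Δ one) (n : Tm Δ Ty.nat) :
    value ρ (hatT t n) = hat (t.eval ρ) (value ρ n) := by
  refine natRec_congr ?_ (fun x x' y y' h h' => ?_) (num_out _).symm
  · rw [value_app, value_app]
    rfl
  · simp only [value_condT, value_badT, value_app, Tm.eval_wk, value_v1, value_v0, h, h']
    rfl

theorem bad_succ (a : 𝔐.M.D one) (x : 𝔐.M.D Ty.nat) :
    bad a (succ (𝔐.num x)) = bad a (𝔐.num x) + value (x ▹ a ▹ 𝔐.base) (gapT v1 v0) := by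
  have h := value_badT (x ▹ a ▹ 𝔐.base) v1 (suc v0)
  rw [value_suc] at h
  refine h.symm.trans ((natRec_suc _ _ _ _).trans ?_)
  rw [value_addT]
  refine congrArg₂ _ (value_badT (x ▹ a ▹ 𝔐.base) v1 v0) ?_
  exact value_gapT_congr (t := (v1 : Tm (Ty.nat :: one :: Γ) one).wk.wk) (n := v0) rfl rfl

theorem bad_zero (a : 𝔐.M.D one) : bad a 0 = 0 := by
  have h := value_badT (a ▹ 𝔐.base) v0 zro
  exact h.symm.trans (natRec_zro _ _ _)

theorem hat_zero (a : 𝔐.M.D one) : hat a 0 = ap a 0 := by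
  have h := value_hatT (a ▹ 𝔐.base) v0 zro
  exact h.symm.trans ((natRec_zro _ _ _).trans (value_app _ _ _))

theorem hat_succ (a : 𝔐.M.D one) (n : 𝔐.Num) :
    hat a (succ n) = cond (bad a (succ n)) (ap a (succ n)) (hat a n) := by
  obtain ⟨x, rfl⟩ := exists_num n
  have h := value_hatT (x ▹ a ▹ 𝔐.base) v1 (suc v0)
  rw [value_suc] at h
  refine h.symm.trans ((natRec_suc _ _ _ _).trans ?_)
  simp only [value_condT, value_badT, value_app, Tm.eval_wk, value_v1, value_v0]
  rw [← value_v0 (a ▹ 𝔐.base) x]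
  exact congrArg _ (value_hatT (x ▹ a ▹ 𝔐.base) v1 v0)

theorem succ_le_pow2 (n : 𝔐.Num) : succ n ≤ pow2 n := by
  refine num_induct 𝔐.base (Fm.eq (subT (suc v0) (powT v0)) zro) (P := fun n => succ n ≤ pow2 n)
    (fun x => ?_) (by rw [pow2_zero]) (fun n h => ?_) n
  · rw [sat_eq, value_subT, value_suc, value_powT, value_zro, sub_eq_zero_iff]
    rfl
  · rw [pow2_succ, succ_eq_add_one]
    exact add_le_add h (succ_zero (𝔐 := 𝔐) ▸ succ_le_iff.2 (pow2_pos n))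

section Reals

variable {K : Type*} [Field K] [LinearOrder K] [IsStrictOrderedRing K] {f : 𝔐.Num →+* K}

theorem value_gapT (hf : StrictMono f) (a : 𝔐.M.D one) (x : 𝔐.M.D Ty.nat) :
    value (x ▹ a ▹ 𝔐.base) (gapT v1 v0) = 0 ↔
      |val f (ap a (𝔐.num x)) - val f (ap a (succ (𝔐.num x)))| < half f (succ (𝔐.num x)) := by
  rw [gapT, value_qltT _ hf, val_qabs _ hf, val_qsub _ hf, val_qhalf, value_app, value_app,
    value_suc]
  rfl

theorem bad_succ_eq_zero (hf : StrictMono f) (a : 𝔐.M.D one) (n : 𝔐.Num) :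
    bad a (succ n) = 0 ↔
      bad a n = 0 ∧ |val f (ap a n) - val f (ap a (succ n))| < half f (succ n) := by
  obtain ⟨x, rfl⟩ := exists_num n
  rw [bad_succ, ← value_gapT hf]
  constructor
  · intro h
    have h' := eq_zero_of_add_eq_zero h
    rw [h', add_zero] at h
    exact ⟨h, h'⟩
  · rintro ⟨h₁, h₂⟩
    rw [h₁, h₂, add_zero]

theorem hat_of_bad_eq_zero {a : 𝔐.M.D one} {n : 𝔐.Num} (h : bad a n = 0) : hat a n = ap a n := by
  rcases zero_or_succ n with rfl | ⟨k, rfl⟩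
  · exact hat_zero a
  · rw [hat_succ, h, cond_zero]

/-- The rational approximations of a real number. -/
noncomputable def appr (f : 𝔐.Num →+* K) (a : 𝔐.M.D one) (n : 𝔐.Num) : K := val f (hat a n)

theorem appr_step (hf : StrictMono f) (a : 𝔐.M.D one) (n : 𝔐.Num) :
    |appr f a n - appr f a (succ n)| < half f (succ n) := by
  by_cases h : bad a (succ n) = 0
  · have h' := (bad_succ_eq_zero hf a n).1 h
    rw [appr, appr, hat_of_bad_eq_zero h, hat_of_bad_eq_zero h'.1]
    exact h'.2
  · obtain ⟨k, hk⟩ := (zero_or_succ _).resolve_left h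
    rw [appr, appr, hat_succ, hk, cond_succ, sub_self, abs_zero]
    exact half_pos hf _

theorem appr_dist (hf : StrictMono f) (a : 𝔐.M.D one) (n d : 𝔐.Num) :
    |appr f a n - appr f a (n + d)| ≤ half f n - half f (n + d) := by
  obtain ⟨x, rfl⟩ := exists_num n
  refine num_induct (x ▹ a ▹ 𝔐.base)
    (qleF (qabs (qsub (hatT v2 v1) (hatT v2 (addT v1 v0)))) (qsub (qhalf v1) (qhalf (addT v1 v0))))
    (P := fun d => |appr f a (𝔐.num x) - appr f a (𝔐.num x + d)| ≤
      half f (𝔐.num x) - half f (𝔐.num x + d)) (fun y => ?_) ?_ (fun d ih => ?_) d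
  · rw [sat_qleF _ hf, val_qabs _ hf, val_qsub _ hf, val_qsub _ hf, val_qhalf, val_qhalf,
      value_hatT, value_hatT, value_addT]
    rfl
  · rw [add_zero, sub_self, sub_self, abs_zero]
  · rw [add_succ]
    have h₁ := appr_step hf a (𝔐.num x + d)
    have h₂ := half_succ (f := f) (𝔐.num x + d)
    have h₃ := abs_sub_le (appr f a (𝔐.num x)) (appr f a (𝔐.num x + d))
      (appr f a (succ (𝔐.num x + d)))
    linarith

theorem appr_of_val_ap (hf : StrictMono f) {a : 𝔐.M.D one} {u : 𝔐.Num → K}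
    (hu : ∀ n, val f (ap a n) = u n) (h : ∀ n, |u n - u (succ n)| < half f (succ n)) (n : 𝔐.Num) :
    appr f a n = u n := by
  have hb : bad a n = 0 := by
    refine num_induct (a ▹ 𝔐.base) (Fm.eq (badT v1 v0) zro) (P := fun n => bad a n = 0)
      (fun y => ?_) (bad_zero a)
      (fun n ih => (bad_succ_eq_zero hf a n).2 ⟨ih, by rw [hu, hu]; exact h n⟩) n
    rw [sat_eq, value_badT, value_zro]
    rfl
  rw [appr, hat_of_bad_eq_zero hb, hu]

variable (ρ : Env 𝔐.M Δ) [Good 𝔐 ρ]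

theorem appr_rrat (hf : StrictMono f) (q : Tm Δ Ty.nat) (n : 𝔐.Num) :
    appr f ((rrat q).eval ρ) n = val f (value ρ q) := by
  refine appr_of_val_ap hf (u := fun _ => val f (value ρ q)) (forall_num.2 fun x => ?_)
    (fun n => ?_) n
  · rw [rrat, ap_lam, value_wk]
  · rw [sub_self, abs_zero]
    exact half_pos hf _

theorem appr_rone (hf : StrictMono f) (n : 𝔐.Num) : appr f (rone.eval ρ) n = 1 := by
  rw [rone, appr_rrat ρ hf, val_qone]

theorem appr_radd (hf : StrictMono f) (s t : Tm Δ one) (n : 𝔐.Num) :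
    appr f ((radd s t).eval ρ) n = appr f (s.eval ρ) (succ n) + appr f (t.eval ρ) (succ n) := by
  refine appr_of_val_ap hf (u := fun n => appr f (s.eval ρ) (succ n) + appr f (t.eval ρ) (succ n))
    (forall_num.2 fun x => ?_) (fun n => ?_) n
  · rw [radd, ap_lam, val_qadd _ hf, value_hatT, value_hatT, value_suc, Tm.eval_wk, Tm.eval_wk]
    rfl
  · have hs := abs_lt.1 (appr_step hf (s.eval ρ) (succ n))
    have ht := abs_lt.1 (appr_step hf (t.eval ρ) (succ n))
    rw [half_succ] at hs ht
    rw [abs_lt]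
    constructor <;> linarith

theorem appr_rsub (hf : StrictMono f) (s t : Tm Δ one) (n : 𝔐.Num) :
    appr f ((rsub s t).eval ρ) n = appr f (s.eval ρ) (succ n) - appr f (t.eval ρ) (succ n) := by
  refine appr_of_val_ap hf (u := fun n => appr f (s.eval ρ) (succ n) - appr f (t.eval ρ) (succ n))
    (forall_num.2 fun x => ?_) (fun n => ?_) n
  · rw [rsub, ap_lam, val_qsub _ hf, value_hatT, value_hatT, value_suc, Tm.eval_wk, Tm.eval_wk]
    rfl
  · have hs := abs_lt.1 (appr_step hf (s.eval ρ) (succ n))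
    have ht := abs_lt.1 (appr_step hf (t.eval ρ) (succ n))
    rw [half_succ] at hs ht
    rw [abs_lt]
    constructor <;> linarith

/-- The inequality `a ≤ b` between real numbers. -/
def RLe (f : 𝔐.Num →+* K) (a b : 𝔐.M.D one) : Prop :=
  ∀ n, appr f a (succ n) - appr f b (succ n) < half f n

/-- The strict inequality `a < b` between real numbers. -/
def RLt (f : 𝔐.Num →+* K) (a b : 𝔐.M.D one) : Prop :=
  ∃ n, half f n ≤ appr f b (succ n) - appr f a (succ n)

theorem sat_rleF (hf : StrictMono f) (s t : Tm Δ one) :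
    Sat ρ (rleF s t) ↔ RLe f (s.eval ρ) (t.eval ρ) := by
  rw [RLe, forall_num]
  refine forall_congr' fun x => ?_
  rw [sat_qltF _ hf, val_qsub _ hf, val_qhalf, value_hatT, value_hatT, value_suc, Tm.eval_wk,
    Tm.eval_wk]
  rfl

theorem sat_rltF (hf : StrictMono f) (s t : Tm Δ one) :
    Sat ρ (rltF s t) ↔ RLt f (s.eval ρ) (t.eval ρ) := by
  rw [RLt, ← not_iff_not, not_exists, forall_num, rltF, Sat, not_exists]
  refine forall_congr' fun x => ?_
  rw [sat_qleF _ hf, val_qsub _ hf, val_qhalf, value_hatT, value_hatT, value_suc, Tm.eval_wk,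
    Tm.eval_wk]
  rfl

theorem gap_pos_of_half_le (hf : StrictMono f) {a b : 𝔐.M.D one} {k : 𝔐.Num}
    (hk : half f k ≤ appr f b (succ k) - appr f a (succ k)) :
    0 < appr f b (succ (succ k)) - appr f a (succ (succ k)) - half f (succ k) := by
  have ha := abs_lt.1 (appr_step hf a (succ k))
  have hb := abs_lt.1 (appr_step hf b (succ k))
  have h₁ := half_succ (f := f) k
  have h₂ := half_succ (f := f) (succ k)
  linarith

theorem RLe_of_gap (hf : StrictMono f) {a b c : 𝔐.M.D one} {k : 𝔐.Num}
    (hc : ∀ n, appr f c n = appr f b (succ n) -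
      (appr f b (succ (succ k)) - appr f a (succ (succ k)) - half f (succ k))) : RLe f a c := by
  intro n
  rw [hc]
  have h₁ := half_succ (f := f) k
  have h₂ := half_succ (f := f) (succ k)
  have h₃ := half_succ (f := f) n
  have h₄ := half_succ (f := f) (succ n)
  have hn₀ := half_pos hf n
  have hk₀ := half_pos hf k
  rcases le_or_gt n k with hn | hn
  · obtain ⟨d, hd⟩ := hn
    have ha := abs_le.1 (appr_dist hf a (succ n) (succ d))
    have hb := abs_le.1 (appr_dist hf b (succ (succ n)) d)
    rw [add_succ, succ_add, ← hd] at ha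
    rw [succ_add, succ_add, ← hd] at hb
    linarith
  · obtain ⟨d, hd⟩ := succ_le_iff.2 hn
    have ha := abs_le.1 (appr_dist hf a (succ (succ k)) d)
    have hb := abs_le.1 (appr_dist hf b (succ (succ k)) (succ d))
    rw [succ_add, ← hd] at ha
    rw [add_succ, succ_add, ← hd] at hb
    linarith

theorem exists_pos_of_RLt (hf : StrictMono f) {a b : 𝔐.M.D one} (h : RLt f a b) :
    ∃ m : 𝔐.M.D Ty.nat, 0 < val f (𝔐.num m) ∧ ∀ c : 𝔐.M.D one,
      (∀ n, appr f c n = appr f b (succ n) - val f (𝔐.num m)) → RLe f a c := by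
  obtain ⟨k, hk⟩ := h
  obtain ⟨x, rfl⟩ := exists_num k
  let E := x ▹ b ▹ a ▹ 𝔐.base
  let q : Tm (Ty.nat :: one :: one :: Γ) Ty.nat :=
    qsub (qsub (hatT v1 (suc (suc v0))) (hatT v2 (suc (suc v0)))) (qhalf (suc v0))
  have hq : val f (𝔐.num (q.eval E)) = appr f b (succ (succ (𝔐.num x))) -
      appr f a (succ (succ (𝔐.num x))) - half f (succ (𝔐.num x)) := by
    change val f (value E q) = _
    rw [val_qsub _ hf, val_qsub _ hf, val_qhalf, value_hatT, value_hatT, value_suc, value_suc]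
    rfl
  refine ⟨q.eval E, ?_, fun c hc => RLe_of_gap hf (b := b) (k := 𝔐.num x) fun n => ?_⟩
  · rw [hq]
    exact gap_pos_of_half_le hf hk
  · rw [hc, hq]

theorem half_le_of_pos (hf : StrictMono f) {q : 𝔐.Num} (hq : 0 < val f q) :
    half f (snd q) ≤ val f q := by
  have hd := den_pos hf (snd q)
  have h₁ : f (snd (fst q)) < f (fst (fst q)) := by
    rw [val, div_pos_iff_of_pos_right hd] at hq
    exact sub_pos.1 hq
  have h₂ := hf.monotone (succ_le_iff.2 (hf.lt_iff_lt.1 h₁))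
  have h₃ := hf.monotone (succ_le_pow2 (snd q))
  rw [map_succ] at h₂ h₃
  calc half f (snd q) ≤ (f (snd q) + 1)⁻¹ := inv_anti₀ hd h₃
    _ = 1 / (f (snd q) + 1) := (one_div _).symm
    _ ≤ val f q := div_le_div_of_nonneg_right (by linarith) hd.le

theorem RLt_of_RLe (hf : StrictMono f) {a b c : 𝔐.M.D one} {q : 𝔐.Num} (hq : 0 < val f q)
    (hc : ∀ n, appr f c n = appr f b (succ n) - val f q) (h : RLe f a c) : RLt f a b := by
  refine ⟨succ (succ (snd q)), ?_⟩
  have h₀ := half_le_of_pos hf hq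
  have h₁ := half_succ (f := f) (snd q)
  have h₂ := half_succ (f := f) (succ (snd q))
  have h₃ := half_succ (f := f) (succ (succ (snd q)))
  have h₄ := half_succ (f := f) (succ (succ (succ (snd q))))
  have h₆ := h (succ (succ (snd q)))
  rw [hc] at h₆
  have h₇ := abs_lt.1 (appr_step hf b (succ (succ (succ (snd q)))))
  linarith

end Reals

end TModel

theorem Env.eq_cons_cons {M : Model} {σ τ : Ty} {Δ : List Ty} {E : Env M (σ :: τ :: Δ)} {a : M.D σ}
    {b : M.D τ} {ρ : Env M Δ} (h₀ : E σ Var.z = a) (h₁ : E τ (Var.s Var.z) = b)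
    (h₂ : ∀ υ v, E υ (Var.s (Var.s v)) = ρ υ v) : E = a ▹ b ▹ ρ := by
  funext υ v
  match v with
  | Var.z => exact h₀
  | Var.s Var.z => exact h₁
  | Var.s (Var.s v) => exact h₂ υ v

theorem Fm.QF.subst {Δ : List Ty} {φ : Fm Δ} (h : φ.QF) {Δ' : List Ty} (s : Sub Δ Δ') :
    (φ.subst s).QF := by
  induction φ generalizing Δ' with
  | eq t u => trivial
  | all | ex => exact h
  | _ φ ψ h₁ h₂ => exact ⟨h₁ h.1 s, h₂ h.2 s⟩

theorem Fm.QF.dual {Δ : List Ty} {φ : Fm Δ} (h : φ.QF) : φ.dual.QF := by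
  induction φ with
  | eq t u => exact ⟨trivial, trivial⟩
  | all | ex => exact h
  | imp φ ψ _ h₂ => exact ⟨h.1, h₂ h.2⟩
  | _ φ ψ h₁ h₂ => exact ⟨h₁ h.1, h₂ h.2⟩

theorem IsExists.subst {Δ : List Ty} {φ : Fm Δ} (h : IsExists φ) {Δ' : List Ty} (s : Sub Δ Δ') :
    IsExists (φ.subst s) := by
  induction h generalizing Δ' with
  | qf h => exact .qf (h.subst s)
  | ex hσ _ ih => exact .ex hσ (ih _)

theorem IsForall.dual {Δ : List Ty} {φ : Fm Δ} (h : IsForall φ) : IsExists φ.dual := by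
  induction h with
  | qf h => exact .qf h.dual
  | all hσ _ ih => exact .ex hσ ih

/-- Equivalence to an `∃`-formula in a model. -/
def IsE (M : Model) {Δ : List Ty} (φ : Fm Δ) : Prop :=
  ∃ ψ : Fm Δ, IsExists ψ ∧ ∀ ρ : Env M Δ, Sat ρ ψ ↔ Sat ρ φ

section Model

variable {M : Model} {Δ : List Ty} {φ ψ : Fm Δ}

theorem IsExists.isE (h : IsExists φ) : IsE M φ := ⟨φ, h, fun _ => Iff.rfl⟩

theorem IsE.congr (h : IsE M φ) (h' : ∀ ρ : Env M Δ, Sat ρ φ ↔ Sat ρ ψ) : IsE M ψ :=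
  let ⟨χ, h₁, h₂⟩ := h
  ⟨χ, h₁, fun ρ => (h₂ ρ).trans (h' ρ)⟩

theorem IsE.ex {σ : Ty} {φ : Fm (σ :: Δ)} (hσ : IsAdmissible σ) (h : IsE M φ) :
    IsE M (Fm.ex σ φ) :=
  let ⟨χ, h₁, h₂⟩ := h
  ⟨Fm.ex σ χ, .ex hσ h₁, fun _ => exists_congr fun _ => h₂ _⟩

theorem sat_ex_or (ρ : Env M Δ) {σ : Ty} (φ : Fm (σ :: Δ)) (ψ : Fm Δ) :
    Sat ρ (Fm.ex σ (Fm.or φ ψ.wk)) ↔ Sat ρ (Fm.or (Fm.ex σ φ) ψ) := by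
  have : Nonempty (M.D σ) := ⟨(Tm.inhabitant σ).eval ρ⟩
  simp only [Sat, sat_wk, exists_or, exists_const]

theorem isE_qf_or (hφ : φ.QF) (hψ : IsExists ψ) : IsE M (Fm.or φ ψ) := by
  induction hψ with
  | qf h => exact IsExists.isE (.qf ⟨hφ, h⟩)
  | ex hσ _ ih =>
      refine (IsE.ex hσ (ih (hφ.subst fun _ v => Tm.var (Var.s v)))).congr fun ρ => ?_
      rw [Sat, or_comm, ← Sat, ← sat_ex_or]
      exact exists_congr fun _ => or_comm

theorem isE_or (hφ : IsExists φ) (hψ : IsExists ψ) : IsE M (Fm.or φ ψ) := by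
  induction hφ with
  | qf h => exact isE_qf_or h hψ
  | ex hσ _ ih => exact (IsE.ex hσ (ih (hψ.subst _))).congr fun ρ => sat_ex_or ρ _ _

theorem IsE.or (hφ : IsE M φ) (hψ : IsE M ψ) : IsE M (Fm.or φ ψ) :=
  let ⟨_, h₁, h₂⟩ := hφ
  let ⟨_, h₁', h₂'⟩ := hψ
  (isE_or h₁ h₁').congr fun ρ => or_congr (h₂ ρ) (h₂' ρ)

theorem isE_qf_and (hφ : φ.QF) (hψ : IsExists ψ) : IsE M (Fm.and φ ψ) := by
  induction hψ with
  | qf h => exact IsExists.isE (.qf ⟨hφ, h⟩)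
  | ex hσ _ ih =>
      refine (IsE.ex hσ (ih (hφ.subst fun _ v => Tm.var (Var.s v)))).congr fun ρ => ?_
      simp only [Sat, ← exists_and_left]
      exact exists_congr fun _ => and_congr_left' (sat_wk _ _ _)

end Model

theorem sat_dual_of_zero_ne_one {M : Model}
    (hM : ¬ M.eq (M.con Con.zero) (M.app (M.con Con.succ) (M.con Con.zero))) {Δ : List Ty}
    (ρ : Env M Δ) (φ : Fm Δ) : Sat ρ φ.dual ↔ ¬ Sat ρ φ := by
  induction φ with
  | eq t u => exact ⟨fun h h' => hM (h h'), fun h h' => (h h').elim⟩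
  | and φ ψ h₁ h₂ => rw [Fm.dual, Sat, Sat, h₁, h₂, not_and_or]
  | or φ ψ h₁ h₂ => rw [Fm.dual, Sat, Sat, h₁, h₂, not_or]
  | imp φ ψ _ h₂ => rw [Fm.dual, Sat, Sat, h₂, Classical.not_imp]
  | all σ φ ih => simp only [Fm.dual, Sat, ih, not_forall]
  | ex σ φ ih => simp only [Fm.dual, Sat, ih, not_exists]

namespace TModel

variable {Γ Δ : List Ty} {𝔐 : TModel Γ}

theorem sat_dual (ρ : Env 𝔐.M Δ) (φ : Fm Δ) : Sat ρ φ.dual ↔ ¬ Sat ρ φ :=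
  sat_dual_of_zero_ne_one 𝔐.zero_ne_one ρ φ

theorem isE_imp {φ ψ : Fm Δ} (hφ : IsForall φ) (hψ : IsE 𝔐.M ψ) : IsE 𝔐.M (Fm.imp φ ψ) :=
  (hφ.dual.isE.or hψ).congr fun ρ => by rw [Sat, Sat, sat_dual, imp_iff_not_or]

/-! ### Uniform boundedness and probabilistic statements in a model -/

/-- The inequality in a type. -/
def LeM {σ : Ty} (a b : 𝔐.M.D σ) : Prop := Sat (b ▹ a ▹ 𝔐.base) (leF σ v1 v0)

theorem sat_leF_congr : ∀ {σ : Ty} {Ξ Ξ' : List Ty} {η : Env 𝔐.M Ξ} [Good 𝔐 η] {η' : Env 𝔐.M Ξ'}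
    [Good 𝔐 η'] {s t : Tm Ξ σ} {s' t' : Tm Ξ' σ}, s.eval η = s'.eval η' → t.eval η = t'.eval η' →
    (Sat η (leF σ s t) ↔ Sat η' (leF σ s' t'))
  | Ty.nat, _, _, _, _, _, _, _, _, _, _, hs, ht => by
      rw [leF, leF, sat_eq, sat_eq, value_subT, value_subT, value, value, hs, ht]
      rfl
  | Ty.Om, _, _, _, _, _, _, _, _, _, _, _, _ => by
      obtain ⟨K, _, _, _, f, hf⟩ := exists_ordered_field 𝔐.Num
      rw [leF, leF, sat_rleF _ hf, sat_rleF _ hf]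
      rfl
  | Ty.Ev, _, _, _, _, _, _, _, _, _, _, hs, ht => by
      obtain ⟨K, _, _, _, f, hf⟩ := exists_ordered_field 𝔐.Num
      rw [leF, leF, sat_rleF _ hf, sat_rleF _ hf]
      simp only [probT, Tm.eval, hs, ht]
  | Ty.fn _ _, _, _, _, _, _, _, _, _, _, _, hs, ht => by
      refine forall_congr' fun d => sat_leF_congr ?_ ?_
      · simp only [Tm.eval, Tm.eval_wk, hs]
        rfl
      · simp only [Tm.eval, Tm.eval_wk, ht]
        rfl

theorem sat_leF {σ : Ty} (ρ : Env 𝔐.M Δ) [Good 𝔐 ρ] (s t : Tm Δ σ) :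
    Sat ρ (leF σ s t) ↔ LeM (s.eval ρ) (t.eval ρ) :=
  sat_leF_congr rfl rfl

theorem exists_bound {B τ : Ty} (hUB : ∀ Ξ φ, UB B τ Ξ φ → 𝔐.T Ξ φ)
    (ρ : Env 𝔐.M Δ) [Good 𝔐 ρ] {θ : Fm (τ :: B :: Δ)} (hθ : IsE 𝔐.M θ)
    (h : ∀ b, ∃ x, Sat (x ▹ b ▹ ρ) θ) : ∃ X, ∀ b, ∃ x, LeM x X ∧ Sat (x ▹ b ▹ ρ) θ := by
  obtain ⟨ψ, hψ, hψθ⟩ := hθ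
  let s : Sub (τ :: B :: Δ) (τ :: B :: Ty.nat :: Ty.nat :: one :: Δ) :=
    Sub.lift (Sub.lift (fun _ v => Tm.var (Var.s (Var.s (Var.s v)))) B) τ
  have sat_iff {E : Env 𝔐.M (τ :: B :: Δ)} {x : 𝔐.M.D τ} {b : 𝔐.M.D B} (h₀ : E τ Var.z = x)
      (h₁ : E B (Var.s Var.z) = b) (h₂ : ∀ σ v, E σ (Var.s (Var.s v)) = ρ σ v) :
      Sat E ψ ↔ Sat (x ▹ b ▹ ρ) θ := by
    rw [← hψθ, Env.eq_cons_cons h₀ h₁ h₂]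
  have hU : Sat ρ (unifBound τ [] [B] (ψ.subst s)) :=
    𝔐.sat_of_proves ρ (.ax (hUB _ _ (.inst [] [[]] _ (hψ.subst s))))
  obtain ⟨χ, hχ⟩ := hU ((Tm.inhabitant one).eval ρ) fun k x b => by
    obtain ⟨w, hw⟩ := h b
    refine ⟨w, ?_⟩
    rw [sat_subst, sat_subst]
    exact (sat_iff rfl rfl fun _ _ => rfl).2 hw
  refine ⟨𝔐.M.app χ (𝔐.M.con Con.zero), fun b => ?_⟩
  obtain ⟨w, hw, hw'⟩ := hχ (𝔐.M.con Con.zero) (𝔐.M.con Con.zero) b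
  rw [sat_subst, sat_subst] at hw'
  exact ⟨w, (sat_leF _ _ _).1 hw, (sat_iff rfl rfl fun _ _ => rfl).1 hw'⟩

variable {τ : Ty}

/-- The probability of an event, a real number in the model. -/
def pr (A : 𝔐.M.D Ty.Ev) : 𝔐.M.D one := 𝔐.M.app (𝔐.M.con Con.prob) A

/-- `ϖ` is in the complement of `A`. -/
def InCompl (ϖ : 𝔐.M.D Ty.Om) (A : 𝔐.M.D Ty.Ev) : Prop :=
  Sat (ϖ ▹ A ▹ 𝔐.base) (memF v0 (compT v1))

/-- The formula `φ(x, ϖ)` is monotone in `x` in the model. -/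
def IsMono (𝔐 : TModel Γ) (φ : Fm (Ty.Om :: τ :: Γ)) : Prop :=
  ∀ (ϖ : 𝔐.M.D Ty.Om) (x y : 𝔐.M.D τ), LeM x y → Sat (ϖ ▹ x ▹ 𝔐.base) φ →
    Sat (ϖ ▹ y ▹ 𝔐.base) φ

theorem sat_at (ρ : Env 𝔐.M Δ) (φ : Fm (Ty.Om :: τ :: Γ)) (ϖ : Tm Δ Ty.Om) (x : Tm Δ τ)
    (s : Sub Γ Δ) : Sat ρ (φ.at ϖ x s) ↔ Sat (ϖ.eval ρ ▹ x.eval ρ ▹ s.eval ρ) φ := by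
  rw [Fm.at, sat_subst, Sub.eval_cons, Sub.eval_cons]

theorem exists_forall_of_forall_exists (hUB : ∀ Ξ φ, UB Ty.Om τ Ξ φ → 𝔐.T Ξ φ)
    {θ : Fm (Ty.Om :: τ :: Γ)} (hθ : IsExists θ) (hm : IsMono 𝔐 θ) (A : 𝔐.M.D Ty.Ev)
    (h : ∀ x, ∃ ϖ, InCompl ϖ A ∧ ¬ Sat (ϖ ▹ x ▹ 𝔐.base) θ) :
    ∃ ϖ, InCompl ϖ A ∧ ∀ x, ¬ Sat (ϖ ▹ x ▹ 𝔐.base) θ := by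
  let Θ : Fm (τ :: Ty.Om :: Ty.Ev :: Γ) := Fm.imp (memF v1 (compT v2))
    (θ.at v1 v0 fun _ v => Tm.var (Var.s (Var.s (Var.s v))))
  have hΘ : ∀ x ϖ, Sat (x ▹ ϖ ▹ A ▹ 𝔐.base) Θ ↔
      (InCompl ϖ A → Sat (ϖ ▹ x ▹ 𝔐.base) θ) := fun x ϖ => imp_congr Iff.rfl (sat_at _ _ _ _ _)
  by_contra! hn
  obtain ⟨X, hX⟩ := exists_bound hUB (A ▹ 𝔐.base) (θ := Θ)
    (isE_imp (.qf trivial) (hθ.subst _).isE) fun ϖ => by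
      by_cases hϖ : InCompl ϖ A
      · obtain ⟨x, hx⟩ := hn ϖ hϖ
        exact ⟨x, (hΘ _ _).2 fun _ => hx⟩
      · exact ⟨(Tm.inhabitant τ).eval 𝔐.base, (hΘ _ _).2 fun h => (hϖ h).elim⟩
  obtain ⟨ϖ, hϖ, hX'⟩ := h X
  obtain ⟨x, hx, hx'⟩ := hX ϖ
  exact hX' (hm ϖ x X hx ((hΘ _ _).1 hx' hϖ))

section Reals

variable {K : Type*} [Field K] [LinearOrder K] {f : 𝔐.Num →+* K}

theorem RLe_congr {a c c' : 𝔐.M.D one} (h : ∀ n, appr f c n = appr f c' n) :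
    RLe f a c ↔ RLe f a c' := by
  simp only [RLe, h]

variable [IsStrictOrderedRing K]

theorem forall_pos_exists_iff (hf : StrictMono f) (hUB : ∀ Ξ φ, UB Ty.Ev τ Ξ φ → 𝔐.T Ξ φ)
    {ψ : Fm (Ty.Om :: τ :: Γ)} (hψ : IsExists ψ) (hm : IsMono 𝔐 ψ) (r : 𝔐.M.D one)
    (t : Tm (Ty.nat :: Γ) one)
    (ht : ∀ m n, appr f (t.eval (m ▹ 𝔐.base)) n = appr f r (succ n) - val f (𝔐.num m)) :
    (∀ m, 0 < val f (𝔐.num m) → ∃ x, ∀ A, RLe f (pr A) (t.eval (m ▹ 𝔐.base)) →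
      ∃ ϖ, InCompl ϖ A ∧ Sat (ϖ ▹ x ▹ 𝔐.base) ψ) ↔
    ∀ A, RLt f (pr A) r → ∃ ϖ, InCompl ϖ A ∧ ∃ x, Sat (ϖ ▹ x ▹ 𝔐.base) ψ := by
  constructor
  · intro h A hA
    obtain ⟨m, hm, hc⟩ := exists_pos_of_RLt hf hA
    obtain ⟨x, hx⟩ := h m hm
    obtain ⟨ϖ, hϖ, h'⟩ := hx A (hc _ (ht m))
    exact ⟨ϖ, hϖ, x, h'⟩
  · intro h m hm₀
    let Θ : Fm (τ :: Ty.Ev :: Ty.nat :: Γ) := Fm.imp (rleF (probT v1) t.wk.wk)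
      (Fm.ex Ty.Om (Fm.and (memF v0 (compT v2))
        (ψ.at v0 v1 fun _ v => Tm.var (Var.s (Var.s (Var.s (Var.s v)))))))
    have hΘ : ∀ x A, Sat (x ▹ A ▹ m ▹ 𝔐.base) Θ ↔ (RLe f (pr A) (t.eval (m ▹ 𝔐.base)) →
        ∃ ϖ, InCompl ϖ A ∧ Sat (ϖ ▹ x ▹ 𝔐.base) ψ) := fun x A => by
      refine imp_congr ?_ (exists_congr fun ϖ => and_congr Iff.rfl (sat_at _ _ _ _ _))
      rw [sat_rleF _ hf, Tm.eval_wk, Tm.eval_wk]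
      rfl
    obtain ⟨X, hX⟩ := exists_bound hUB (m ▹ 𝔐.base) (θ := Θ)
      (isE_imp (.all (.ground .nat) (.qf trivial))
        (.ex (.ground .om) (isE_qf_and trivial (hψ.subst _)))) fun A => by
        by_cases hA : RLe f (pr A) (t.eval (m ▹ 𝔐.base))
        · obtain ⟨ϖ, hϖ, x, hx⟩ := h A (RLt_of_RLe hf hm₀ (ht m) hA)
          exact ⟨x, (hΘ _ _).2 fun _ => ⟨ϖ, hϖ, hx⟩⟩
        · exact ⟨(Tm.inhabitant τ).eval 𝔐.base, (hΘ _ _).2 fun h => (hA h).elim⟩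
    refine ⟨X, fun A hA => ?_⟩
    obtain ⟨x, hx, hx'⟩ := hX A
    obtain ⟨ϖ, hϖ, hϖ'⟩ := (hΘ _ _).1 hx' hA
    exact ⟨ϖ, hϖ, hm ϖ x X hx hϖ'⟩

theorem sat_probGe (hf : StrictMono f) (ρ : Env 𝔐.M Δ) [Good 𝔐 ρ] (φ : Fm (Ty.Om :: Δ))
    (l : Tm Δ one) : Sat ρ (probGe φ l) ↔
      ∀ A, RLt f (pr A) (l.eval ρ) → ∃ ϖ, InCompl ϖ A ∧ Sat (ϖ ▹ ρ) φ := by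
  refine forall_congr' fun A => imp_congr ?_ (exists_congr fun ϖ => and_congr Iff.rfl ?_)
  · rw [sat_rltF _ hf, Tm.eval_wk]
    rfl
  · rw [Fm.wkBelow, sat_subst, Sub.eval_lift]
    rfl

theorem sat_probGt (hf : StrictMono f) (ρ : Env 𝔐.M Δ) [Good 𝔐 ρ] (φ : Fm (Ty.Om :: Δ))
    (l : Tm Δ one) : Sat ρ (probGt φ l) ↔
      ∀ A, RLe f (pr A) (l.eval ρ) → ∃ ϖ, InCompl ϖ A ∧ Sat (ϖ ▹ ρ) φ := by
  refine forall_congr' fun A => imp_congr ?_ (exists_congr fun ϖ => and_congr Iff.rfl ?_)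
  · rw [sat_rleF _ hf, Tm.eval_wk]
    rfl
  · rw [Fm.wkBelow, sat_subst, Sub.eval_lift]
    rfl

theorem sat_allRatPos (hf : StrictMono f) (ρ : Env 𝔐.M Δ) [Good 𝔐 ρ] (φ : Fm (Ty.nat :: Δ)) :
    Sat ρ (allRatPos φ) ↔ ∀ m, 0 < val f (𝔐.num m) → Sat (m ▹ ρ) φ := by
  refine forall_congr' fun m => imp_congr ?_ Iff.rfl
  rw [sat_qltF _ hf, val_qzero]
  rfl

end Reals

theorem sat_swap (ρ : Env 𝔐.M Δ) {σ : Ty} (φ : Fm (σ :: τ :: Δ)) (x : 𝔐.M.D τ) (y : 𝔐.M.D σ) :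
    Sat (x ▹ y ▹ ρ) φ.swap ↔ Sat (y ▹ x ▹ ρ) φ := by
  rw [Fm.swap, sat_subst, Sub.eval_cons, Sub.eval_cons]
  rfl

theorem sat_wkBelow2 (ρ : Env 𝔐.M Δ) {σ υ : Ty} (φ : Fm (σ :: τ :: Δ)) (x : 𝔐.M.D τ)
    (y : 𝔐.M.D σ) (z : 𝔐.M.D υ) : Sat (y ▹ x ▹ z ▹ ρ) φ.wkBelow2 ↔ Sat (y ▹ x ▹ ρ) φ := by
  rw [Fm.wkBelow2, sat_subst, Sub.eval_lift, Sub.eval_lift]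
  rfl

theorem sat_iff (ρ : Env 𝔐.M Δ) (φ ψ : Fm Δ) : Sat ρ (Fm.iff φ ψ) ↔ (Sat ρ φ ↔ Sat ρ ψ) :=
  iff_iff_implies_and_implies.symm

theorem isMono_of_sat_mono {φ : Fm (Ty.Om :: τ :: Γ)} (h : Sat 𝔐.base (mono φ)) :
    IsMono 𝔐 φ := by
  intro ϖ x y hxy hx
  refine (sat_at _ _ _ _ _).1 (h ϖ x y ⟨?_, (sat_at _ _ _ _ _).2 hx⟩)
  rw [sat_leF]
  exact hxy

theorem isMono_dual_of_sat_antiMono {φ : Fm (Ty.Om :: τ :: Γ)}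
    (h : Sat 𝔐.base (antiMono φ)) : IsMono 𝔐 φ.dual := by
  intro ϖ x y hxy hx
  rw [sat_dual] at hx ⊢
  refine fun hy => hx ((sat_at _ _ _ _ _).1 (h ϖ x y ⟨?_, (sat_at _ _ _ _ _).2 hy⟩))
  rw [sat_leF]
  exact hxy

section Interchange

variable {K : Type*} [Field K] [LinearOrder K] [IsStrictOrderedRing K] {f : 𝔐.Num →+* K}
  {φ : Fm (Ty.Om :: τ :: Γ)} (l : Tm Γ one)

theorem sat_probGe_all (hf : StrictMono f) (hUB : ∀ Ξ χ, UB Ty.Om τ Ξ χ → 𝔐.T Ξ χ)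
    (hφ : IsForall φ) (hm : Sat 𝔐.base (antiMono φ)) :
    Sat 𝔐.base (probGe (Fm.all τ φ.swap) l) ↔ Sat 𝔐.base (Fm.all τ (probGe φ l.wk)) := by
  have h := exists_forall_of_forall_exists hUB hφ.dual (isMono_dual_of_sat_antiMono hm)
  simp only [sat_dual, not_not] at h
  simp only [sat_probGe hf, Sat, sat_swap, Tm.eval_wk]
  constructor
  · intro h' x A hA
    obtain ⟨ϖ, hϖ, hx⟩ := h' A hA
    exact ⟨ϖ, hϖ, hx x⟩
  · exact fun h' A hA => h A fun x => h' x A hA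

theorem sat_probLe_ex (hf : StrictMono f) (hUB : ∀ Ξ χ, UB Ty.Om τ Ξ χ → 𝔐.T Ξ χ)
    (hφ : IsExists φ) (hm : Sat 𝔐.base (mono φ)) :
    Sat 𝔐.base (probLe (Fm.ex τ φ.swap) l) ↔ Sat 𝔐.base (Fm.all τ (probLe φ l.wk)) := by
  have h := exists_forall_of_forall_exists hUB hφ (isMono_of_sat_mono hm)
  have hr : ∀ (x : 𝔐.M.D τ) a, RLt f a ((rsub rone l.wk).eval (x ▹ 𝔐.base)) ↔
      RLt f a ((rsub rone l).eval 𝔐.base) := fun x a => by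
    simp only [RLt, appr_rsub _ hf, appr_rone _ hf, Tm.eval_wk]
  simp only [probLe, Sat, sat_probGe hf, sat_dual, sat_swap, hr, not_exists]
  constructor
  · intro h' x A hA
    obtain ⟨ϖ, hϖ, hx⟩ := h' A hA
    exact ⟨ϖ, hϖ, hx x⟩
  · exact fun h' A hA => h A fun x => h' x A hA

theorem sat_probLe_all (hf : StrictMono f) (hUB : ∀ Ξ χ, UB Ty.Ev τ Ξ χ → 𝔐.T Ξ χ)
    (hφ : IsForall φ) (hm : Sat 𝔐.base (antiMono φ)) :
    Sat 𝔐.base (allRatPos (Fm.ex τ (probLt φ.wkBelow2 (radd l.wk.wk (rrat v1))))) ↔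
      Sat 𝔐.base (probLe (Fm.all τ φ.swap) l) := by
  have h := forall_pos_exists_iff hf hUB hφ.dual (isMono_dual_of_sat_antiMono hm)
    ((rsub rone l).eval 𝔐.base) (rsub rone (radd l.wk (rrat v0))) fun m n => by
      simp only [appr_rsub _ hf, appr_radd _ hf, appr_rone _ hf, appr_rrat _ hf, Tm.eval_wk,
        value_v0, sub_add_eq_sub_sub]
  have hr : ∀ (x : 𝔐.M.D τ) m a,
      RLe f a ((rsub rone (radd l.wk.wk (rrat v1))).eval (x ▹ m ▹ 𝔐.base)) ↔
        RLe f a ((rsub rone (radd l.wk (rrat v0))).eval (m ▹ 𝔐.base)) := fun x m a =>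
    RLe_congr fun n => by
      simp only [appr_rsub _ hf, appr_radd _ hf, appr_rone _ hf, appr_rrat _ hf, Tm.eval_wk,
        value_v0, value_v1]
  simp only [sat_dual] at h
  simp only [sat_allRatPos hf, probLe, probLt, Sat, sat_probGe hf, sat_probGt hf, sat_dual,
    sat_swap, sat_wkBelow2, hr, not_forall]
  exact h

theorem sat_probGe_ex (hf : StrictMono f) (hUB : ∀ Ξ χ, UB Ty.Ev τ Ξ χ → 𝔐.T Ξ χ)
    (hφ : IsExists φ) (hm : Sat 𝔐.base (mono φ)) :
    Sat 𝔐.base (allRatPos (Fm.ex τ (probGt φ.wkBelow2 (rsub l.wk.wk (rrat v1))))) ↔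
      Sat 𝔐.base (probGe (Fm.ex τ φ.swap) l) := by
  have h := forall_pos_exists_iff hf hUB hφ (isMono_of_sat_mono hm)
    (l.eval 𝔐.base) (rsub l.wk (rrat v0)) fun m n => by
      simp only [appr_rsub _ hf, appr_rrat _ hf, Tm.eval_wk, value_v0]
  have hr : ∀ (x : 𝔐.M.D τ) m a,
      RLe f a ((rsub l.wk.wk (rrat v1)).eval (x ▹ m ▹ 𝔐.base)) ↔
        RLe f a ((rsub l.wk (rrat v0)).eval (m ▹ 𝔐.base)) := fun x m a =>
    RLe_congr fun n => by
      simp only [appr_rsub _ hf, appr_rrat _ hf, Tm.eval_wk, value_v0, value_v1]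
  simp only [sat_allRatPos hf, Sat, sat_probGe hf, sat_probGt hf, sat_swap, sat_wkBelow2, hr]
  exact h

end Interchange

end TModel

theorem proves_imp_iff {T : Theory} (hT : ExtendsFP T) {Γ : List Ty} {φ ψ χ : Fm Γ}
    (h : ∀ 𝔐 : TModel Γ, 𝔐.T = T → ∀ (K : Type) [Field K] [LinearOrder K] [IsStrictOrderedRing K]
      (f : 𝔐.Num →+* K), StrictMono f → Sat 𝔐.base φ → (Sat 𝔐.base ψ ↔ Sat 𝔐.base χ)) :
    Proves T (Fm.imp φ (Fm.iff ψ χ)) :=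
  proves_of_forall_tmodel hT fun 𝔐 h𝔐 hφ => by
    obtain ⟨K, _, _, _, f, hf⟩ := exists_ordered_field 𝔐.Num
    exact (TModel.sat_iff _ _ _).2 (h 𝔐 h𝔐 K f hf hφ)

theorem mainTheorem11_general (Γ : List Ty) (τ : Ty) (φ : Fm (Ty.Om :: τ :: Γ))
    (l : Tm Γ one) :
    (IsForall φ →
      Proves (FPUBOm τ) (Fm.imp (antiMono φ)
        (Fm.iff (probGe (Fm.all τ φ.swap) l) (Fm.all τ (probGe φ l.wk)))) ∧
      Proves (FPUBEv τ) (Fm.imp (antiMono φ)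
        (Fm.iff (allRatPos (Fm.ex τ (probLt φ.wkBelow2 (radd l.wk.wk (rrat v1)))))
          (probLe (Fm.all τ φ.swap) l)))) ∧
    (IsExists φ →
      Proves (FPUBOm τ) (Fm.imp (mono φ)
        (Fm.iff (probLe (Fm.ex τ φ.swap) l) (Fm.all τ (probLe φ l.wk)))) ∧
      Proves (FPUBEv τ) (Fm.imp (mono φ)
        (Fm.iff (allRatPos (Fm.ex τ (probGt φ.wkBelow2 (rsub l.wk.wk (rrat v1)))))
          (probGe (Fm.ex τ φ.swap) l)))) := by
  have hOm : ExtendsFP (FPUBOm τ) := fun _ _ => Or.inl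
  have hEv : ExtendsFP (FPUBEv τ) := fun _ _ => Or.inl
  have uOm (𝔐 : TModel Γ) (h : 𝔐.T = FPUBOm τ) Ξ χ (hχ : UB Ty.Om τ Ξ χ) : 𝔐.T Ξ χ := h ▸ Or.inr hχ
  have uEv (𝔐 : TModel Γ) (h : 𝔐.T = FPUBEv τ) Ξ χ (hχ : UB Ty.Ev τ Ξ χ) : 𝔐.T Ξ χ := h ▸ Or.inr hχ
  refine ⟨fun hφ => ⟨?_, ?_⟩, fun hφ => ⟨?_, ?_⟩⟩
  · exact proves_imp_iff hOm fun 𝔐 h _ _ _ _ _ hf => TModel.sat_probGe_all l hf (uOm 𝔐 h) hφ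
  · exact proves_imp_iff hEv fun 𝔐 h _ _ _ _ _ hf => TModel.sat_probLe_all l hf (uEv 𝔐 h) hφ
  · exact proves_imp_iff hOm fun 𝔐 h _ _ _ _ _ hf => TModel.sat_probLe_ex l hf (uOm 𝔐 h) hφ
  · exact proves_imp_iff hEv fun 𝔐 h _ _ _ _ _ hf => TModel.sat_probGe_ex l hf (uEv 𝔐 h) hφ

end FinType

open FinType in
theorem mainTheorem11 (Γ : List Ty) (τ : Ty) (hτ : IsPure τ)
    (φ : Fm (Ty.Om :: τ :: Γ)) (l : Tm Γ one) :
    (IsForall φ →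
      Proves (FPUBOm τ) (Fm.imp (antiMono φ)
        (Fm.iff (probGe (Fm.all τ φ.swap) l) (Fm.all τ (probGe φ l.wk)))) ∧
      Proves (FPUBEv τ) (Fm.imp (antiMono φ)
        (Fm.iff (allRatPos (Fm.ex τ (probLt φ.wkBelow2 (radd l.wk.wk (rrat v1)))))
          (probLe (Fm.all τ φ.swap) l)))) ∧
    (IsExists φ →
      Proves (FPUBOm τ) (Fm.imp (mono φ)
        (Fm.iff (probLe (Fm.ex τ φ.swap) l) (Fm.all τ (probLe φ l.wk)))) ∧
      Proves (FPUBEv τ) (Fm.imp (mono φ)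
        (Fm.iff (allRatPos (Fm.ex τ (probGt φ.wkBelow2 (rsub l.wk.wk (rrat v1)))))
          (probGe (Fm.ex τ φ.swap) l)))) :=
  mainTheorem11_general Γ τ φ l
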